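/- Write $\log x=\max\{1,\log_2 x\}$; $n=2^N\ge 2$, $p$ and all other numbers of processing elements are powers of two. **Machine and cost.** A static algorithm (for a given input size) on $M(v)$ is a fixed sequence of supersteps with labels in $[0,\log_2 v)$. In a superstep each of the $v$ processing elements evaluates DAG nodes whose operands it holds (initial input, own result, or received in an earlier superstep) and then sends constant-size messages (one node value it holds, or a dummy); in an $i$-superstep messages are exchanged only between indices agreeing in their $i$ most significant bits. Folding $A$ on $M(p)$, $p\le v$, lets processor $j$ carry out the $v/p$ consecutive processing elements starting with $jv/p$; supersteps with label $\ge\log_2 p$ become local computation. Let $S^i_A$ be the number of $i$-supersteps and $F^i_A(n,p)$ the sum, over the $i$-supersteps of the folding on $p$ processors, of the degree $h$ (maximum number of messages sent or received by a processor to/from other processors). Put $$H_A(n,p,\sigma)=\sum_{i<\log_2 p}\bigl(F^i_A(n,p)+S^i_A\,\sigma\bigr),\qquad D_A(n,p,\mathbf g,\boldsymbol\ell)=\sum_{i<\log_2 p}\bigl(F^i_A(n,p)\,g_i+S^i_A\,\ell_i\bigr).$$ $A$ is $(\alpha,n)$-wise if $\sum_{i<j}F^i_A(n,2^j)\ge\alpha\frac{n}{2^j}\sum_{i<j}F^i_A(n,n)$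 for $1\le j\le\log_2 n$. **Problem and class.** The $(n,1)$-stencil problem is to evaluate the DAG with nodes $\langle x,t\rangle$, $0\le x,t<n$, and arcs $\langle x,t\rangle\to\langle x+\delta,t+1\rangle$, $\delta\in\{0,\pm1\}$ (whenever both nodes exist). For a constant $\varepsilon<1$, $\mathscr C_1$ is the class of static algorithms for this problem that evaluate each node exactly once, in which no processing element evaluates more than $\varepsilon n^2$ nodes, and all of whose foldings on at least two processing elements have these properties too (so $\mathscr C_1$ is empty for $\varepsilon<1/2$). An algorithm $B\in\mathscr C_1$ on $p$ processing elements is $\beta$-optimal, $0<\beta\le 1$, on $M(p,\sigma)$ (on D-BSP$(p,\mathbf g,\boldsymbol\ell)$) if $H_B\le\frac1\beta H_{B'}$ (if $D_B\le\frac1\beta D_{B'}$) for all $B'\in\mathscr C_1$ on $p$ processing elements. **The algorithm** $A$ is specified on $M(n)$; the inputs $\langle x,0\rangle$ are initially placed one per virtual processor, in an arbitrary way. Let $k=2^{\lceil\sqrt{\log n}\rceil}$, $u=x+t+\frac n2$, $v=t-x+\frac{3n}2$. The grid is covered by the five squares (diamonds, full or truncated) $[an,(a+1)n)\times[bn,(b+1)n)$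 of the $(u,v)$-plane with $(a,b)=(0,1),(1,0),(1,1),(1,2),(2,1)$, evaluated in this order in five stages, each started by a $0$-superstep. A diamond of extent $m>1$ (in $u$ and in $v$), assigned to a segment of $m$ virtual processors, is cut into $q\times q$ diamonds of extent $m/q$, $q=\min\{k,m\}$; its $2q-1$ stripes $a+b=r$ are evaluated in $2q-1$ successive phases, in each of which the diamonds $(a,b)$ of the stripe are evaluated recursively and in parallel, $(a,b)$ by the $a$-th subsegment of $m/q$ virtual processors. Each phase starts with a superstep of label $\log_2(n/m)$ that supplies the inputs of its diamonds and spreads the outputs of previously evaluated ones, the boundary values of a diamond of extent $m$ being kept evenly distributed over its $m$ virtual processors. Diamonds of extent $1$ contain at most one node, which is evaluated locally. In every superstep dummy messages are added to the virtual processor whose index differs only in the bit given by the label, so that each virtual processor sends the same number of messages, twice the degree of the relation formed by the non-dummy messages. A last $0$-superstep ends the execution. **Theorem.** $A$ is a static algorithm for the $(n,1)$-stencil problem specified on $M(n)$, independent of $p,\sigma,\mathbf g,\boldsymbol\ell$; it belongs to $\mathscr C_1$ (even with $\varepsilon=1/2$), and the following holds, uniformly in the placement of the inputs. 1. For every constant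 $c\ge0$: $H_A(n,p,\sigma)=O\bigl(n4^{\sqrt{\log n}}\bigr)$ for all $1<p\le n$ and $0\le\sigma\le c\,n/p$. 2. $A$ is $(\alpha,n)$-wise for a constant $\alpha\in(0,1]$. 3. For all constants $\varepsilon\in[1/2,1)$ and $c\ge0$ there is a constant $b>0$ such that (the folding on $p$ processors of) $A$ belongs to $\mathscr C_1$ and is $b/4^{\sqrt{\log n}}$-optimal with respect to $\mathscr C_1$ on every $M(p,\sigma)$ with $1<p\le n$ and $0\le\sigma\le c\,n/p$. 4. For all constants $\varepsilon\in[1/2,1)$ and $c\ge0$ there is a constant $b>0$ such that $A$ is $b/4^{\sqrt{\log n}}$-optimal with respect to $\mathscr C_1$ on every D-BSP$(p,\mathbf g,\boldsymbol\ell)$ with $1<p\le n$, $g_i>0$, $\ell_i\ge0$, non-increasing $g_i$ and $\ell_i/g_i$, and $\ell_0/g_0\le c\,n/p$. -/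

import Mathlib

/-- The logarithm used throughout: `log x = max {1, log₂ x}`. -/
noncomputable def lg (x : ℝ) : ℝ := max 1 (Real.logb 2 x)

/-! ## Static algorithms on the machine with `2 ^ Q` processing elements -/

/-- A static algorithm, for one fixed input size, on the machine `M(2 ^ Q)`, for the evaluation of a
DAG with node set `V`: a sequence of `len` labelled supersteps. In superstep `s`, processing element
`r` first evaluates the DAG nodes in `eval s r` and then sends the messages `sent s r r'` to `r'`;
these can be used by `r'` only in later supersteps. A message of constant size is either the value of
one DAG node (`some w`) or a dummy (`none`).

An `i`-superstep with `i < Q` ends with a barrier inside every `i`-cluster. A step with label `i ≥ Q`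
is a piece of local computation: its clusters consist of a single processing element, it contains no
barrier, and it is never charged. Such steps are what folding makes of the supersteps that are
internal to a processing element of the smaller machine. -/
structure StaticAlg (V : Type) (Q : ℕ) where
  len : ℕ
  label : Fin len → ℕ
  eval : Fin len → Fin (2 ^ Q) → Finset V
  sent : Fin len → Fin (2 ^ Q) → Fin (2 ^ Q) → Multiset (Option V)

/-- Number of messages that `r` sends to other processing elements. -/
def outDegree {M : Type} {q : ℕ} (msg : Fin q → Fin q → Multiset M) (r : Fin q) : ℕ :=
  ∑ r' ∈ Finset.univ.erase r, (msg r r').card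

/-- Number of messages that `r` receives from other processing elements. -/
def inDegree {M : Type} {q : ℕ} (msg : Fin q → Fin q → Multiset M) (r : Fin q) : ℕ :=
  ∑ r' ∈ Finset.univ.erase r, (msg r' r).card

/-- The least `h` such that the messages form an `h`-relation. -/
def relationDegree {M : Type} {q : ℕ} (msg : Fin q → Fin q → Multiset M) : ℕ :=
  Finset.univ.sup fun r => max (outDegree msg r) (inDegree msg r)

namespace StaticAlg

variable {V : Type} {Q : ℕ}

/-- A genuine specification on `M(2 ^ Q)`: there is a last superstep (so the execution ends with a
barrier), and every step is a superstep with a label in `[0, Q)`. -/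
def IsSpecification (A : StaticAlg V Q) : Prop :=
  0 < A.len ∧ ∀ s, A.label s < Q

/-- The value of node `w` is at the disposal of `r` when `r` sends its messages in superstep `s`:
`r` has evaluated `w`, or it has received the value in an earlier superstep. -/
def Knows (A : StaticAlg V Q) (s : Fin A.len) (r : Fin (2 ^ Q)) (w : V) : Prop :=
  w ∈ A.eval s r ∨ ∃ s' < s, w ∈ A.eval s' r ∨ ∃ r', some w ∈ A.sent s' r' r

/-- `A` correctly evaluates the DAG with arc relation `arc`: every node is evaluated, a node is
evaluated only where its operands are available, only available values are sent, and messages of an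
`i`-superstep stay inside the `i`-clusters (the sets of indices that share their `i` most significant
bits). Nodes of indegree `0` are the inputs, which are read where they are evaluated. -/
structure Evaluates (arc : V → V → Prop) (A : StaticAlg V Q) : Prop where
  complete : ∀ w, ∃ s r, w ∈ A.eval s r
  operands : ∀ s r w, w ∈ A.eval s r → ∀ w', arc w' w → A.Knows s r w'
  messages : ∀ s r r' w, some w ∈ A.sent s r r' → A.Knows s r w
  clusters : ∀ s r r', A.sent s r r' ≠ 0 →
    r.val / 2 ^ (Q - A.label s) = r'.val / 2 ^ (Q - A.label s)

/-- No recomputation: each node is evaluated exactly once. -/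
def EvaluatesOnce (A : StaticAlg V Q) : Prop :=
  ∀ w, ∃! sr : Fin A.len × Fin (2 ^ Q), w ∈ A.eval sr.1 sr.2

/-- The number of node evaluations that `r` performs. -/
def work (A : StaticAlg V Q) (r : Fin (2 ^ Q)) : ℕ :=
  ∑ s, (A.eval s r).card

/-- The virtual processors of `M(2 ^ Q)` that processor `R` of `M(2 ^ j)` carries out. -/
def block (Q j : ℕ) (R : Fin (2 ^ j)) : Finset (Fin (2 ^ Q)) :=
  Finset.univ.filter fun r => r.val / 2 ^ (Q - j) = R.val

/-- The folding of an `M(2 ^ Q)`-algorithm on `M(2 ^ j)`, `j ≤ Q`. -/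
def fold [DecidableEq V] (A : StaticAlg V Q) (j : ℕ) : StaticAlg V j where
  len := A.len
  label := A.label
  eval s R := (block Q j R).biUnion fun r => A.eval s r
  sent s R R' := ∑ r ∈ block Q j R, ∑ r' ∈ block Q j R', A.sent s r r'

/-- `S^i`: the number of `i`-supersteps. -/
def S (A : StaticAlg V Q) (i : ℕ) : ℕ :=
  (Finset.univ.filter fun s => A.label s = i).card

/-- `F^i`: the cumulative degree of all `i`-supersteps. -/
def F (A : StaticAlg V Q) (i : ℕ) : ℕ :=
  ∑ s ∈ Finset.univ.filter (fun s => A.label s = i), relationDegree (A.sent s)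

/-- The communication complexity on the evaluation model `M(2 ^ Q, σ)`. -/
def H (A : StaticAlg V Q) (σ : ℝ) : ℝ :=
  ∑ i ∈ Finset.range Q, ((A.F i : ℝ) + (A.S i : ℝ) * σ)

/-- The communication time on the execution machine model `D-BSP(2 ^ Q, g, ℓ)`. -/
def D (A : StaticAlg V Q) (g ℓ : ℕ → ℝ) : ℝ :=
  ∑ i ∈ Finset.range Q, ((A.F i : ℝ) * g i + (A.S i : ℝ) * ℓ i)

/-- `(α, 2 ^ P)`-wiseness (at the input size for which `A` is given). -/
def Wise [DecidableEq V] (A : StaticAlg V Q) (α : ℝ) (P : ℕ) : Prop :=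
  ∀ j, 1 ≤ j → j ≤ P →
    α * ((2 : ℝ) ^ P / 2 ^ j) * ∑ i ∈ Finset.range j, ((A.fold P).F i : ℝ)
      ≤ ∑ i ∈ Finset.range j, ((A.fold j).F i : ℝ)

/-- `B` is `β`-optimal on `M(2 ^ Q, σ)` with respect to the class `C`. -/
def OptimalOnM (C : StaticAlg V Q → Prop) (β σ : ℝ) (B : StaticAlg V Q) : Prop :=
  0 < β ∧ β ≤ 1 ∧ C B ∧ ∀ B', C B' → B.H σ ≤ 1 / β * B'.H σ

/-- `B` is `β`-optimal on `D-BSP(2 ^ Q, g, ℓ)` with respect to the class `C`. -/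
def OptimalOnDBSP (C : StaticAlg V Q → Prop) (β : ℝ) (g ℓ : ℕ → ℝ) (B : StaticAlg V Q) : Prop :=
  0 < β ∧ β ≤ 1 ∧ C B ∧ ∀ B', C B' → B.D g ℓ ≤ 1 / β * B'.D g ℓ

end StaticAlg

/-! ## The `(n, 1)`-stencil problem and the class `C₁` -/

/-- The node `⟨x, t⟩`: grid element `x` at time step `t`. -/
abbrev StencilNode (n : ℕ) : Type := Fin n × Fin n

/-- The arcs `⟨x, t⟩ → ⟨x + δ, t + 1⟩`, `δ ∈ {0, 1, -1}`. -/
def StencilArc {n : ℕ} (a b : StencilNode n) : Prop :=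
  b.2.val = a.2.val + 1 ∧ b.1.val ≤ a.1.val + 1 ∧ a.1.val ≤ b.1.val + 1

instance {n : ℕ} (a b : StencilNode n) : Decidable (StencilArc a b) := by
  unfold StencilArc; infer_instance

/-- `A` solves the `(n, 1)`-stencil problem without recomputation, and no processing element computes
more than `ε n ^ 2` nodes. -/
structure StencilAdmissible {n Q : ℕ} (ε : ℝ) (A : StaticAlg (StencilNode n) Q) : Prop where
  evaluates : A.Evaluates StencilArc
  once : A.EvaluatesOnce
  balanced : ∀ r, (A.work r : ℝ) ≤ ε * (n : ℝ) ^ 2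

/-- The class `C₁`, with work-balance constant `ε`, on `2 ^ Q` processing elements: the algorithm and
all its foldings on `2 ≤ 2 ^ j < 2 ^ Q` processing elements are admissible. -/
def ClassC1 {n Q : ℕ} (ε : ℝ) (A : StaticAlg (StencilNode n) Q) : Prop :=
  StencilAdmissible ε A ∧ ∀ j, 1 ≤ j → j < Q → StencilAdmissible ε (A.fold j)

/-! ## The network-oblivious algorithm

Here `n = 2 ^ N`, the algorithm uses `n` virtual processors, and the recursion splits a diamond into
`k × k` smaller ones, with `k = 2 ^ κ`.

In the rotated coordinates `u = x + t + n / 2` and `v = t - x + 3 n / 2` the arcs lead from `(u, v)` to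
`(u + 2, v)`, `(u + 1, v + 1)` and `(u, v + 2)`, and diamonds are squares. The diamond of level `0` with
index `(a, b)` is the square `[a n, (a + 1) n) × [b n, (b + 1) n)`; the `n × n` grid of the stencil is
covered by five of them, one full diamond `(1, 1)` in the centre and the truncated ones `(0, 1)`,
`(1, 0)`, `(1, 2)`, `(2, 1)` at the four corners. A diamond of level `i` is cut into diamonds of level
`i + 1`, of extent `n / k ^ (i + 1)`, or `1` if this is smaller, so the last level consists of squares
with at most one node. -/

namespace DiamondStencil

/-- The extent of a diamond of level `i`, which is also the number of virtual processors assigned to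
it: `n / k ^ i`, or `1` if this is smaller. -/
def ext (N κ i : ℕ) : ℕ := 2 ^ (N - i * κ)

/-- The number `⌈N / κ⌉` of levels of the recursion: the first level of extent `1`. -/
def depth (N κ : ℕ) : ℕ := (N + κ - 1) / κ

/-- The rotated coordinate `x + t + n / 2`. -/
def uCoord (N : ℕ) (w : StencilNode (2 ^ N)) : ℕ := w.1.val + w.2.val + 2 ^ N / 2

/-- The rotated coordinate `t - x + 3 n / 2`. -/
def vCoord (N : ℕ) (w : StencilNode (2 ^ N)) : ℕ := 2 ^ N + 2 ^ N / 2 + w.2.val - w.1.val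

/-- The stage in which the level-`0` diamond of `w` is evaluated: `(0, 1)`, `(1, 0)`, `(1, 1)`, `(1, 2)`,
`(2, 1)` are evaluated in stages `0`, `1`, `2`, `3`, `4`. -/
def stage (N : ℕ) (w : StencilNode (2 ^ N)) : ℕ :=
  2 * (uCoord N w / 2 ^ N) + vCoord N w / 2 ^ N - 1

/-- The horizontal stripe, inside the level-`i` diamond of `w`, that contains the level-`(i + 1)`
diamond of `w`: if the latter has index `(a, b)` in the former, this is `a + b`. -/
def stripe (N κ : ℕ) (w : StencilNode (2 ^ N)) (i : ℕ) : ℕ :=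
  uCoord N w % ext N κ i / ext N κ (i + 1) + vCoord N w % ext N κ i / ext N κ (i + 1)

/-- The phase of level `i` in which the level-`i` diamond of `w` is evaluated, as the list of the stage
and the stripe numbers. -/
def phase (N κ : ℕ) (w : StencilNode (2 ^ N)) (i : ℕ) : List ℕ :=
  stage N w :: (List.range i).map (stripe N κ w)

/-- The virtual processor that evaluates `w`: the diamond of index `(a, b)` in its parent is assigned to
the `a`-th segment of the virtual processors of the parent, on every level. -/
def home (N : ℕ) (w : StencilNode (2 ^ N)) : ℕ := uCoord N w % 2 ^ N

/-- Even distribution of the boundary values of a level-`i` diamond over its segment of virtual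
processors: values that enter the level-`i` diamond of `w` from the neighbouring segment to be used for
`w`, or that leave it with `w` on the boundary, are kept in this virtual processor between the phases
of level `i`. -/
def seat (N κ : ℕ) (w : StencilNode (2 ^ N)) (i : ℕ) : ℕ :=
  (uCoord N w / ext N κ i * ext N κ i + vCoord N w % ext N κ i) % 2 ^ N

/-- The phases, in order, of the recursive evaluation of a diamond of extent `2 ^ e`: with
`q = min {k, 2 ^ e}`, there is one phase for each of the `2 q - 1` stripes, in which the diamonds of the
stripe, of extent `2 ^ e / q`, are evaluated recursively and in parallel. -/
def phases (κ e : ℕ) : List (List ℕ) :=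
  if 0 < κ ∧ 0 < e then
    (List.range (2 * 2 ^ min κ e - 1)).flatMap fun r =>
      [r] :: (phases κ (e - κ)).map (List.cons r)
  else []
termination_by e
decreasing_by omega

/-- All supersteps of the algorithm: each of the five stages starts with one superstep and so does each
phase; a final superstep `[5]` ends the execution. -/
def program (N κ : ℕ) : List (List ℕ) :=
  ((List.range 5).flatMap fun s => [s] :: (phases κ N).map (List.cons s)) ++ [[5]]

/-- The label: `0` for a superstep that starts a stage, `(i - 1) log k` for a superstep that starts a
phase of level `i ≥ 1`. -/
def stepLabel (κ : ℕ) (a : List ℕ) : ℕ := (a.length - 2) * κ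

/-- The level-`i` diamonds of `w` and `w'` belong to different segments of virtual processors, or to
level-`0` diamonds with different first index. -/
def Separated (N κ : ℕ) (w w' : StencilNode (2 ^ N)) (i : ℕ) : Prop :=
  uCoord N w / ext N κ i ≠ uCoord N w' / ext N κ i

instance (N κ : ℕ) (w w' : StencilNode (2 ^ N)) (i : ℕ) : Decidable (Separated N κ w w' i) := by
  unfold Separated; infer_instance

/-- For the arc from `w` to `w'`, the value of `w` moves from virtual processor `y` to `y'` in superstep
`a`. The three cases are: the value leaves the level-`(i + 1)` diamond of `w` and is kept as an output
of its level-`i` diamond; at the start of the phase of the level-`i` diamond of `w'`, the outermost one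
on whose segment `w` does not lie, it becomes an input of that diamond; at the start of the phase of
the level-`(i + 1)` diamond of `w'` it is passed on from the level-`i` diamond to this one. -/
def Hop (N κ : ℕ) (w w' : StencilNode (2 ^ N)) (a : List ℕ) (y y' : ℕ) : Prop :=
  y ≠ y' ∧
    ((∃ i < depth N κ, Separated N κ w w' i ∧ a = phase N κ w i ++ [stripe N κ w i + 1] ∧
        y = seat N κ w (i + 1) ∧ y' = seat N κ w i) ∨
     (∃ i < depth N κ + 1, (Separated N κ w w' i ∧ ∀ j < i, ¬ Separated N κ w w' j) ∧
        a = phase N κ w' i ∧ y = seat N κ w i ∧ y' = seat N κ w' i) ∨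
     (∃ i < depth N κ, Separated N κ w w' i ∧ a = phase N κ w' (i + 1) ∧
        y = seat N κ w' i ∧ y' = seat N κ w' (i + 1)))

instance (N κ : ℕ) (w w' : StencilNode (2 ^ N)) (a : List ℕ) (y y' : ℕ) :
    Decidable (Hop N κ w w' a y y') := by
  unfold Hop; infer_instance

/-- The messages with node values from `y` to `y'` in superstep number `s`. The input `⟨x, 0⟩` is given
in the virtual processor `π x`; superstep number `0` also brings the inputs to the virtual processors
that need them. -/
def values (N κ : ℕ) (π : Equiv.Perm (Fin (2 ^ N))) (s : ℕ) (y y' : Fin (2 ^ N)) :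
    Multiset (Option (StencilNode (2 ^ N))) :=
  (Finset.univ.filter fun e : StencilNode (2 ^ N) × StencilNode (2 ^ N) =>
      StencilArc e.1 e.2 ∧ Hop N κ e.1 e.2 ((program N κ).getD s []) y y').val.map
    (fun e => some e.1) +
  (Finset.univ.filter fun w : StencilNode (2 ^ N) =>
      s = 0 ∧ w.2.val = 0 ∧ π w.1 = y ∧ home N w = y' ∧ y ≠ y').val.map some

/-- The dummy messages of superstep number `s`, which make all virtual processors send the same number
of messages, twice the degree of the relation formed by the messages with node values: in a superstep
with label `i`, they are sent to the virtual processor whose index differs in bit `i` only, counted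
from the most significant bit. -/
def dummies (N κ : ℕ) (π : Equiv.Perm (Fin (2 ^ N))) (s : ℕ) (y y' : Fin (2 ^ N)) :
    Multiset (Option (StencilNode (2 ^ N))) :=
  if y'.val = y.val ^^^ 2 ^ (N - 1 - stepLabel κ ((program N κ).getD s [])) then
    Multiset.replicate
      (2 * relationDegree (values N κ π s) - outDegree (values N κ π s) y) none
  else 0

/-- The algorithm with recursion degree `k = 2 ^ κ` and inputs placed by `π`. A node that is not an input
is evaluated right after the superstep that starts the phase of its one-node diamond. -/
def alg (N κ : ℕ) (π : Equiv.Perm (Fin (2 ^ N))) : StaticAlg (StencilNode (2 ^ N)) N where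
  len := (program N κ).length
  label s := stepLabel κ ((program N κ).getD s.val [])
  eval s y := Finset.univ.filter fun w =>
    if w.2.val = 0 then s.val = 0 ∧ π w.1 = y
    else 0 < s.val ∧ (program N κ).getD (s.val - 1) [] = phase N κ w (depth N κ) ∧ home N w = y
  sent s y y' := values N κ π s.val y y' + dummies N κ π s.val y y'

end DiamondStencil

/-- The network-oblivious algorithm for the `(n, 1)`-stencil problem, specified on `M(n)` for `n = 2 ^ N`,
with recursion degree `k = 2 ^ ⌈√(log n)⌉`. The input `⟨x, 0⟩` is initially in virtual processor `π x`. -/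
noncomputable def stencilAlg (N : ℕ) (π : Equiv.Perm (Fin (2 ^ N))) :
    StaticAlg (StencilNode (2 ^ N)) N :=
  DiamondStencil.alg N ⌈√(lg (2 ^ N))⌉₊ π

/-! ### Partial sums of degrees, and the folding of an algorithm -/

namespace StaticAlg

variable {V : Type} {Q : ℕ}

/-! The optimality rests on two estimates, for each `m ≤ log₂ p`, of what happens in labels below
`m`. The algorithm has at most `12 · 2^m · 4^√(log n)` such supersteps (`sum_S_stencilAlg_le`), each
of degree at most `57` on `M(n)` and so at most `57 n / p` after folding on `p` processors. Every
member of the class on `p` processors has, in these labels, total degree at least a constant times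
`n · 2^m / p` (`ClassC1.le_sum_F`). The quotient is `O(4^√(log n))` for every `m`, so summation by
parts against the non-increasing `g` compares the communication times; latencies are absorbed
because `ℓ i / g i = O(n / p)`. `M(p, σ)` is the case `g = 1`, `ℓ = σ`.

Since folding from `p` to `2^m` processors multiplies degrees by at most `p / 2^m`, the lower bound
only has to say that the total degree `T` is `Ω(n)` on every machine (`StencilAdmissible.le_sum_F`).
Let `T` be a small fraction of `n`. At most `2 T` nodes are tails of arcs that cross the boundary of
the set evaluated by one processor. If this set and its complement both had more than `2 T n` nodes,
each would contain a whole column, and every row but the last would have a crossing node, so `n ≤ 2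
T + 1`. By the balance condition every processor therefore evaluates at most `2 T n` nodes. Now
descend from the last row. A run of `k` nodes of one processor on a line is doubled by a transversal
of length `2 k`, unless a value enters along each of the `k` transversals. In that case the
processor has received `k` values since the earliest of them was evaluated, at most `4 k` rows below
the start, and the descent continues from that earliest node with a strictly earlier budget. Runs
cannot grow to length `n / 16`, because one processor would then evaluate too large an area. Hence
`4 k` rows always cost `k` units of degree, and `T = Ω(n)` (`GridSchedule.le_cost`).

For the algorithm, supersteps are lists of stage and stripe numbers in lexicographic order, which is
compatible with the dependencies (`phase_append_lt`). The value carried by an arc that changes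
segment climbs to the outermost level separating its ends, crosses there, and descends again
(`heldAfter_exit`, `heldAfter_phase`). A seat takes its segment from `u` and its offset from `v`. An
arc raises `u` by at most `2`, so superstep, kind of move, processor and a six-valued code determine
the arc, and the degree is at most `3 · 6 + 1` (`relationDegree_values_le`). The dummies cross every
block boundary that the label allows, which gives wiseness (`alg_wise`). -/

theorem sum_range_F (A : StaticAlg V Q) (j : ℕ) :
    ∑ i ∈ Finset.range j, A.F i =
      ∑ s ∈ Finset.univ.filter (fun s => A.label s < j), relationDegree (A.sent s) := by
  unfold F
  rw [← Finset.sum_fiberwise_of_maps_to (s := Finset.univ.filter (fun s => A.label s < j))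
    (t := Finset.range j) (g := A.label) (by intro s hs; simpa using hs)]
  refine Finset.sum_congr rfl fun i hi => Finset.sum_congr ?_ fun _ _ => rfl
  ext s
  simp only [Finset.mem_filter, Finset.mem_univ, true_and, Finset.mem_range] at hi ⊢
  constructor
  · intro h; exact ⟨h ▸ hi, h⟩
  · exact fun h => h.2

theorem sum_range_S (A : StaticAlg V Q) (j : ℕ) :
    ∑ i ∈ Finset.range j, A.S i = (Finset.univ.filter (fun s => A.label s < j)).card := by
  unfold S
  rw [Finset.card_eq_sum_card_fiberwise (f := A.label) (t := Finset.range j)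
    (by intro s hs; simpa using hs)]
  refine Finset.sum_congr rfl fun i hi => congrArg _ ?_
  ext s
  simp only [Finset.mem_filter, Finset.mem_univ, true_and, Finset.mem_range] at hi ⊢
  constructor
  · intro h; exact ⟨h ▸ hi, h⟩
  · exact fun h => h.2

theorem mem_block {j : ℕ} {R : Fin (2 ^ j)} {r : Fin (2 ^ Q)} :
    r ∈ block Q j R ↔ r.val / 2 ^ (Q - j) = R.val := by
  simp [block]

/-- The processor of `M(2 ^ j)` that carries out the virtual processor `r`. -/
def blockOf {j : ℕ} (hj : j ≤ Q) (r : Fin (2 ^ Q)) : Fin (2 ^ j) :=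
  ⟨r.val / 2 ^ (Q - j), by
    rw [Nat.div_lt_iff_lt_mul (by positivity), ← pow_add]
    have := r.isLt
    rwa [Nat.add_sub_cancel' hj]⟩

theorem mem_block_iff_blockOf {j : ℕ} (hj : j ≤ Q) {R : Fin (2 ^ j)} {r : Fin (2 ^ Q)} :
    r ∈ block Q j R ↔ blockOf hj r = R := by
  rw [mem_block, Fin.ext_iff]; rfl

theorem mem_block_blockOf {j : ℕ} (hj : j ≤ Q) (r : Fin (2 ^ Q)) :
    r ∈ block Q j (blockOf hj r) := (mem_block_iff_blockOf hj).2 rfl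

theorem card_block {j : ℕ} (hj : j ≤ Q) (R : Fin (2 ^ j)) :
    (block Q j R).card = 2 ^ (Q - j) := by
  have hQ : 2 ^ Q = 2 ^ j * 2 ^ (Q - j) := by rw [← pow_add, Nat.add_sub_cancel' hj]
  have h : (block Q j R).map Fin.valEmbedding =
      Finset.Ico (R.val * 2 ^ (Q - j)) (R.val * 2 ^ (Q - j) + 2 ^ (Q - j)) := by
    ext y
    simp only [Finset.mem_map, Fin.valEmbedding_apply, Finset.mem_Ico, mem_block]
    have hp : 0 < 2 ^ (Q - j) := by positivity
    constructor
    · rintro ⟨r, hr, rfl⟩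
      rw [← hr]
      have := Nat.div_add_mod r.val (2 ^ (Q - j))
      have := Nat.mod_lt r.val hp
      rw [mul_comm]
      have := Nat.mul_div_le r.val (2 ^ (Q - j))
      constructor <;> linarith
    · rintro ⟨h1, h2⟩
      have hy : y < 2 ^ Q := by
        have := R.isLt
        rw [hQ]
        calc y < (R.val + 1) * 2 ^ (Q - j) := by linarith
          _ ≤ _ := Nat.mul_le_mul_right _ this
      refine ⟨⟨y, hy⟩, ?_, rfl⟩
      exact Nat.div_eq_of_lt_le h1 (by linarith)
  rw [← Finset.card_map Fin.valEmbedding, h, Nat.card_Ico, Nat.add_sub_cancel_left]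

theorem pairwiseDisjoint_block {j : ℕ} (s : Set (Fin (2 ^ j))) :
    s.PairwiseDisjoint (block Q j) := by
  intro R _ R' _ h
  refine Finset.disjoint_left.2 fun r hr hr' => h ?_
  rw [mem_block] at hr hr'
  exact Fin.ext (hr.symm.trans hr')

theorem outDegree_le_relationDegree {M : Type} {q : ℕ} (msg : Fin q → Fin q → Multiset M)
    (r : Fin q) : outDegree msg r ≤ relationDegree msg :=
  (le_max_left _ _).trans (Finset.le_sup (f := fun r => max (outDegree msg r) (inDegree msg r))
    (Finset.mem_univ r))

theorem inDegree_le_relationDegree {M : Type} {q : ℕ} (msg : Fin q → Fin q → Multiset M)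
    (r : Fin q) : inDegree msg r ≤ relationDegree msg :=
  (le_max_right _ _).trans (Finset.le_sup (f := fun r => max (outDegree msg r) (inDegree msg r))
    (Finset.mem_univ r))

theorem inDegree_eq_outDegree {M : Type} {q : ℕ} (msg : Fin q → Fin q → Multiset M)
    (r : Fin q) : inDegree msg r = outDegree (fun a b => msg b a) r := rfl

theorem relationDegree_le {M : Type} {q : ℕ} {msg : Fin q → Fin q → Multiset M} {d : ℕ}
    (h : ∀ r, outDegree msg r ≤ d) (h' : ∀ r, inDegree msg r ≤ d) : relationDegree msg ≤ d :=
  Finset.sup_le fun r _ => max_le (h r) (h' r)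

theorem outDegree_fold {M : Type} (msg : Fin (2 ^ Q) → Fin (2 ^ Q) → Multiset M) (j : ℕ)
    (R : Fin (2 ^ j)) :
    outDegree (fun R R' : Fin (2 ^ j) => ∑ r ∈ block Q j R, ∑ r' ∈ block Q j R', msg r r') R =
      ∑ r ∈ block Q j R, ∑ r' ∈ (Finset.univ.erase R).biUnion (block Q j), (msg r r').card := by
  unfold outDegree
  simp only [Multiset.card_sum]
  rw [Finset.sum_comm]
  exact Finset.sum_congr rfl fun r _ => (Finset.sum_biUnion (pairwiseDisjoint_block _)).symm

theorem outDegree_fold_le {M : Type} (msg : Fin (2 ^ Q) → Fin (2 ^ Q) → Multiset M) {j d : ℕ}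
    (hj : j ≤ Q) (hd : ∀ r, outDegree msg r ≤ d) (R : Fin (2 ^ j)) :
    outDegree (fun R R' : Fin (2 ^ j) => ∑ r ∈ block Q j R, ∑ r' ∈ block Q j R', msg r r') R ≤
      2 ^ (Q - j) * d := by
  rw [outDegree_fold, ← card_block hj R, ← smul_eq_mul]
  refine Finset.sum_le_card_nsmul _ _ _ fun r hr => le_trans ?_ (hd r)
  refine Finset.sum_le_sum_of_subset fun r' hr' => ?_
  simp only [Finset.mem_biUnion, Finset.mem_erase, Finset.mem_univ, and_true] at hr' ⊢
  obtain ⟨R', hR', h⟩ := hr'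
  rintro rfl
  rw [mem_block] at hr h
  exact hR' (Fin.ext (h.symm.trans hr))

/-- Each block consists of `2 ^ (Q - j)` virtual processors, and messages inside a block no longer
count. This inequality transports the lower bound from coarse machines to fine ones. -/
theorem relationDegree_fold_le [DecidableEq V] (A : StaticAlg V Q) {j : ℕ} (hj : j ≤ Q)
    (s : Fin A.len) :
    relationDegree ((A.fold j).sent s) ≤ 2 ^ (Q - j) * relationDegree (A.sent s) := by
  refine relationDegree_le (fun R => outDegree_fold_le _ hj (outDegree_le_relationDegree _) R)
    fun R => ?_
  have h := outDegree_fold_le (fun a b => A.sent s b a) hj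
    (fun r => inDegree_le_relationDegree (A.sent s) r) R
  rw [inDegree_eq_outDegree]
  refine le_trans (le_of_eq ?_) h
  unfold outDegree
  refine Finset.sum_congr rfl fun R' _ => ?_
  simp only [fold]
  rw [Finset.sum_comm]

theorem sum_range_F_fold_le [DecidableEq V] (A : StaticAlg V Q) {j : ℕ} (hj : j ≤ Q) (i : ℕ) :
    ∑ k ∈ Finset.range i, (A.fold j).F k ≤ 2 ^ (Q - j) * ∑ k ∈ Finset.range i, A.F k := by
  rw [sum_range_F, sum_range_F, Finset.mul_sum]
  exact Finset.sum_le_sum fun s _ => relationDegree_fold_le A hj s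

theorem mem_fold_eval [DecidableEq V] (A : StaticAlg V Q) {j : ℕ} (hj : j ≤ Q) {s : Fin A.len}
    {R : Fin (2 ^ j)} {w : V} :
    w ∈ (A.fold j).eval s R ↔ ∃ r, blockOf hj r = R ∧ w ∈ A.eval s r := by
  simp [fold, mem_block_iff_blockOf hj]

theorem mem_fold_sent [DecidableEq V] (A : StaticAlg V Q) {j : ℕ} (hj : j ≤ Q) {s : Fin A.len}
    {R R' : Fin (2 ^ j)} {m : Option V} :
    m ∈ (A.fold j).sent s R R' ↔
      ∃ r r', blockOf hj r = R ∧ blockOf hj r' = R' ∧ m ∈ A.sent s r r' := by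
  simp only [fold, Multiset.mem_sum, mem_block_iff_blockOf hj]
  constructor
  · rintro ⟨r, h, r', h', hm⟩; exact ⟨r, r', h, h', hm⟩
  · rintro ⟨r, r', h, h', hm⟩; exact ⟨r, h, r', h', hm⟩

theorem Knows.fold [DecidableEq V] {A : StaticAlg V Q} {j : ℕ} (hj : j ≤ Q) {s : Fin A.len}
    {r : Fin (2 ^ Q)} {w : V} (h : A.Knows s r w) : (A.fold j).Knows s (blockOf hj r) w := by
  rcases h with h | ⟨s', hs, h | ⟨r', h⟩⟩
  · exact Or.inl ((mem_fold_eval A hj).2 ⟨r, rfl, h⟩)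
  · exact Or.inr ⟨s', hs, Or.inl ((mem_fold_eval A hj).2 ⟨r, rfl, h⟩)⟩
  · exact Or.inr ⟨s', hs, Or.inr ⟨_, (mem_fold_sent A hj).2 ⟨r', r, rfl, rfl, h⟩⟩⟩

theorem Evaluates.fold [DecidableEq V] {arc : V → V → Prop} {A : StaticAlg V Q}
    (hA : A.Evaluates arc) {j : ℕ} (hj : j ≤ Q) : (A.fold j).Evaluates arc where
  complete w := by
    obtain ⟨s, r, h⟩ := hA.complete w
    exact ⟨s, _, (mem_fold_eval A hj).2 ⟨r, rfl, h⟩⟩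
  operands s R w hw w' ha := by
    obtain ⟨r, rfl, h⟩ := (mem_fold_eval A hj).1 hw
    exact (hA.operands s r w h w' ha).fold hj
  messages s R R' w hw := by
    obtain ⟨r, r', rfl, -, h⟩ := (mem_fold_sent A hj).1 hw
    exact (hA.messages s r r' w h).fold hj
  clusters s R R' h := by
    obtain ⟨m, hm⟩ := Multiset.exists_mem_of_ne_zero h
    obtain ⟨r, r', rfl, rfl, h'⟩ := (mem_fold_sent A hj).1 hm
    have hc := hA.clusters s r r' (fun h0 => by rw [h0] at h'; exact Multiset.notMem_zero _ h')
    change r.val / 2 ^ (Q - j) / 2 ^ (j - A.label s) = r'.val / 2 ^ (Q - j) / 2 ^ (j - A.label s)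
    rw [Nat.div_div_eq_div_mul, Nat.div_div_eq_div_mul, ← pow_add]
    -- Truncated subtraction covers both cases: for labels below `j` the last summand vanishes, for
    -- larger labels the block of size `2 ^ (Q - j)` already contains the cluster.
    have : Q - j + (j - A.label s) = (Q - A.label s) + ((Q - j) - (Q - A.label s)) := by omega
    rw [this, pow_add, ← Nat.div_div_eq_div_mul, ← Nat.div_div_eq_div_mul, hc]

theorem EvaluatesOnce.fold [DecidableEq V] {A : StaticAlg V Q} (hA : A.EvaluatesOnce) {j : ℕ}
    (hj : j ≤ Q) : (A.fold j).EvaluatesOnce := by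
  intro w
  obtain ⟨⟨s, r⟩, h, hu⟩ := hA w
  refine ⟨(s, blockOf hj r), (mem_fold_eval A hj).2 ⟨r, rfl, h⟩, ?_⟩
  rintro ⟨s', R'⟩ h'
  obtain ⟨r', rfl, h'⟩ := (mem_fold_eval A hj).1 h'
  have := hu (s', r') h'
  have h1 : s' = s := congrArg Prod.fst this
  have h2 : r' = r := congrArg Prod.snd this
  rw [h1, h2]

theorem work_fold_le [DecidableEq V] (A : StaticAlg V Q) {j : ℕ} (hj : j ≤ Q) {W : ℕ}
    (hW : ∀ r, A.work r ≤ W) (R : Fin (2 ^ j)) : (A.fold j).work R ≤ 2 ^ (Q - j) * W := by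
  calc (A.fold j).work R
      ≤ ∑ s, ∑ r ∈ block Q j R, (A.eval s r).card :=
        Finset.sum_le_sum fun s _ => Finset.card_biUnion_le
    _ = ∑ r ∈ block Q j R, A.work r := Finset.sum_comm
    _ ≤ 2 ^ (Q - j) * W := by
      rw [← card_block hj R, ← smul_eq_mul]
      exact Finset.sum_le_card_nsmul _ _ _ fun r _ => hW r

/-- Supersteps whose clusters are single processing elements do not
communicate. -/
theorem Evaluates.relationDegree_eq_zero {arc : V → V → Prop} {A : StaticAlg V Q}
    (hA : A.Evaluates arc) {s : Fin A.len} (hs : Q ≤ A.label s) :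
    relationDegree (A.sent s) = 0 := by
  have key : ∀ r r', r ≠ r' → A.sent s r r' = 0 := by
    intro r r' hne
    by_contra h
    have := hA.clusters s r r' h
    rw [Nat.sub_eq_zero_of_le hs, pow_zero, Nat.div_one, Nat.div_one] at this
    exact hne (Fin.ext this)
  refine Nat.le_zero.1 (relationDegree_le (fun r => ?_) fun r => ?_)
  · refine (Finset.sum_eq_zero fun r' hr' => ?_).le
    rw [key r r' (Finset.ne_of_mem_erase hr').symm, Multiset.card_zero]
  · refine (Finset.sum_eq_zero fun r' hr' => ?_).le
    rw [key r' r (Finset.ne_of_mem_erase hr'), Multiset.card_zero]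

theorem Evaluates.sum_range_F_eq {arc : V → V → Prop} {A : StaticAlg V Q}
    (hA : A.Evaluates arc) :
    ∑ i ∈ Finset.range Q, A.F i = ∑ s, relationDegree (A.sent s) := by
  rw [sum_range_F]
  refine Finset.sum_subset (Finset.filter_subset _ _) fun s _ hs => ?_
  refine hA.relationDegree_eq_zero ?_
  simpa using hs

end StaticAlg

/-! ## Isoperimetry in the stencil grid -/

/-- The nodes with an arc that enters or leaves `W`. -/
def crossingNodes {n : ℕ} (W : Finset (StencilNode n)) : Finset (StencilNode n) :=
  Finset.univ.filter fun w => ∃ w', StencilArc w w' ∧ ¬(w ∈ W ↔ w' ∈ W)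

theorem mem_crossingNodes {n : ℕ} {W : Finset (StencilNode n)} {w : StencilNode n} :
    w ∈ crossingNodes W ↔ ∃ w', StencilArc w w' ∧ ¬(w ∈ W ↔ w' ∈ W) := by
  simp [crossingNodes]

theorem crossingNodes_compl {n : ℕ} (W : Finset (StencilNode n)) :
    crossingNodes Wᶜ = crossingNodes W := by
  ext w
  simp only [mem_crossingNodes, Finset.mem_compl, not_iff_not]

/-- The vertical arcs join consecutive nodes of a column, so membership can only change at a
crossing node. -/
theorem mem_iff_of_forall_notMem_crossingNodes {n : ℕ} {W : Finset (StencilNode n)} {x : Fin n}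
    (hx : ∀ t, (x, t) ∉ crossingNodes W) (t t' : Fin n) : (x, t) ∈ W ↔ (x, t') ∈ W := by
  have key : ∀ m (hm : m < n), (x, (⟨m, hm⟩ : Fin n)) ∈ W ↔ (x, (⟨0, by omega⟩ : Fin n)) ∈ W := by
    intro m
    induction m with
    | zero => intro _; rfl
    | succ m ih =>
      intro hm
      rw [← ih (by omega)]
      have h := hx ⟨m, by omega⟩
      rw [mem_crossingNodes] at h
      by_contra hc
      exact h ⟨(x, ⟨m + 1, hm⟩), ⟨rfl, by simp, by simp⟩, fun h => hc h.symm⟩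
  rw [key t.val t.isLt, key t'.val t'.isLt]

/-- A set with more than `n` nodes per crossing node contains an entire column. -/
theorem exists_column_subset {n : ℕ} {W : Finset (StencilNode n)}
    (h : (crossingNodes W).card * n < W.card) : ∃ x, ∀ t, (x, t) ∈ W := by
  by_contra! hc
  -- If no column is contained in `W`, every column that meets `W` has a crossing node, and there
  -- are at most `n` nodes of `W` in each of these columns.
  have hsub : W ⊆ (crossingNodes W).image Prod.fst ×ˢ Finset.univ := by
    rintro ⟨x, t⟩ hw
    by_contra hx
    have hx' : ∀ t, (x, t) ∉ crossingNodes W := fun t' ht' => hx <|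
      Finset.mem_product.2 ⟨Finset.mem_image.2 ⟨_, ht', rfl⟩, Finset.mem_univ _⟩
    obtain ⟨t', ht'⟩ := hc x
    exact ht' ((mem_iff_of_forall_notMem_crossingNodes hx' t t').1 hw)
  have := Finset.card_le_card hsub
  rw [Finset.card_product, Finset.card_univ, Fintype.card_fin] at this
  have := Nat.mul_le_mul_right n (Finset.card_image_le (s := crossingNodes W) (f := Prod.fst))
  omega

/-- A set that is neither too small nor too large has a crossing node in every row but the last. -/
theorem le_card_crossingNodes {n : ℕ} {W : Finset (StencilNode n)}
    (h : (crossingNodes W).card * n < W.card) (h' : W.card + (crossingNodes W).card * n < n ^ 2) :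
    n ≤ (crossingNodes W).card + 1 := by
  obtain ⟨x, hx⟩ := exists_column_subset h
  obtain ⟨x', hx'⟩ := exists_column_subset (W := Wᶜ) (by
    rw [crossingNodes_compl, Finset.card_compl, Fintype.card_prod, Fintype.card_fin, ← sq]
    omega)
  have row : ∀ m, m + 1 < n → m ∈ (crossingNodes W).image fun w => w.2.val := by
    intro m hm
    by_contra hc
    have hr : ∀ y y' : Fin n, y.val ≤ y'.val + 1 → y'.val ≤ y.val + 1 →
        ((y, (⟨m, by omega⟩ : Fin n)) ∈ W ↔ (y', (⟨m + 1, hm⟩ : Fin n)) ∈ W) := by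
      intro y y' h1 h2
      by_contra hne
      exact hc (Finset.mem_image.2 ⟨(y, ⟨m, by omega⟩),
        mem_crossingNodes.2 ⟨_, ⟨rfl, h2, h1⟩, hne⟩, rfl⟩)
    -- Zigzag between rows `m` and `m + 1`: without crossing nodes in row `m`, the row is constant,
    -- against one column inside `W` and one outside.
    have key : ∀ y (hy : y < n), (((⟨y, hy⟩ : Fin n), (⟨m, by omega⟩ : Fin n)) ∈ W ↔
        ((⟨0, by omega⟩ : Fin n), (⟨m, by omega⟩ : Fin n)) ∈ W) := by
      intro y
      induction y with
      | zero => intro _; rfl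
      | succ y ih =>
        intro hy
        rw [← ih (by omega), hr ⟨y + 1, hy⟩ ⟨y + 1, hy⟩ (by simp) (by simp),
          hr ⟨y, by omega⟩ ⟨y + 1, hy⟩ (by simp; omega) (by simp)]
    have h1 := hx ⟨m, by omega⟩
    have h2 := Finset.mem_compl.1 (hx' ⟨m, by omega⟩)
    rw [key x.val x.isLt] at h1
    rw [key x'.val x'.isLt] at h2
    exact h2 h1
  have := Finset.card_le_card (s := Finset.range (n - 1)) (fun m hm => row m (by
    rw [Finset.mem_range] at hm; omega))
  rw [Finset.card_range] at this
  have := this.trans Finset.card_image_le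
  omega

/-! ## Descent along the dependencies -/

/-- What the lower bound uses of an execution: the processor `own x y` that evaluates node `⟨x, y⟩`
and the time `tm x y` when it does, and a bound `cost s` for the number of values that a processor
receives before time `s`. -/
structure GridSchedule (ι : Type) (n : ℕ) where
  own : ℤ → ℤ → ι
  tm : ℤ → ℤ → ℕ
  cost : ℕ → ℕ
  mono : ∀ x y d : ℤ, -1 ≤ d → d ≤ 1 → (0 ≤ x ∧ x < n ∧ y < n) →
    (0 ≤ x + d ∧ x + d < n ∧ 0 ≤ y - 1) → tm (x + d) (y - 1) ≤ tm x y
  recv : ∀ r s₀ s₁, ∀ W : Finset (ℤ × ℤ), W.Nonempty →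
    (∀ p ∈ W, (0 ≤ p.1 ∧ p.1 < n ∧ 0 ≤ p.2) ∧ own p.1 p.2 ≠ r ∧ s₀ ≤ tm p.1 p.2 ∧
      ∃ d : ℤ, -1 ≤ d ∧ d ≤ 1 ∧ (0 ≤ p.1 - d ∧ p.1 - d < n ∧ p.2 + 1 < n) ∧
        own (p.1 - d) (p.2 + 1) = r ∧ tm (p.1 - d) (p.2 + 1) ≤ s₁) →
    W.card + cost s₀ ≤ cost s₁

namespace GridSchedule

variable {ι : Type} {n : ℕ}

theorem tm_path_le (S : GridSchedule ι n) {x y d : ℤ} (hd : -1 ≤ d ∧ d ≤ 1) (hy : y < n) {L : ℕ}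
    (hx : ∀ m : ℕ, m < L → 0 ≤ x + d * m ∧ x + d * m < n ∧ 0 ≤ y - m) :
    ∀ m : ℕ, m < L → S.tm (x + d * m) (y - m) ≤ S.tm x y := by
  intro m
  induction m with
  | zero => intro _; simp
  | succ m ih =>
    intro hm
    refine le_trans ?_ (ih (by omega))
    have h1 := hx m (by omega)
    have h2 := hx (m + 1) hm
    have e : x + d * ((m + 1 : ℕ) : ℤ) = x + d * m + d := by push_cast; ring
    have e' : y - ((m + 1 : ℕ) : ℤ) = y - m - 1 := by push_cast; ring
    rw [e, e'] at h2 ⊢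
    exact S.mono _ _ _ hd.1 hd.2 ⟨h1.1, h1.2.1, by omega⟩ h2

/-- Along a path that starts at `r`, either `r` evaluates all nodes, or there is an arc that enters. -/
theorem path_cases (S : GridSchedule ι n) {r : ι} {x y d : ℤ} (h0 : S.own x y = r) (L : ℕ) :
    (∀ m : ℕ, m < L → S.own (x + d * m) (y - m) = r) ∨
      ∃ m : ℕ, m + 1 < L ∧ S.own (x + d * m) (y - m) = r ∧
        S.own (x + d * (m + 1 : ℕ)) (y - (m + 1 : ℕ)) ≠ r := by
  by_cases h : ∀ m : ℕ, m < L → S.own (x + d * m) (y - m) = r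
  · exact Or.inl h
  · right
    classical
    push Not at h
    have hf := Nat.find_spec h
    have hmin : ∀ m, m < Nat.find h → _ := fun m hm => Nat.find_min h hm
    generalize Nat.find h = m at hf hmin
    cases m with
    | zero => exact absurd (by simpa using h0) hf.2
    | succ m =>
      refine ⟨m, hf.1, ?_, hf.2⟩
      have := hmin m (by omega)
      push Not at this
      exact this (by omega)

/-- Lines of different slopes `d` and `e` are transversal; the determinant of the parametrization is
`d - e` up to sign. -/
theorem transversal_injective {x y d e : ℤ} (hde : d ≠ e) {i i' m m' : ℕ}
    (h1 : x + e * i + d * m = x + e * i' + d * m') (h2 : y - i - m = y - i' - m') :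
    i = i' ∧ m = m' := by
  have hm : (m : ℤ) = i' + m' - i := by linarith
  rw [hm] at h1
  have : (d - e) * ((i' : ℤ) - i) = 0 := by linarith
  rcases mul_eq_zero.1 this with h | h
  · exact absurd (by linarith) hde
  · omega

/-- The values that enter `r` along distinct transversals of a run are distinct. -/
theorem gain (S : GridSchedule ι n) {r : ι} {s₁ L : ℕ} {x y d e : ℤ} (hde : d ≠ e)
    (hd : -1 ≤ d ∧ d ≤ 1) (hy : y < n) (I : Finset ℕ) (hI : I.Nonempty)
    (hg : ∀ i ∈ I, ∀ m : ℕ, m < L →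
      0 ≤ x + e * i + d * m ∧ x + e * i + d * m < n ∧ 0 ≤ y - i - m)
    (ht : ∀ i ∈ I, S.tm (x + e * i) (y - i) ≤ s₁)
    (hb : ∀ i ∈ I, ∃ m : ℕ, m + 1 < L ∧ S.own (x + e * i + d * m) (y - i - m) = r ∧
      S.own (x + e * i + d * (m + 1 : ℕ)) (y - i - (m + 1 : ℕ)) ≠ r) :
    ∃ i ∈ I, ∃ m : ℕ, 0 < m ∧ m < L ∧
      I.card + S.cost (S.tm (x + e * i + d * m) (y - i - m)) ≤ S.cost s₁ := by
  classical
  choose! f hf using hb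
  let q : ℕ → ℤ × ℤ := fun i => (x + e * i + d * (f i + 1 : ℕ), y - i - (f i + 1 : ℕ))
  have hinj : Set.InjOn q I := by
    intro i _ i' _ h
    simp only [q, Prod.mk.injEq] at h
    exact (transversal_injective hde h.1 h.2).1
  -- The earliest evaluated of the entering values: none of the others can have been sent before its
  -- time, so all are received within one interval of supersteps.
  obtain ⟨i, hi, hmin⟩ := Finset.exists_min_image I (fun i => S.tm (q i).1 (q i).2) hI
  refine ⟨i, hi, f i + 1, by omega, (hf i hi).1, ?_⟩
  rw [← Finset.card_image_of_injOn hinj]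
  refine S.recv r _ _ _ (hI.image q) fun p hp => ?_
  obtain ⟨i', hi', rfl⟩ := Finset.mem_image.1 hp
  obtain ⟨hL, ho, ho'⟩ := hf i' hi'
  have g1 := hg i' hi' (f i') (by omega)
  have g2 := hg i' hi' (f i' + 1) hL
  have e1 : (q i').1 - d = x + e * i' + d * f i' := by simp only [q]; push_cast; ring
  have e2 : (q i').2 + 1 = y - i' - f i' := by simp only [q]; push_cast; ring
  refine ⟨g2, ho', hmin i' hi', d, hd.1, hd.2, ?_⟩
  rw [e1, e2]
  refine ⟨⟨g1.1, g1.2.1, by omega⟩, ho, le_trans ?_ (ht i' hi')⟩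
  exact S.tm_path_le hd (by omega) (L := L) (fun m hm => hg i' hi' m hm) (f i') (by omega)

/-- A run of `k` nodes on a line of slope `e` that `r` evaluates until time `s`, less than `2 k` rows
below row `t`. -/
def Run (S : GridSchedule ι n) (r : ι) (s : ℕ) (t : ℤ) (k : ℕ) (e : ℤ) : Prop :=
  (-1 ≤ e ∧ e ≤ 1) ∧ ∃ x y : ℤ, y ≤ t ∧ t ≤ y + k ∧ ∀ i : ℕ, i < k →
    (0 ≤ x + e * i ∧ x + e * i < n) ∧ S.own (x + e * i) (y - i) = r ∧
      S.tm (x + e * i) (y - i) ≤ s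

/-- Slanted runs have vertical transversals, which stay in the columns of the run. For a vertical
run one goes towards the farther side of the grid, where there is room for `n / 2` steps. -/
theorem exists_transversal_direction {x e : ℤ} (he : -1 ≤ e ∧ e ≤ 1) {k L : ℕ}
    (hL : 2 * L ≤ n) (hx : ∀ i : ℕ, i < k → 0 ≤ x + e * i ∧ x + e * i < n) :
    ∃ d : ℤ, (-1 ≤ d ∧ d ≤ 1) ∧ d ≠ e ∧ ∀ i : ℕ, i < k → ∀ m : ℕ, m < L →
      0 ≤ x + e * i + d * m ∧ x + e * i + d * m < n := by
  by_cases h : e = 0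
  · subst h
    by_cases h2 : 2 * x < n
    · refine ⟨1, by omega, by omega, fun i hi m hm => ?_⟩
      have := hx i hi
      constructor <;> omega
    · refine ⟨-1, by omega, by omega, fun i hi m hm => ?_⟩
      have := hx i hi
      constructor <;> omega
  · refine ⟨0, by omega, Ne.symm h, fun i hi m _ => ?_⟩
    rw [zero_mul, add_zero]
    exact hx i hi

/-- Take a transversal of length `2 k` at each node of the run. If `r` evaluates one of them
entirely, this is the new run. Otherwise each brings in a value, and `gain` charges `k` units. The
offsets `k`, `k` and `2 k` of the run, of the position in it and of the transversal keep everything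
within `4 k` rows. -/
theorem run_double (S : GridSchedule ι n) {r : ι} {s k : ℕ} {t e : ℤ} (ht : t < n) (hk : 0 < k)
    (hkt : 4 * k ≤ t) (h : S.Run r s t k e) :
    (∃ e', S.Run r s t (2 * k) e') ∨
      ∃ x y : ℤ, (0 ≤ x ∧ x < n ∧ 0 ≤ y ∧ y < t) ∧ t ≤ y + 4 * k ∧
        k + S.cost (S.tm x y) ≤ S.cost s := by
  obtain ⟨he, x, y, hyt, hty, hrun⟩ := h
  obtain ⟨d, hd, hde, hg⟩ := exists_transversal_direction (n := n) he (L := 2 * k) (by omega)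
    (fun i hi => (hrun i hi).1)
  by_cases hc : ∃ i : ℕ, i < k ∧ ∀ m : ℕ, m < 2 * k → S.own (x + e * i + d * m) (y - i - m) = r
  · obtain ⟨i, hi, hm⟩ := hc
    refine Or.inl ⟨d, hd, x + e * i, y - i, by omega, by push_cast; omega,
      fun m hm' => ⟨hg i hi m hm', hm m hm', le_trans ?_ (hrun i hi).2.2⟩⟩
    exact S.tm_path_le hd (by omega) (L := 2 * k)
      (fun m hm => ⟨(hg i hi m hm).1, (hg i hi m hm).2, by omega⟩) m hm'
  · right
    push Not at hc
    obtain ⟨i, hi, m, hm0, hm, hcost⟩ := S.gain (r := r) (s₁ := s) (L := 2 * k) hde hd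
      (by omega : y < n) (Finset.range k) (Finset.nonempty_range_iff.2 hk.ne')
      (fun i hi m hm => by
        rw [Finset.mem_range] at hi
        exact ⟨(hg i hi m hm).1, (hg i hi m hm).2, by omega⟩)
      (fun i hi => (hrun i (Finset.mem_range.1 hi)).2.2)
      (fun i hi => by
        rw [Finset.mem_range] at hi
        rcases S.path_cases (d := d) (hrun i hi).2.1 (2 * k) with h | h
        · obtain ⟨m, hm, hne⟩ := hc i hi
          exact absurd (h m hm) hne
        · exact h)
    rw [Finset.mem_range] at hi
    rw [Finset.card_range] at hcost
    have := hg i hi m hm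
    exact ⟨_, _, ⟨this.1, this.2, by omega, by omega⟩, by omega, hcost⟩

/-- A long run forces its processor to evaluate many nodes. -/
theorem Run.area (S : GridSchedule ι n) {r : ι} {s k T : ℕ} {t e : ℤ} (hT : ∀ s, S.cost s ≤ T)
    (ht : t < n) (hkt : 4 * k ≤ t) (h : S.Run r s t k e) :
    ∃ W : Finset (ℤ × ℤ), (∀ p ∈ W, (0 ≤ p.1 ∧ p.1 < n ∧ 0 ≤ p.2 ∧ p.2 < n) ∧
      S.own p.1 p.2 = r) ∧ (k - T) * k ≤ W.card := by
  classical
  obtain ⟨he, x, y, hyt, hty, hrun⟩ := h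
  obtain ⟨d, hd, hde, hg⟩ := exists_transversal_direction (n := n) he (L := k) (by omega)
    (fun i hi => (hrun i hi).1)
  let free : Finset ℕ := (Finset.range k).filter fun i =>
    ∀ m : ℕ, m < k → S.own (x + e * i + d * m) (y - i - m) = r
  -- Transversals that leave `r` bring in distinct values, so at most `T` of them do; the other `k -
  -- T` are evaluated by `r` in full and are disjoint.
  have hI : ((Finset.range k).filter fun i : ℕ =>
      ¬∀ m : ℕ, m < k → S.own (x + e * i + d * m) (y - i - m) = r).card ≤ T := by
    rcases Finset.eq_empty_or_nonempty ((Finset.range k).filter fun i : ℕ =>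
      ¬∀ m : ℕ, m < k → S.own (x + e * i + d * m) (y - i - m) = r) with h0 | h0
    · rw [h0]; simp
    · obtain ⟨i, hi, m, hm0, hm, hcost⟩ := S.gain (r := r) (s₁ := s) (L := k) hde hd
        (by omega : y < n) _ h0
        (fun i hi m hm => by
          rw [Finset.mem_filter, Finset.mem_range] at hi
          exact ⟨(hg i hi.1 m hm).1, (hg i hi.1 m hm).2, by omega⟩)
        (fun i hi => by
          rw [Finset.mem_filter, Finset.mem_range] at hi
          exact (hrun i hi.1).2.2)
        (fun i hi => by
          rw [Finset.mem_filter, Finset.mem_range] at hi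
          rcases S.path_cases (d := d) (hrun i hi.1).2.1 k with h | h
          · exact absurd h hi.2
          · exact h)
      exact le_trans (by omega) (hT s)
  have hcard := Finset.card_filter_add_card_filter_not (s := Finset.range k)
    (fun i : ℕ => ∀ m : ℕ, m < k → S.own (x + e * i + d * m) (y - i - m) = r)
  rw [Finset.card_range] at hcard
  let q : ℕ × ℕ → ℤ × ℤ := fun p => (x + e * p.1 + d * p.2, y - p.1 - p.2)
  refine ⟨(free ×ˢ Finset.range k).image q, ?_, ?_⟩
  · intro p hp
    obtain ⟨⟨i, m⟩, him, rfl⟩ := Finset.mem_image.1 hp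
    rw [Finset.mem_product, Finset.mem_filter, Finset.mem_range, Finset.mem_range] at him
    obtain ⟨⟨hi, hf⟩, hm⟩ := him
    simp only at hi hf hm
    exact ⟨⟨(hg i hi m hm).1, (hg i hi m hm).2, by simp only [q]; omega, by simp only [q]; omega⟩,
      hf m hm⟩
  · rw [Finset.card_image_of_injective, Finset.card_product, Finset.card_range]
    · refine Nat.mul_le_mul_right _ ?_
      simp only [free]
      omega
    · rintro ⟨i, m⟩ ⟨i', m'⟩ h
      simp only [q, Prod.mk.injEq] at h
      obtain ⟨h1, h2⟩ := transversal_injective hde h.1 h.2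
      rw [h1, h2]

/-- Descent on the row, at a rate of four rows per unit of degree. A counterexample in row `t` would
allow its run to be doubled up to length `2 ^ a`: whenever doubling fails, the entering node in a
lower row satisfies the bound, and the `k` units paid make up for the at most `4 k` rows. A run of
length `2 ^ a` is excluded by the area bound `hsmall`. -/
theorem le_cost (S : GridSchedule ι n) {a T : ℕ} (hT : ∀ s, S.cost s ≤ T)
    (hsmall : ∀ r, ∀ W : Finset (ℤ × ℤ), (∀ p ∈ W, (0 ≤ p.1 ∧ p.1 < n ∧ 0 ≤ p.2 ∧ p.2 < n) ∧
      S.own p.1 p.2 = r) → W.card < (2 ^ a - T) * 2 ^ a) :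
    ∀ (t : ℕ) (x : ℤ), t < n → 0 ≤ x → x < n → t ≤ 4 * S.cost (S.tm x t) + 4 * 2 ^ a := by
  intro t
  induction t using Nat.strong_induction_on with
  | _ t ih =>
  intro x ht hx0 hx
  by_contra! hlt
  have run : ∀ b, b ≤ a → ∃ e, S.Run (S.own x t) (S.tm x t) t (2 ^ b) e := by
    intro b
    induction b with
    | zero =>
      intro _
      refine ⟨0, by omega, x, t, le_rfl, by simp, fun i hi => ?_⟩
      have hi0 : i = 0 := by simpa using hi
      subst hi0
      simp [hx0, hx]
    | succ b ihb =>
      intro hb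
      obtain ⟨e, he⟩ := ihb (by omega)
      have hpow : (2 : ℕ) ^ b ≤ 2 ^ a := Nat.pow_le_pow_right (by omega) (by omega)
      rcases S.run_double (by omega) (by positivity) (by push_cast; norm_cast; omega)
        he with ⟨e', h⟩ | ⟨x', y', hg, hy, hcost⟩
      · exact ⟨e', by rwa [pow_succ, mul_comm]⟩
      · obtain ⟨u, rfl⟩ := Int.eq_ofNat_of_zero_le hg.2.2.1
        have hut : u < t := by omega
        have := ih u hut x' (by omega) hg.1 hg.2.1
        have hy' : t ≤ u + 4 * 2 ^ b := by exact_mod_cast hy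
        omega
  obtain ⟨e, he⟩ := run a le_rfl
  obtain ⟨W, hW, hcard⟩ := he.area S hT (by omega) (by push_cast; norm_cast; omega)
  exact absurd (hsmall _ W hW) (by omega)

end GridSchedule

/-! ### Traffic in executions without recomputation -/

namespace StaticAlg

variable {V : Type} {Q : ℕ}

/-- The processing element that evaluates `w`. -/
noncomputable def EvaluatesOnce.proc {A : StaticAlg V Q} (hA : A.EvaluatesOnce) (w : V) :
    Fin (2 ^ Q) := (hA w).choose.2

/-- The superstep in which `w` is evaluated. -/
noncomputable def EvaluatesOnce.time {A : StaticAlg V Q} (hA : A.EvaluatesOnce) (w : V) :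
    Fin A.len := (hA w).choose.1

theorem EvaluatesOnce.mem_eval_iff {A : StaticAlg V Q} (hA : A.EvaluatesOnce) {s : Fin A.len}
    {r : Fin (2 ^ Q)} {w : V} : w ∈ A.eval s r ↔ s = hA.time w ∧ r = hA.proc w := by
  constructor
  · intro h
    have := (hA w).choose_spec.2 (s, r) h
    exact ⟨congrArg Prod.fst this, congrArg Prod.snd this⟩
  · rintro ⟨rfl, rfl⟩
    exact (hA w).choose_spec.1

section

variable {arc : V → V → Prop} {A : StaticAlg V Q}

theorem Evaluates.time_le_of_knows (hE : A.Evaluates arc) (hO : A.EvaluatesOnce) {r : Fin (2 ^ Q)}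
    {w : V} {s : Fin A.len} (h : A.Knows s r w) : hO.time w ≤ s := by
  induction s using WellFoundedLT.induction generalizing r with
  | _ s ih =>
  rcases h with h | ⟨s', hs, h | ⟨r', h⟩⟩
  · exact (hO.mem_eval_iff.1 h).1.ge
  · exact (hO.mem_eval_iff.1 h).1 ▸ hs.le
  · exact (ih s' hs (hE.messages _ _ _ _ h)).trans hs.le

theorem Evaluates.time_le_of_arc (hE : A.Evaluates arc) (hO : A.EvaluatesOnce) {w w' : V} (h : arc w w') :
    hO.time w ≤ hO.time w' :=
  hE.time_le_of_knows hO (hE.operands _ _ w' (hO.mem_eval_iff.2 ⟨rfl, rfl⟩) w h)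

/-- Follow the message that brought the value backwards in time. Messages from `r` to itself do not
count towards the degree, but before them `r` must have received the value from somebody else. -/
theorem Evaluates.exists_received (hE : A.Evaluates arc) (hO : A.EvaluatesOnce) {r : Fin (2 ^ Q)}
    {w : V} {s : Fin A.len} (h : A.Knows s r w) (hr : hO.proc w ≠ r) :
    ∃ s', hO.time w ≤ s' ∧ s' < s ∧ ∃ r', r' ≠ r ∧ some w ∈ A.sent s' r' r := by
  induction s using WellFoundedLT.induction with
  | _ s ih =>
  rcases h with h | ⟨s', hs, h | ⟨r', h⟩⟩
  · exact absurd (hO.mem_eval_iff.1 h).2.symm hr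
  · exact absurd (hO.mem_eval_iff.1 h).2.symm hr
  · have hk := hE.messages _ _ _ _ h
    by_cases hr' : r' = r
    · subst hr'
      obtain ⟨s'', h1, h2, h3⟩ := ih s' hs hk
      exact ⟨s'', h1, h2.trans hs, h3⟩
    · exact ⟨s', hE.time_le_of_knows hO hk, hs, r', hr', h⟩

/-- The value may reach `r` through relays; tracing it back ends at a message by which its owner
gives it away. -/
theorem Evaluates.exists_sent (hE : A.Evaluates arc) (hO : A.EvaluatesOnce) {r : Fin (2 ^ Q)}
    {w : V} {s : Fin A.len} (h : A.Knows s r w) (hr : hO.proc w ≠ r) :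
    ∃ s', ∃ r', r' ≠ hO.proc w ∧ some w ∈ A.sent s' (hO.proc w) r' := by
  induction s using WellFoundedLT.induction generalizing r with
  | _ s ih =>
  rcases h with h | ⟨s', hs, h | ⟨r', h⟩⟩
  · exact absurd (hO.mem_eval_iff.1 h).2.symm hr
  · exact absurd (hO.mem_eval_iff.1 h).2.symm hr
  · by_cases hr' : r' = hO.proc w
    · exact ⟨s', r, hr.symm, hr' ▸ h⟩
    · exact ih s' hs (hE.messages _ _ _ _ h) (Ne.symm hr')

end

/-- A message carries only one node value. The relation `msg` is kept general so that its transpose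
gives the bound for received values. -/
theorem card_le_sum_outDegree (A : StaticAlg V Q) (I : Finset (Fin A.len))
    (msg : Fin A.len → Fin (2 ^ Q) → Fin (2 ^ Q) → Multiset (Option V)) (r : Fin (2 ^ Q))
    (W : Finset V) (h : ∀ w ∈ W, ∃ s ∈ I, ∃ r', r' ≠ r ∧ some w ∈ msg s r r') :
    W.card ≤ ∑ s ∈ I, outDegree (msg s) r := by
  classical
  have hsub : W.image some ⊆
      I.biUnion fun s => (∑ r' ∈ Finset.univ.erase r, msg s r r').toFinset := by
    intro m hm
    obtain ⟨w, hw, rfl⟩ := Finset.mem_image.1 hm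
    obtain ⟨s, hs, r', hr', hmem⟩ := h w hw
    refine Finset.mem_biUnion.2 ⟨s, hs, Multiset.mem_toFinset.2 (Multiset.mem_sum.2 ⟨r', ?_, hmem⟩)⟩
    exact Finset.mem_erase.2 ⟨hr', Finset.mem_univ _⟩
  rw [← Finset.card_image_of_injective W (Option.some_injective V)]
  refine (Finset.card_le_card hsub).trans (Finset.card_biUnion_le.trans
    (Finset.sum_le_sum fun s _ => (Multiset.toFinset_card_le _).trans ?_))
  rw [Multiset.card_sum]; rfl

theorem card_le_of_received (A : StaticAlg V Q) (I : Finset (Fin A.len)) (r : Fin (2 ^ Q))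
    (W : Finset V) (h : ∀ w ∈ W, ∃ s ∈ I, ∃ r', r' ≠ r ∧ some w ∈ A.sent s r' r) :
    W.card ≤ ∑ s ∈ I, relationDegree (A.sent s) :=
  (card_le_sum_outDegree A I (fun s a b => A.sent s b a) r W h).trans
    (Finset.sum_le_sum fun s _ => inDegree_le_relationDegree (A.sent s) r)

theorem card_le_of_sent (A : StaticAlg V Q) (I : Finset (Fin A.len)) (r : Fin (2 ^ Q))
    (W : Finset V) (h : ∀ w ∈ W, ∃ s ∈ I, ∃ r', r' ≠ r ∧ some w ∈ A.sent s r r') :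
    W.card ≤ ∑ s ∈ I, relationDegree (A.sent s) :=
  (card_le_sum_outDegree A I A.sent r W h).trans
    (Finset.sum_le_sum fun s _ => outDegree_le_relationDegree (A.sent s) r)

/-- The sum of the degrees of the supersteps before `s`. -/
def cost (A : StaticAlg V Q) (s : ℕ) : ℕ :=
  ∑ s' ∈ Finset.univ.filter (fun s' : Fin A.len => s'.val < s), relationDegree (A.sent s')

theorem cost_le (A : StaticAlg V Q) (s : ℕ) : A.cost s ≤ ∑ s, relationDegree (A.sent s) :=
  Finset.sum_le_sum_of_subset (Finset.filter_subset _ _)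

theorem card_add_cost_le (A : StaticAlg V Q) {s₀ s₁ : ℕ} (r : Fin (2 ^ Q))
    (hs : s₀ ≤ s₁) (W : Finset V)
    (h : ∀ w ∈ W, ∃ s : Fin A.len, s₀ ≤ s ∧ s < s₁ ∧ ∃ r', r' ≠ r ∧ some w ∈ A.sent s r' r) :
    W.card + A.cost s₀ ≤ A.cost s₁ := by
  have h1 := card_le_of_received A (Finset.univ.filter fun s : Fin A.len => s₀ ≤ s ∧ s < s₁) r W
    (fun w hw => by
      obtain ⟨s, h1, h2, h3⟩ := h w hw
      exact ⟨s, by simp [h1, h2], h3⟩)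
  refine (Nat.add_le_add_right h1 _).trans ?_
  unfold cost
  rw [← Finset.sum_union]
  · refine Finset.sum_le_sum_of_subset fun s hs' => ?_
    simp only [Finset.mem_union, Finset.mem_filter, Finset.mem_univ, true_and] at hs' ⊢
    omega
  · refine Finset.disjoint_left.2 fun s h1 h2 => ?_
    simp only [Finset.mem_filter, Finset.mem_univ, true_and] at h1 h2
    omega

end StaticAlg

/-! ### The lower bound for admissible algorithms -/

section LowerBound

open StaticAlg

/-- The grid node at integer coordinates. -/
def gridNode (n : ℕ) [NeZero n] (x y : ℤ) : StencilNode n :=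
  (Fin.ofNat n x.toNat, Fin.ofNat n y.toNat)

theorem ofNat_toNat_val {n : ℕ} [NeZero n] {x : ℤ} (h0 : 0 ≤ x) (hx : x < n) :
    ((Fin.ofNat n x.toNat).val : ℤ) = x := by
  rw [Fin.val_ofNat, Nat.mod_eq_of_lt (by omega)]
  omega

theorem gridNode_injOn {n : ℕ} [NeZero n] : Set.InjOn (fun p : ℤ × ℤ => gridNode n p.1 p.2)
    {p | (0 ≤ p.1 ∧ p.1 < n) ∧ 0 ≤ p.2 ∧ p.2 < n} := by
  rintro p ⟨h1, h2⟩ p' ⟨h1', h2'⟩ h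
  simp only [gridNode, Prod.mk.injEq] at h
  refine Prod.ext ?_ ?_
  · rw [← ofNat_toNat_val h1.1 h1.2, h.1, ofNat_toNat_val h1'.1 h1'.2]
  · rw [← ofNat_toNat_val h2.1 h2.2, h.2, ofNat_toNat_val h2'.1 h2'.2]

theorem stencilArc_gridNode {n : ℕ} [NeZero n] {x y d : ℤ} (hd : -1 ≤ d ∧ d ≤ 1)
    (h : 0 ≤ x ∧ x < n ∧ y < n) (h' : 0 ≤ x + d ∧ x + d < n ∧ 0 ≤ y - 1) :
    StencilArc (gridNode n (x + d) (y - 1)) (gridNode n x y) := by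
  have e1 := ofNat_toNat_val (n := n) h.1 h.2.1
  have e2 := ofNat_toNat_val (n := n) h'.1 h'.2.1
  have e3 := ofNat_toNat_val (n := n) (x := y) (by omega) h.2.2
  have e4 := ofNat_toNat_val (n := n) (x := y - 1) h'.2.2 (by omega)
  unfold StencilArc gridNode
  refine ⟨?_, ?_, ?_⟩ <;> simp only <;> omega

/-- The schedule of an execution without recomputation. -/
noncomputable def gridSchedule {n Q : ℕ} [NeZero n] {A : StaticAlg (StencilNode n) Q}
    (hE : A.Evaluates StencilArc) (hO : A.EvaluatesOnce) : GridSchedule (Fin (2 ^ Q)) n where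
  own x y := hO.proc (gridNode n x y)
  tm x y := hO.time (gridNode n x y)
  cost := A.cost
  mono x y d hd hd' h h' := hE.time_le_of_arc hO (stencilArc_gridNode ⟨hd, hd'⟩ h h')
  recv r s₀ s₁ W hne hW := by
    classical
    have arcW : ∀ p ∈ W, ∃ w', StencilArc (gridNode n p.1 p.2) w' ∧ hO.proc w' = r ∧
        (hO.time w').val ≤ s₁ := by
      intro p hp
      obtain ⟨h1, -, -, d, hd, hd', h2, h3, h4⟩ := hW p hp
      refine ⟨_, ?_, h3, h4⟩
      have := stencilArc_gridNode (n := n) (x := p.1 - d) (y := p.2 + 1) ⟨hd, hd'⟩ h2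
        ⟨by omega, by omega, by omega⟩
      simpa using this
    rw [← Finset.card_image_of_injOn ((gridNode_injOn (n := n)).mono fun p hp => ?_)]
    · refine A.card_add_cost_le r ?_ _ fun w hw => ?_
      -- Only here is `W` required to be nonempty: one of its arcs shows `s₀ ≤ s₁`.
      · obtain ⟨p, hp⟩ := hne
        obtain ⟨w', ha, -, ht⟩ := arcW p hp
        exact ((hW p hp).2.2.1).trans
          ((Fin.le_def.1 (hE.time_le_of_arc hO ha)).trans ht)
      · obtain ⟨p, hp, rfl⟩ := Finset.mem_image.1 hw
        obtain ⟨w', ha, rfl, ht⟩ := arcW p hp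
        obtain ⟨-, hown, hs₀, -⟩ := hW p hp
        obtain ⟨s, hs, hs', r', hr', hm⟩ := hE.exists_received hO
          (hE.operands _ _ w' (hO.mem_eval_iff.2 ⟨rfl, rfl⟩) _ ha) hown
        exact ⟨s, hs₀.trans hs, lt_of_lt_of_le hs' ht, r', hr', hm⟩
    · obtain ⟨h1, -, -, d, hd, hd', h2, -⟩ := hW p hp
      exact ⟨⟨h1.1, h1.2.1⟩, h1.2.2, by omega⟩

/-- The nodes that `r` evaluates. -/
noncomputable def ownedNodes {n Q : ℕ} {A : StaticAlg (StencilNode n) Q} (hO : A.EvaluatesOnce)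
    (r : Fin (2 ^ Q)) : Finset (StencilNode n) :=
  Finset.univ.filter fun w => hO.proc w = r

theorem mem_ownedNodes {n Q : ℕ} {A : StaticAlg (StencilNode n) Q} {hO : A.EvaluatesOnce}
    {r : Fin (2 ^ Q)} {w : StencilNode n} : w ∈ ownedNodes hO r ↔ hO.proc w = r := by
  simp [ownedNodes]

theorem card_ownedNodes_le_work {n Q : ℕ} {A : StaticAlg (StencilNode n) Q}
    (hO : A.EvaluatesOnce) (r : Fin (2 ^ Q)) : (ownedNodes hO r).card ≤ A.work r := by
  classical
  refine (Finset.card_le_card (t := Finset.univ.biUnion fun s => A.eval s r) fun w hw => ?_).trans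
    Finset.card_biUnion_le
  rw [mem_ownedNodes] at hw
  exact Finset.mem_biUnion.2 ⟨hO.time w, Finset.mem_univ _, hO.mem_eval_iff.2 ⟨rfl, hw.symm⟩⟩

/-- A crossing node evaluated by `r` is needed elsewhere and must be sent by `r`; one evaluated
elsewhere is needed by `r` and must be received. Each kind is bounded by the total degree, hence the
factor `2`. -/
theorem card_crossingNodes_ownedNodes_le {n Q : ℕ} {A : StaticAlg (StencilNode n) Q}
    (hE : A.Evaluates StencilArc) (hO : A.EvaluatesOnce) (r : Fin (2 ^ Q)) :
    (crossingNodes (ownedNodes hO r)).card ≤ 2 * ∑ s, relationDegree (A.sent s) := by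
  classical
  have knows : ∀ {w w'}, StencilArc w w' → A.Knows (hO.time w') (hO.proc w') w := fun {w w'} h =>
    hE.operands _ _ w' (hO.mem_eval_iff.2 ⟨rfl, rfl⟩) w h
  rw [two_mul, ← Finset.card_filter_add_card_filter_not (fun w => hO.proc w = r)]
  refine Nat.add_le_add (A.card_le_of_sent _ r _ fun w hw => ?_)
    (A.card_le_of_received _ r _ fun w hw => ?_)
  · obtain ⟨h1, rfl⟩ := Finset.mem_filter.1 hw
    obtain ⟨w', ha, hne⟩ := mem_crossingNodes.1 h1
    simp only [mem_ownedNodes, true_iff] at hne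
    obtain ⟨s, r', hr', hm⟩ := hE.exists_sent hO (knows ha) (Ne.symm hne)
    exact ⟨s, Finset.mem_univ _, r', hr', hm⟩
  · obtain ⟨h1, h2⟩ := Finset.mem_filter.1 hw
    obtain ⟨w', ha, hne⟩ := mem_crossingNodes.1 h1
    simp only [mem_ownedNodes, h2, false_iff, not_not] at hne
    subst hne
    obtain ⟨s, -, -, r', hr', hm⟩ := hE.exists_received hO (knows ha) h2
    exact ⟨s, Finset.mem_univ _, r', hr', hm⟩

/-- Every admissible algorithm for the `(n, 1)`-stencil problem has communication complexity
`Ω(n)`. -/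
theorem StencilAdmissible.le_sum_F {ε : ℝ} (hε : ε < 1) {N Q : ℕ} (hN : 1 ≤ N)
    {A : StaticAlg (StencilNode (2 ^ N)) Q} (hA : StencilAdmissible ε A) :
    min (1 / 1024) ((1 - ε) / 2) * (2 : ℝ) ^ N ≤ ∑ i ∈ Finset.range Q, (A.F i : ℝ) := by
  have hE := hA.evaluates
  have hO := hA.once
  rw [← Nat.cast_sum, hE.sum_range_F_eq]
  set T := ∑ s, relationDegree (A.sent s) with hT
  -- With `n = 16 · 2 ^ a`, the first term yields `64 T ≤ 2 ^ a`; the second yields `2 T n < (1 - ε)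
  -- n ^ 2`, so that no processor can own all but `2 T n` nodes.
  set c : ℝ := min (1 / 1024) ((1 - ε) / 2)
  have hc1 : c ≤ 1 / 1024 := min_le_left _ _
  have hc2 : c ≤ (1 - ε) / 2 := min_le_right _ _
  have hc0 : 0 < c := lt_min (by norm_num) (by linarith)
  have hpow : (1 : ℝ) ≤ 2 ^ N := one_le_pow₀ (by norm_num)
  have hn2 : 2 ≤ 2 ^ N := by simpa using Nat.pow_le_pow_right (n := 2) (by norm_num) hN
  have hcr : ∀ r, (crossingNodes (ownedNodes hO r)).card ≤ 2 * T :=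
    card_crossingNodes_ownedNodes_le hE hO
  have hwork : ∀ r, ((ownedNodes hO r).card : ℝ) ≤ ε * (2 ^ N) ^ 2 := by
    intro r
    have h1 : ((ownedNodes hO r).card : ℝ) ≤ A.work r := by
      exact_mod_cast card_ownedNodes_le_work hO r
    have h2 := hA.balanced r
    push_cast at h2
    exact h1.trans h2
  have iso : ∀ r, 2 * T * 2 ^ N < (ownedNodes hO r).card →
      (ownedNodes hO r).card + 2 * T * 2 ^ N < (2 ^ N) ^ 2 → 2 ^ N ≤ 2 * T + 1 := by
    intro r h1 h2
    have h3 := Nat.mul_le_mul_right (2 ^ N) (hcr r)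
    have := le_card_crossingNodes (W := ownedNodes hO r) (by omega) (by omega)
    have := hcr r
    omega
  by_contra! hlt
  -- Without communication the owner of any node would own the whole grid, against the balance
  -- condition.
  have hT1 : 1 ≤ T := by
    by_contra h0
    have hT0 : T = 0 := by omega
    let w : StencilNode (2 ^ N) := (⟨0, by omega⟩, ⟨0, by omega⟩)
    have := iso (hO.proc w) (by
      rw [hT0]
      simpa using Finset.card_pos.2 ⟨w, mem_ownedNodes.2 rfl⟩) (by
      rw [hT0]
      have h1 := hwork (hO.proc w)
      have h2 : ((ownedNodes hO (hO.proc w)).card : ℝ) < (2 ^ N) ^ 2 := by nlinarith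
      have h3 : (ownedNodes hO (hO.proc w)).card < (2 ^ N) ^ 2 := by exact_mod_cast h2
      simpa using h3)
    omega
  have hT1' : (1 : ℝ) ≤ T := by exact_mod_cast hT1
  have hN4 : 4 ≤ N := by
    by_contra h
    have : (2 : ℝ) ^ N ≤ 2 ^ 4 := pow_le_pow_right₀ (by norm_num) (by omega)
    nlinarith
  obtain ⟨a, rfl⟩ := Nat.exists_eq_add_of_le' hN4
  have h16 : (2 : ℕ) ^ (a + 4) = 16 * 2 ^ a := by rw [pow_add]; ring
  have h16' : (2 : ℝ) ^ (a + 4) = 16 * 2 ^ a := by rw [pow_add]; ring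
  have hK : (1 : ℝ) ≤ 2 ^ a := one_le_pow₀ (by norm_num)
  have hTK' : (T : ℝ) * 64 ≤ 2 ^ a := by nlinarith
  have hTK : T * 64 ≤ 2 ^ a := by exact_mod_cast hTK'
  have hcT : (T : ℝ) < (1 - ε) / 2 * (16 * 2 ^ a) := by nlinarith
  -- As `32 T < 2 ^ a - T`, an area of `(2 ^ a - T) 2 ^ a` exceeds `2 T n`, which `iso` forbids.
  -- Applied to row `n - 1`, the bound reads `16 · 2 ^ a - 1 ≤ 4 T + 4 · 2 ^ a`, which is false.
  have main := (gridSchedule hE hO).le_cost (a := a) (T := T) (fun s => A.cost_le s)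
    (fun r W hW => by
      by_contra! hge
      have hWc : W.card ≤ (ownedNodes hO r).card := by
        classical
        rw [← Finset.card_image_of_injOn (gridNode_injOn (n := 2 ^ (a + 4)).mono fun p hp => ?_)]
        · refine Finset.card_le_card fun w hw => ?_
          obtain ⟨p, hp, rfl⟩ := Finset.mem_image.1 hw
          exact mem_ownedNodes.2 (hW p hp).2
        · have := (hW p hp).1
          exact ⟨⟨this.1, this.2.1⟩, this.2.2⟩
      have := iso r (by
          have : 2 * T * (16 * 2 ^ a) < (2 ^ a - T) * 2 ^ a := by
            have : 32 * T < 2 ^ a - T := by omega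
            calc 2 * T * (16 * 2 ^ a) = 32 * T * 2 ^ a := by ring
              _ < _ := Nat.mul_lt_mul_of_pos_right this (by positivity)
          exact lt_of_lt_of_le (h16 ▸ this) (hge.trans hWc)) (by
          have h1 := hwork r
          have h2 : ((ownedNodes hO r).card : ℝ) + 2 * T * 2 ^ (a + 4) < (2 ^ (a + 4)) ^ 2 := by
            rw [h16'] at h1 ⊢
            nlinarith
          exact_mod_cast h2)
      omega) (2 ^ (a + 4) - 1) 0 (by omega) le_rfl (by positivity)
  have : (gridSchedule hE hO).cost ((gridSchedule hE hO).tm 0 ((2 ^ (a + 4) - 1 : ℕ) : ℤ)) ≤ T :=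
    A.cost_le _
  omega

end LowerBound

namespace DiamondStencil

/-! ## The sequence of supersteps -/

/-- The lists of stripe numbers that occur in the recursive evaluation of a diamond of extent
`2 ^ e`. -/
def ValidPath (κ e : ℕ) (l : List ℕ) : Prop :=
  ∀ i (h : i < l.length), i * κ < e ∧ l[i] < 2 * 2 ^ min κ (e - i * κ) - 1

theorem validPath_nil (κ e : ℕ) : ValidPath κ e [] := fun i h => absurd h (by simp)

theorem validPath_cons {κ e r : ℕ} {l : List ℕ} :
    ValidPath κ e (r :: l) ↔ 0 < e ∧ r < 2 * 2 ^ min κ e - 1 ∧ ValidPath κ (e - κ) l := by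
  have hsub : ∀ i, e - (i + 1) * κ = e - κ - i * κ := fun i => by rw [add_mul, one_mul]; omega
  constructor
  · intro h
    have h0 := h 0 (by simp)
    simp only [zero_mul, Nat.sub_zero, List.getElem_cons_zero] at h0
    refine ⟨h0.1, h0.2, fun i hi => ?_⟩
    have := h (i + 1) (by simpa using hi)
    rw [List.getElem_cons_succ, hsub] at this
    refine ⟨?_, this.2⟩
    have := this.1
    rw [add_mul, one_mul] at this
    omega
  · rintro ⟨h0, hr, hl⟩ i hi
    cases i with
    | zero => simpa using ⟨h0, hr⟩
    | succ i =>
      have := hl i (by simpa using hi)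
      rw [List.getElem_cons_succ, hsub]
      refine ⟨?_, this.2⟩
      rw [add_mul, one_mul]
      omega

theorem cons_mem_phases {κ e r : ℕ} {l : List ℕ} (hκ : 0 < κ) :
    r :: l ∈ phases κ e ↔ 0 < e ∧ r < 2 * 2 ^ min κ e - 1 ∧ (l = [] ∨ l ∈ phases κ (e - κ)) := by
  rw [phases]
  by_cases he : 0 < e
  · rw [if_pos ⟨hκ, he⟩]
    simp only [List.mem_flatMap, List.mem_range, List.mem_cons, List.cons.injEq, List.mem_map]
    constructor
    · rintro ⟨r', hr', ⟨rfl, rfl⟩ | ⟨l', hl', rfl, rfl⟩⟩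
      · exact ⟨he, hr', Or.inl rfl⟩
      · exact ⟨he, hr', Or.inr hl'⟩
    · rintro ⟨-, hr, h | h⟩
      · exact ⟨r, hr, Or.inl ⟨rfl, h⟩⟩
      · exact ⟨r, hr, Or.inr ⟨l, h, rfl, rfl⟩⟩
  · rw [if_neg (by omega)]
    simp [he]

theorem nil_notMem_phases (κ e : ℕ) : [] ∉ phases κ e := by
  rw [phases]
  split_ifs <;> simp

theorem mem_phases {κ e : ℕ} {l : List ℕ} (hκ : 0 < κ) :
    l ∈ phases κ e ↔ l ≠ [] ∧ ValidPath κ e l := by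
  induction l generalizing e with
  | nil => simp [nil_notMem_phases]
  | cons r l ih =>
    rw [cons_mem_phases hκ, validPath_cons, ih]
    by_cases h : l = []
    · subst h; simp [validPath_nil]
    · simp [h]

theorem eq_nil_or_mem_phases {κ e : ℕ} {l : List ℕ} (hκ : 0 < κ) :
    l = [] ∨ l ∈ phases κ e ↔ ValidPath κ e l := by
  rw [mem_phases hκ]
  by_cases h : l = []
  · subst h; simp [validPath_nil]
  · simp [h]

theorem mem_program {N κ : ℕ} (hκ : 0 < κ) {a : List ℕ} :
    a ∈ program N κ ↔ a = [5] ∨ ∃ s < 5, ∃ l, ValidPath κ N l ∧ a = s :: l := by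
  simp only [program, List.mem_append, List.mem_flatMap, List.mem_range, List.mem_cons,
    List.mem_map, List.not_mem_nil, or_false]
  rw [or_comm]
  refine or_congr_right (exists_congr fun s => and_congr_right fun _ => ?_)
  constructor
  · rintro (h | ⟨l, hl, rfl⟩)
    · exact ⟨[], validPath_nil _ _, h⟩
    · exact ⟨l, ((mem_phases hκ).1 hl).2, rfl⟩
  · rintro ⟨l, hl, rfl⟩
    rcases (eq_nil_or_mem_phases hκ).2 hl with rfl | h
    · exact Or.inl rfl
    · exact Or.inr ⟨l, h, rfl⟩

theorem pairwise_cons_map_cons {s : ℕ} {l : List (List ℕ)} (hl : l.Pairwise (· < ·))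
    (h0 : [] ∉ l) : ([s] :: l.map (List.cons s)).Pairwise (· < ·) := by
  rw [List.pairwise_cons, List.pairwise_map]
  refine ⟨fun a ha => ?_, hl.imp fun h => List.cons_lt_cons_iff.2 (Or.inr ⟨rfl, h⟩)⟩
  obtain ⟨b, hb, rfl⟩ := List.mem_map.1 ha
  cases b with
  | nil => exact absurd hb h0
  | cons c b => exact List.cons_lt_cons_iff.2 (Or.inr ⟨rfl, List.nil_lt_cons _ _⟩)

theorem pairwise_flatMap_range {m : ℕ} {l : List (List ℕ)} (hl : l.Pairwise (· < ·))
    (h0 : [] ∉ l) :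
    ((List.range m).flatMap fun s => [s] :: l.map (List.cons s)).Pairwise (· < ·) := by
  rw [List.pairwise_flatMap]
  refine ⟨fun s _ => pairwise_cons_map_cons hl h0, List.pairwise_lt_range.imp ?_⟩
  intro s s' hs a ha b hb
  have hd : ∀ {s a}, a ∈ [s] :: l.map (List.cons s) → ∃ a', a = s :: a' := by
    intro s a h
    rcases List.mem_cons.1 h with rfl | h
    · exact ⟨[], rfl⟩
    · obtain ⟨b, -, rfl⟩ := List.mem_map.1 h
      exact ⟨b, rfl⟩
  obtain ⟨a', rfl⟩ := hd ha
  obtain ⟨b', rfl⟩ := hd hb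
  exact List.cons_lt_cons_iff.2 (Or.inl hs)

theorem pairwise_phases (κ e : ℕ) : (phases κ e).Pairwise (· < ·) := by
  induction e using Nat.strong_induction_on with
  | _ e ih =>
  rw [phases]
  split_ifs with h
  · exact pairwise_flatMap_range (ih _ (by omega)) (nil_notMem_phases _ _)
  · exact List.Pairwise.nil

/-- The supersteps are in lexicographic order. -/
theorem pairwise_program {N κ : ℕ} : (program N κ).Pairwise (· < ·) := by
  rw [program, List.pairwise_append]
  refine ⟨pairwise_flatMap_range (pairwise_phases _ _) (nil_notMem_phases _ _),
    List.pairwise_singleton _ _, fun a ha b hb => ?_⟩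
  rw [List.mem_singleton] at hb
  subst hb
  obtain ⟨s, hs, h⟩ := List.mem_flatMap.1 ha
  rw [List.mem_range] at hs
  rcases List.mem_cons.1 h with rfl | h
  · exact List.cons_lt_cons_iff.2 (Or.inl hs)
  · obtain ⟨l, -, rfl⟩ := List.mem_map.1 h
    exact List.cons_lt_cons_iff.2 (Or.inl hs)

/-- The path of superstep number `s`. -/
abbrev path (N κ s : ℕ) : List ℕ := (program N κ).getD s []

theorem path_eq_getElem {N κ s : ℕ} (hs : s < (program N κ).length) :
    path N κ s = (program N κ)[s] := by
  rw [path, List.getD_eq_getElem _ _ hs]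

theorem path_mem {N κ s : ℕ} (hs : s < (program N κ).length) : path N κ s ∈ program N κ := by
  rw [path_eq_getElem hs]
  exact List.getElem_mem hs

theorem exists_path_eq {N κ : ℕ} {a : List ℕ} (ha : a ∈ program N κ) :
    ∃ s < (program N κ).length, path N κ s = a := by
  obtain ⟨s, hs, rfl⟩ := List.getElem_of_mem ha
  exact ⟨s, hs, path_eq_getElem hs⟩

theorem path_lt_path {N κ s s' : ℕ} (h : s < s') (hs' : s' < (program N κ).length) :
    path N κ s < path N κ s' := by
  rw [path_eq_getElem (h.trans hs'), path_eq_getElem hs']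
  exact List.pairwise_iff_getElem.1 pairwise_program s s' _ hs' h

theorem lt_of_path_lt_path {N κ s s' : ℕ} (hs : s < (program N κ).length)
    (h : path N κ s < path N κ s') : s < s' := by
  by_contra hc
  rcases Nat.eq_or_lt_of_le (not_lt.1 hc) with rfl | hlt
  · exact absurd h (lt_irrefl _)
  · exact absurd h (lt_asymm (path_lt_path hlt hs))

theorem path_injective {N κ s s' : ℕ} (hs : s < (program N κ).length)
    (hs' : s' < (program N κ).length) (h : path N κ s = path N κ s') : s = s' := by
  rcases lt_trichotomy s s' with hl | hl | hl
  · exact absurd h (path_lt_path hl hs').ne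
  · exact hl
  · exact absurd h (path_lt_path hl hs).ne'

theorem program_eq_cons (N κ : ℕ) : ∃ l, program N κ = [0] :: l :=
  ⟨_, by rw [program, List.range_succ_eq_map, List.flatMap_cons, List.cons_append, List.cons_append]⟩

theorem path_zero (N κ : ℕ) : path N κ 0 = [0] := by
  obtain ⟨l, hl⟩ := program_eq_cons N κ
  rw [path, hl]; rfl

theorem length_program_pos (N κ : ℕ) : 0 < (program N κ).length := by
  obtain ⟨l, hl⟩ := program_eq_cons N κ
  rw [hl]; simp

theorem stepLabel_lt {N κ : ℕ} (hN : 0 < N) (hκ : 0 < κ) {a : List ℕ} (ha : a ∈ program N κ) :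
    stepLabel κ a < N := by
  unfold stepLabel
  rcases (mem_program hκ).1 ha with rfl | ⟨s, -, l, hl, rfl⟩
  · simpa using hN
  · cases l with
    | nil => simpa using hN
    | cons r l => simpa using (hl l.length (by simp)).1

/-! ## The number of supersteps -/

theorem countP_map_cons (l : List (List ℕ)) (r L : ℕ) :
    (l.map (List.cons r)).countP (fun a => a.length ≤ L + 1) =
      l.countP (fun a => a.length ≤ L) := by
  rw [List.countP_map]
  refine List.countP_congr fun a _ => ?_
  simp

theorem countP_flatMap_range (l : List (List ℕ)) (m L : ℕ) :
    ((List.range m).flatMap fun r => [r] :: l.map (List.cons r)).countP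
      (fun a => a.length ≤ L + 1) = m * (l.countP (fun a => a.length ≤ L) + 1) := by
  rw [List.countP_flatMap]
  have : (List.countP (fun a : List ℕ => decide (a.length ≤ L + 1)) ∘
      fun r => [r] :: l.map (List.cons r)) =
      fun _ => l.countP (fun a => a.length ≤ L) + 1 := by
    funext r
    rw [Function.comp, List.countP_cons, countP_map_cons]
    simp
  rw [this, List.map_const', List.sum_replicate, List.length_range, smul_eq_mul]

/-- A level multiplies the number of phases by at most `2 · 2 ^ κ - 1`. Adding `1` to the count
turns the recursion into multiplication by at most `2 ^ (κ + 1)`. -/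
theorem countP_phases_le (κ e L : ℕ) :
    (phases κ e).countP (fun a => a.length ≤ L) + 1 ≤ 2 ^ ((κ + 1) * L) := by
  induction L generalizing e with
  | zero =>
    rw [List.countP_eq_zero.2]
    · simp
    · intro a ha
      cases a with
      | nil => exact absurd ha (nil_notMem_phases _ _)
      | cons => simp
  | succ L ih =>
    rw [phases]
    split_ifs with h
    · rw [countP_flatMap_range]
      have h1 := ih (e - κ)
      have h2 : 2 * 2 ^ min κ e - 1 + 1 ≤ 2 ^ (κ + 1) := by
        have : (2 : ℕ) ^ min κ e ≤ 2 ^ κ := Nat.pow_le_pow_right (by omega) (by omega)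
        have : 1 ≤ (2 : ℕ) ^ min κ e := Nat.one_le_two_pow
        rw [pow_succ]
        omega
      generalize 2 * 2 ^ min κ e - 1 = m at h2 ⊢
      generalize (phases κ (e - κ)).countP (fun a => a.length ≤ L) + 1 = x at h1 ⊢
      have hx : 1 ≤ 2 ^ ((κ + 1) * L) := Nat.one_le_two_pow
      calc m * x + 1 ≤ m * 2 ^ ((κ + 1) * L) + 2 ^ ((κ + 1) * L) :=
            Nat.add_le_add (Nat.mul_le_mul_left _ h1) hx
        _ = (m + 1) * 2 ^ ((κ + 1) * L) := by ring
        _ ≤ 2 ^ (κ + 1) * 2 ^ ((κ + 1) * L) := Nat.mul_le_mul_right _ h2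
        _ = 2 ^ ((κ + 1) * (L + 1)) := by rw [← pow_add]; congr 1; ring
    · simpa using Nat.one_le_two_pow

theorem countP_program_le (N κ L : ℕ) :
    (program N κ).countP (fun a => a.length ≤ L + 1) ≤ 6 * 2 ^ ((κ + 1) * L) := by
  rw [program, List.countP_append, countP_flatMap_range]
  have h1 := countP_phases_le κ N L
  have h2 : [[5]].countP (fun a : List ℕ => decide (a.length ≤ L + 1)) ≤ 1 :=
    (List.countP_le_length).trans (by simp)
  have h3 : 1 ≤ 2 ^ ((κ + 1) * L) := Nat.one_le_two_pow
  omega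

theorem card_filter_path (N κ : ℕ) (p : List ℕ → Bool) :
    (Finset.univ.filter fun s : Fin (program N κ).length => p (path N κ s) = true).card =
      (program N κ).countP p := by
  rw [Finset.card_filter]
  have : ∀ s : Fin (program N κ).length, (if p (path N κ s) = true then 1 else 0) =
      (fun a => if p a = true then 1 else 0) ((program N κ)[s.val]) := fun s => by
    rw [path_eq_getElem s.isLt]
  rw [Finset.sum_congr rfl fun s _ => this s,
    Fin.sum_univ_fun_getElem (program N κ) (fun a => if p a = true then 1 else 0)]
  induction program N κ with
  | nil => rfl
  | cons a l ih => rw [List.map_cons, List.sum_cons, ih, List.countP_cons, add_comm]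

end DiamondStencil

namespace DiamondStencil

/-! ## Rotated coordinates and diamonds -/

theorem ext_pos (N κ i : ℕ) : 0 < ext N κ i := Nat.two_pow_pos _

theorem ext_zero (N κ : ℕ) : ext N κ 0 = 2 ^ N := by simp [ext]

/-- The splitting factor `q` of level `i` is `2 ^ min κ (N - i * κ)`; truncated subtraction produces
the smaller factor of the last split, and `1` below it. -/
theorem ext_succ_mul (N κ i : ℕ) :
    ext N κ (i + 1) * 2 ^ min κ (N - i * κ) = ext N κ i := by
  unfold ext
  rw [← pow_add]
  congr 1
  rw [add_mul, one_mul]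
  omega

theorem ext_dvd_ext (N κ : ℕ) {i j : ℕ} (h : i ≤ j) : ext N κ j ∣ ext N κ i :=
  pow_dvd_pow 2 (by have := Nat.mul_le_mul_right κ h; omega)

theorem ext_dvd (N κ i : ℕ) : ext N κ i ∣ 2 ^ N := ext_zero N κ ▸ ext_dvd_ext N κ (Nat.zero_le i)

theorem lt_mul_of_lt_depth {N κ i : ℕ} (h : i < depth N κ) : i * κ < N := by
  rcases Nat.eq_zero_or_pos κ with rfl | hκ
  · simp [depth] at h
  · have h2 := (Nat.le_div_iff_mul_le hκ).1 (show i + 1 ≤ (N + κ - 1) / κ from h)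
    rw [add_mul, one_mul] at h2
    omega

theorem ext_depth {N κ : ℕ} (hκ : 0 < κ) : ext N κ (depth N κ) = 1 := by
  have h := Nat.lt_mul_div_succ (N + κ - 1) hκ
  unfold ext depth
  rw [mul_add, mul_one, mul_comm] at h
  rw [Nat.sub_eq_zero_of_le (by omega), pow_zero]

theorem two_mul_half {N : ℕ} (hN : 1 ≤ N) : 2 * (2 ^ N / 2) = 2 ^ N :=
  Nat.mul_div_cancel' (dvd_pow_self 2 (by omega))

theorem uCoord_add {N : ℕ} (w : StencilNode (2 ^ N)) :
    uCoord N w + 2 ^ N = vCoord N w + 2 * w.1.val := by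
  have := w.1.isLt
  unfold uCoord vCoord
  omega

theorem uCoord_add_vCoord {N : ℕ} (hN : 1 ≤ N) (w : StencilNode (2 ^ N)) :
    uCoord N w + vCoord N w = 2 * w.2.val + 2 * 2 ^ N := by
  have := w.1.isLt
  have := two_mul_half hN
  unfold uCoord vCoord
  omega

theorem eq_of_coords {N : ℕ} (hN : 1 ≤ N) {w w' : StencilNode (2 ^ N)}
    (hu : uCoord N w = uCoord N w') (hv : vCoord N w = vCoord N w') : w = w' := by
  have h1 := uCoord_add w
  have h2 := uCoord_add w'
  have h3 := uCoord_add_vCoord hN w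
  have h4 := uCoord_add_vCoord hN w'
  exact Prod.ext (Fin.ext (by omega)) (Fin.ext (by omega))

/-- An arc increases `u` by `d = x' - x + 1` and `v` by `2 - d`. -/
theorem coords_of_arc {N : ℕ} {w w' : StencilNode (2 ^ N)} (h : StencilArc w w') :
    w'.1.val + 1 - w.1.val ≤ 2 ∧ uCoord N w' = uCoord N w + (w'.1.val + 1 - w.1.val) ∧
      vCoord N w' + (w'.1.val + 1 - w.1.val) = vCoord N w + 2 := by
  obtain ⟨h1, h2, h3⟩ := h
  have := w.1.isLt
  have := w'.1.isLt
  unfold uCoord vCoord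
  omega

theorem stage_cases {N : ℕ} (hN : 1 ≤ N) (w : StencilNode (2 ^ N)) :
    (uCoord N w / 2 ^ N = 0 ∧ vCoord N w / 2 ^ N = 1) ∨
    (uCoord N w / 2 ^ N = 1 ∧ vCoord N w / 2 ^ N = 0) ∨
    (uCoord N w / 2 ^ N = 1 ∧ vCoord N w / 2 ^ N = 1) ∨
    (uCoord N w / 2 ^ N = 1 ∧ vCoord N w / 2 ^ N = 2) ∨
    (uCoord N w / 2 ^ N = 2 ∧ vCoord N w / 2 ^ N = 1) := by
  have h1 := uCoord_add w
  have h2 := uCoord_add_vCoord hN w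
  have hx := w.1.isLt
  have ht := w.2.isLt
  have hn : 0 < 2 ^ N := by positivity
  have hu := Nat.div_add_mod (uCoord N w) (2 ^ N)
  have hv := Nat.div_add_mod (vCoord N w) (2 ^ N)
  have hu' := Nat.mod_lt (uCoord N w) hn
  have hv' := Nat.mod_lt (vCoord N w) hn
  have ha : uCoord N w / 2 ^ N < 3 := Nat.div_lt_of_lt_mul (by omega)
  have hb : vCoord N w / 2 ^ N < 3 := Nat.div_lt_of_lt_mul (by omega)
  generalize uCoord N w / 2 ^ N = a at *
  generalize vCoord N w / 2 ^ N = b at *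
  -- Of the nine index pairs, the ranges of `u - v = 2 x - n` and `u + v = 2 t + 2 n` leave five.
  interval_cases a <;> interval_cases b <;> omega

theorem stage_lt_five {N : ℕ} (hN : 1 ≤ N) (w : StencilNode (2 ^ N)) : stage N w < 5 := by
  unfold stage
  rcases stage_cases hN w with h | h | h | h | h <;> omega

theorem stage_injective {N : ℕ} (hN : 1 ≤ N) {w w' : StencilNode (2 ^ N)}
    (h : stage N w = stage N w') :
    uCoord N w / 2 ^ N = uCoord N w' / 2 ^ N ∧ vCoord N w / 2 ^ N = vCoord N w' / 2 ^ N := by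
  unfold stage at h
  rcases stage_cases hN w with h1 | h1 | h1 | h1 | h1 <;>
    rcases stage_cases hN w' with h2 | h2 | h2 | h2 | h2 <;> omega

theorem div_ext_congr {N κ u u' : ℕ} {i j : ℕ} (hij : j ≤ i)
    (h : u / ext N κ i = u' / ext N κ i) : u / ext N κ j = u' / ext N κ j := by
  obtain ⟨c, hc⟩ := ext_dvd_ext N κ hij
  rw [hc, ← Nat.div_div_eq_div_mul, ← Nat.div_div_eq_div_mul, h]

theorem mod_ext_div_ext_succ (N κ u i : ℕ) :
    u % ext N κ i / ext N κ (i + 1) = u / ext N κ (i + 1) % 2 ^ min κ (N - i * κ) := by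
  rw [← ext_succ_mul N κ i, Nat.mod_mul_right_div_self]

theorem div_ext_succ (N κ u i : ℕ) :
    u / ext N κ (i + 1) =
      u / ext N κ i * 2 ^ min κ (N - i * κ) + u % ext N κ i / ext N κ (i + 1) := by
  rw [mod_ext_div_ext_succ, ← ext_succ_mul N κ i, ← Nat.div_div_eq_div_mul]
  exact (Nat.div_add_mod' _ _).symm

theorem stripe_congr {N κ i : ℕ} {w w' : StencilNode (2 ^ N)}
    (hu : uCoord N w / ext N κ (i + 1) = uCoord N w' / ext N κ (i + 1))
    (hv : vCoord N w / ext N κ (i + 1) = vCoord N w' / ext N κ (i + 1)) :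
    stripe N κ w i = stripe N κ w' i := by
  unfold stripe
  simp only [mod_ext_div_ext_succ, hu, hv]

/-- Inside a common parent both indices of the smaller diamond are weakly monotone; if one of them
changes, their sum increases. -/
theorem stripe_lt_stripe {N κ i : ℕ} {w w' : StencilNode (2 ^ N)}
    (hu : uCoord N w / ext N κ i = uCoord N w' / ext N κ i)
    (hv : vCoord N w / ext N κ i = vCoord N w' / ext N κ i)
    (hle : uCoord N w ≤ uCoord N w') (hle' : vCoord N w ≤ vCoord N w')
    (hne : uCoord N w / ext N κ (i + 1) ≠ uCoord N w' / ext N κ (i + 1) ∨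
      vCoord N w / ext N κ (i + 1) ≠ vCoord N w' / ext N κ (i + 1)) :
    stripe N κ w i < stripe N κ w' i := by
  have h1 := Nat.div_le_div_right (c := ext N κ (i + 1)) hle
  have h2 := Nat.div_le_div_right (c := ext N κ (i + 1)) hle'
  unfold stripe
  rw [div_ext_succ N κ (uCoord N w) i, div_ext_succ N κ (uCoord N w') i, hu] at h1 hne
  rw [div_ext_succ N κ (vCoord N w) i, div_ext_succ N κ (vCoord N w') i, hv] at h2 hne
  omega

theorem phase_zero (N κ : ℕ) (w : StencilNode (2 ^ N)) : phase N κ w 0 = [stage N w] := rfl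

theorem phase_succ (N κ : ℕ) (w : StencilNode (2 ^ N)) (i : ℕ) :
    phase N κ w (i + 1) = phase N κ w i ++ [stripe N κ w i] := by
  simp [phase, List.range_succ]

theorem length_phase (N κ : ℕ) (w : StencilNode (2 ^ N)) (i : ℕ) :
    (phase N κ w i).length = i + 1 := by
  simp [phase]

theorem phase_congr {N κ : ℕ} {w w' : StencilNode (2 ^ N)} {i : ℕ}
    (hu : uCoord N w / ext N κ i = uCoord N w' / ext N κ i)
    (hv : vCoord N w / ext N κ i = vCoord N w' / ext N κ i) : phase N κ w i = phase N κ w' i := by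
  induction i with
  | zero =>
    rw [ext_zero] at hu hv
    rw [phase_zero, phase_zero, stage, stage, hu, hv]
  | succ i ih =>
    rw [phase_succ, phase_succ, ih (div_ext_congr (Nat.le_succ i) hu)
      (div_ext_congr (Nat.le_succ i) hv), stripe_congr hu hv]

/-- The diamond of the head of an arc is evaluated after the diamond of the tail, unless they are the
same. -/
theorem phase_append_lt {N κ : ℕ} (hN : 1 ≤ N) {w w' : StencilNode (2 ^ N)}
    (hle : uCoord N w ≤ uCoord N w') (hle' : vCoord N w ≤ vCoord N w') {i : ℕ}
    (hne : uCoord N w / ext N κ i ≠ uCoord N w' / ext N κ i ∨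
      vCoord N w / ext N κ i ≠ vCoord N w' / ext N κ i) (L L' : List ℕ) :
    phase N κ w i ++ L < phase N κ w' i ++ L' := by
  -- The order is decided at the outermost level where the diamonds differ; whatever follows in the
  -- lists is irrelevant, hence the arbitrary suffixes.
  induction i generalizing L L' with
  | zero =>
    rw [phase_zero, phase_zero]
    refine List.cons_lt_cons_iff.2 (Or.inl ?_)
    rw [ext_zero] at hne
    have h1 := Nat.div_le_div_right (c := 2 ^ N) hle
    have h2 := Nat.div_le_div_right (c := 2 ^ N) hle'
    unfold stage
    rcases stage_cases hN w with h | h | h | h | h <;> omega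
  | succ i ih =>
    rw [phase_succ, phase_succ, List.append_assoc, List.append_assoc]
    by_cases hu : uCoord N w / ext N κ i = uCoord N w' / ext N κ i
    · by_cases hv : vCoord N w / ext N κ i = vCoord N w' / ext N κ i
      · rw [phase_congr hu hv]
        exact List.append_left_lt
          (List.cons_lt_cons_iff.2 (Or.inl (stripe_lt_stripe hu hv hle hle' hne)))
      · exact ih (Or.inr hv) _ _
    · exact ih (Or.inl hu) _ _

theorem phase_lt_phase_succ (N κ : ℕ) (w : StencilNode (2 ^ N)) (i : ℕ) :
    phase N κ w i < phase N κ w (i + 1) := by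
  conv_lhs => rw [← List.append_nil (phase N κ w i)]
  rw [phase_succ]
  exact List.append_left_lt (List.nil_lt_cons _ _)

theorem stripe_le (N κ : ℕ) (w : StencilNode (2 ^ N)) (i : ℕ) :
    stripe N κ w i < 2 * 2 ^ min κ (N - i * κ) - 1 := by
  unfold stripe
  rw [mod_ext_div_ext_succ, mod_ext_div_ext_succ]
  have h := Nat.two_pow_pos (min κ (N - i * κ))
  have h1 := Nat.mod_lt (uCoord N w / ext N κ (i + 1)) h
  have h2 := Nat.mod_lt (vCoord N w / ext N κ (i + 1)) h
  omega

theorem validPath_map_stripe {N κ i : ℕ} (w : StencilNode (2 ^ N)) (hi : i ≤ depth N κ) :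
    ValidPath κ N ((List.range i).map (stripe N κ w)) := by
  intro k hk
  rw [List.length_map, List.length_range] at hk
  refine ⟨lt_mul_of_lt_depth (by omega), ?_⟩
  simpa using stripe_le N κ w k

theorem phase_mem_program {N κ i : ℕ} (hN : 1 ≤ N) (hκ : 0 < κ) (w : StencilNode (2 ^ N))
    (hi : i ≤ depth N κ) : phase N κ w i ∈ program N κ :=
  (mem_program hκ).2 (Or.inr ⟨_, stage_lt_five hN w, _, validPath_map_stripe w hi, rfl⟩)

theorem exit_mem_program {N κ i r : ℕ} (hN : 1 ≤ N) (hκ : 0 < κ) (w : StencilNode (2 ^ N))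
    (hi : i < depth N κ) (hr : r < 2 * 2 ^ min κ (N - i * κ) - 1) :
    phase N κ w i ++ [r] ∈ program N κ := by
  refine (mem_program hκ).2 (Or.inr ⟨_, stage_lt_five hN w,
    (List.range i).map (stripe N κ w) ++ [r], ?_, rfl⟩)
  intro k hk
  rw [List.length_append, List.length_map, List.length_range, List.length_singleton] at hk
  refine ⟨lt_mul_of_lt_depth (by omega), ?_⟩
  rcases Nat.lt_succ_iff_lt_or_eq.1 hk with h | rfl
  · rw [List.getElem_append_left (by simpa using h)]
    simpa using stripe_le N κ w k
  · simpa using hr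

theorem phase_lt_end {N κ i : ℕ} (hN : 1 ≤ N) (w : StencilNode (2 ^ N)) :
    phase N κ w i < [5] :=
  List.cons_lt_cons_iff.2 (Or.inl (stage_lt_five hN w))

/-! ## Seats -/

theorem mod_two_pow_mod_ext (N κ u i : ℕ) : u % 2 ^ N % ext N κ i = u % ext N κ i :=
  Nat.mod_mod_of_dvd _ (ext_dvd N κ i)

theorem mod_two_pow_div_ext {N κ u u' i : ℕ} (h : u / ext N κ i = u' / ext N κ i) :
    u % 2 ^ N / ext N κ i = u' % 2 ^ N / ext N κ i := by
  obtain ⟨c, hc⟩ := ext_dvd N κ i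
  rw [hc, Nat.mod_mul_right_div_self, Nat.mod_mul_right_div_self, h]

theorem seat_lt (N κ : ℕ) (w : StencilNode (2 ^ N)) (i : ℕ) : seat N κ w i < 2 ^ N :=
  Nat.mod_lt _ (by positivity)

theorem seat_mod_ext (N κ : ℕ) (w : StencilNode (2 ^ N)) (i : ℕ) :
    seat N κ w i % ext N κ i = vCoord N w % ext N κ i := by
  rw [seat, mod_two_pow_mod_ext, Nat.mul_add_mod_self_right, Nat.mod_mod]

theorem seat_div_ext (N κ : ℕ) (w : StencilNode (2 ^ N)) (i : ℕ) :
    seat N κ w i / ext N κ i = uCoord N w % 2 ^ N / ext N κ i := by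
  refine mod_two_pow_div_ext ?_
  rw [mul_comm, Nat.mul_add_div (ext_pos N κ i),
    Nat.div_eq_of_lt (Nat.mod_lt _ (ext_pos N κ i)), add_zero]

theorem seat_succ_div_ext (N κ : ℕ) (w : StencilNode (2 ^ N)) (i : ℕ) :
    seat N κ w (i + 1) / ext N κ i = uCoord N w % 2 ^ N / ext N κ i :=
  div_ext_congr (Nat.le_succ i) (seat_div_ext N κ w (i + 1))

theorem seat_depth {N κ : ℕ} (hκ : 0 < κ) (w : StencilNode (2 ^ N)) :
    seat N κ w (depth N κ) = home N w := by
  rw [seat, home, ext_depth hκ, Nat.div_one, mul_one, Nat.mod_one, add_zero]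

/-- In the last stripe of a diamond there is a single smaller diamond, and it ends where the diamond
ends. -/
theorem seat_succ_eq_seat {N κ i : ℕ} {w : StencilNode (2 ^ N)}
    (h : ¬stripe N κ w i + 1 < 2 * 2 ^ min κ (N - i * κ) - 1) :
    seat N κ w (i + 1) = seat N κ w i := by
  have hq := Nat.two_pow_pos (min κ (N - i * κ))
  have h1 := Nat.mod_lt (uCoord N w / ext N κ (i + 1)) hq
  have h2 := Nat.mod_lt (vCoord N w / ext N κ (i + 1)) hq
  have h3 := div_ext_succ N κ (uCoord N w) i
  rw [stripe] at h
  rw [← mod_ext_div_ext_succ] at h1 h2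
  have h4 := Nat.div_add_mod (vCoord N w % ext N κ i) (ext N κ (i + 1))
  rw [Nat.mod_mod_of_dvd _ (ext_dvd_ext N κ (Nat.le_succ i))] at h4
  have h5 : uCoord N w % ext N κ i / ext N κ (i + 1) =
    vCoord N w % ext N κ i / ext N κ (i + 1) := by omega
  unfold seat
  rw [← h4, h3, ← h5, ← ext_succ_mul N κ i]
  congr 1
  ring

theorem separated_succ {N κ : ℕ} {w w' : StencilNode (2 ^ N)} {i j : ℕ} (hij : i ≤ j)
    (h : Separated N κ w w' i) : Separated N κ w w' j := fun h' => h (div_ext_congr hij h')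

end DiamondStencil

namespace DiamondStencil

open StaticAlg

/-! ## Correctness -/

section Correctness

variable {N κ : ℕ} {π : Equiv.Perm (Fin (2 ^ N))}

theorem some_mem_values {s : ℕ} {y y' : Fin (2 ^ N)} {w : StencilNode (2 ^ N)} :
    some w ∈ values N κ π s y y' ↔
      (∃ w', StencilArc w w' ∧ Hop N κ w w' (path N κ s) y y') ∨
      (s = 0 ∧ w.2.val = 0 ∧ π w.1 = y ∧ home N w = y' ∧ y ≠ y') := by
  simp only [values, Multiset.mem_add, Multiset.mem_map, Finset.mem_val, Finset.mem_filter,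
    Finset.mem_univ, true_and, Option.some.injEq]
  refine or_congr ⟨?_, ?_⟩ ⟨?_, ?_⟩
  · rintro ⟨⟨w, w'⟩, h, rfl⟩; exact ⟨w', h⟩
  · rintro ⟨w', h⟩; exact ⟨(w, w'), h, rfl⟩
  · rintro ⟨w, h, rfl⟩; exact h
  · intro h; exact ⟨w, h, rfl⟩

theorem some_notMem_dummies {s : ℕ} {y y' : Fin (2 ^ N)} {w : StencilNode (2 ^ N)} :
    some w ∉ dummies N κ π s y y' := by
  unfold dummies
  split_ifs
  · intro h
    exact absurd (Multiset.eq_of_mem_replicate h) (by simp)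
  · exact Multiset.notMem_zero _

theorem some_mem_sent {s : Fin (alg N κ π).len} {y y' : Fin (2 ^ N)} {w : StencilNode (2 ^ N)} :
    some w ∈ (alg N κ π).sent s y y' ↔ some w ∈ values N κ π s y y' := by
  change some w ∈ _ + _ ↔ _
  rw [Multiset.mem_add, or_iff_left some_notMem_dummies]

theorem mem_eval_input {s : Fin (alg N κ π).len} {y : Fin (2 ^ N)} {w : StencilNode (2 ^ N)}
    (hw : w.2.val = 0) : w ∈ (alg N κ π).eval s y ↔ s.val = 0 ∧ π w.1 = y := by
  simp only [alg, Finset.mem_filter, Finset.mem_univ, true_and, if_pos hw]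

theorem mem_eval_inner {s : Fin (alg N κ π).len} {y : Fin (2 ^ N)} {w : StencilNode (2 ^ N)}
    (hw : w.2.val ≠ 0) : w ∈ (alg N κ π).eval s y ↔
      0 < s.val ∧ path N κ (s.val - 1) = phase N κ w (depth N κ) ∧ home N w = y := by
  simp only [alg, Finset.mem_filter, Finset.mem_univ, true_and, if_neg hw, path]

theorem exists_eval_step (hN : 1 ≤ N) (hκ : 0 < κ) (w : StencilNode (2 ^ N)) :
    ∃ s, s + 1 < (program N κ).length ∧ path N κ s = phase N κ w (depth N κ) := by
  obtain ⟨s, hs, h⟩ := exists_path_eq (phase_mem_program hN hκ w le_rfl)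
  obtain ⟨s', hs', h'⟩ := exists_path_eq ((mem_program (N := N) hκ).2 (Or.inl rfl))
  have := lt_of_path_lt_path (s' := s') hs (by rw [h, h']; exact phase_lt_end hN w)
  exact ⟨s, by omega, h⟩

/-- From superstep `a` on, excluding `a` itself, the value of `w` is available at `y`. -/
def HeldAfter (N κ : ℕ) (π : Equiv.Perm (Fin (2 ^ N))) (a : List ℕ) (y : ℕ)
    (w : StencilNode (2 ^ N)) : Prop :=
  ∀ s : Fin (alg N κ π).len, a < path N κ s → ∀ r : Fin (2 ^ N), r.val = y →
    (alg N κ π).Knows s r w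

/-- No message is sent when `y = y'`, so superstep `b` need not even occur in the program in that
case; the last stripe of a diamond relies on this. -/
theorem HeldAfter.hop {a b : List ℕ} {y y' : ℕ} {w w' : StencilNode (2 ^ N)}
    (h : HeldAfter N κ π a y w) (hab : a < b) (hy : y < 2 ^ N)
    (hop : y ≠ y' → (StencilArc w w' ∧ Hop N κ w w' b y y') ∧ b ∈ program N κ) :
    HeldAfter N κ π b y' w := by
  intro s hs r hr
  subst hr
  by_cases hyy : y = r.val
  · exact h s (lt_trans hab hs) r hyy.symm
  · obtain ⟨h1, hb⟩ := hop hyy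
    obtain ⟨s₀, hs₀, rfl⟩ := exists_path_eq hb
    have := lt_of_path_lt_path hs₀ hs
    exact Or.inr ⟨⟨s₀, hs₀⟩, this, Or.inr ⟨⟨y, hy⟩, some_mem_sent.2
      (some_mem_values.2 (Or.inl ⟨w', h1⟩))⟩⟩

/-- An input reaches its home in superstep `0`; any other node is evaluated there, in the step just
after the one that starts its one-node phase. -/
theorem heldAfter_home (hN : 1 ≤ N) (hκ : 0 < κ) (w : StencilNode (2 ^ N)) :
    HeldAfter N κ π (phase N κ w (depth N κ)) (home N w) w := by
  intro s hs r hr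
  obtain ⟨s₀, hs₀, h₀⟩ := exists_eval_step hN hκ w
  rw [← h₀] at hs
  have hlt := lt_of_path_lt_path (by omega) hs
  by_cases hw : w.2.val = 0
  · refine Or.inr ⟨⟨0, length_program_pos N κ⟩, Fin.lt_def.2 (by simp; omega), ?_⟩
    by_cases hπ : π w.1 = r
    · exact Or.inl ((mem_eval_input hw).2 ⟨rfl, hπ⟩)
    · exact Or.inr ⟨π w.1, some_mem_sent.2 (some_mem_values.2
        (Or.inr ⟨rfl, hw, rfl, hr.symm, hπ⟩))⟩
  · have he : w ∈ (alg N κ π).eval ⟨s₀ + 1, hs₀⟩ r :=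
      (mem_eval_inner hw).2 ⟨by simp, by simpa using h₀, hr.symm⟩
    rcases Nat.eq_or_lt_of_le hlt with h | h
    · left
      have : s = ⟨s₀ + 1, hs₀⟩ := Fin.ext h.symm
      rwa [this]
    · exact Or.inr ⟨_, Fin.lt_def.2 h, Or.inl he⟩

/-- The climb, by induction from the innermost level outwards: when the next stripe begins, an
output of a smaller diamond moves to its seat in the enclosing one. -/
theorem heldAfter_exit (hN : 1 ≤ N) (hκ : 0 < κ) {w w' : StencilNode (2 ^ N)}
    (ha : StencilArc w w') {i : ℕ} (hi : i ≤ depth N κ) (hs : Separated N κ w w' i) :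
    HeldAfter N κ π (phase N κ w i ++ [stripe N κ w i + 1]) (seat N κ w i) w := by
  induction hi using Nat.decreasingInduction with
  | self =>
    -- At the innermost level the list is not a superstep; it serves only as a bound in the
    -- lexicographic order.
    intro s h r hr
    refine heldAfter_home hN hκ w s (lt_of_le_of_lt ?_ h) r (by rw [hr, seat_depth hκ])
    conv_lhs => rw [← List.append_nil (phase N κ w (depth N κ))]
    exact (List.append_left_lt (List.nil_lt_cons _ _)).le
  | of_succ i hi ih =>
    refine (ih (separated_succ (Nat.le_succ i) hs)).hop (w' := w') ?_ (seat_lt _ _ _ _) fun hne => ?_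
    · rw [phase_succ, List.append_assoc]
      exact List.append_left_lt (List.cons_lt_cons_iff.2 (Or.inl (Nat.lt_succ_self _)))
    · refine ⟨⟨ha, hne, Or.inl ⟨i, hi, hs, rfl, rfl, rfl⟩⟩, exit_mem_program hN hκ w hi ?_⟩
      -- After the last stripe there is no superstep for the move, but then the two seats coincide.
      by_contra h
      exact hne (seat_succ_eq_seat h)

theorem heldAfter_entry (hN : 1 ≤ N) (hκ : 0 < κ) {w w' : StencilNode (2 ^ N)}
    (ha : StencilArc w w') {i : ℕ} (hi : i ≤ depth N κ) (hs : Separated N κ w w' i)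
    (hmin : ∀ j < i, ¬Separated N κ w w' j) :
    HeldAfter N κ π (phase N κ w' i) (seat N κ w' i) w := by
  have hc := coords_of_arc ha
  refine (heldAfter_exit hN hκ ha hi hs).hop (w' := w') ?_ (seat_lt _ _ _ _) fun hne => ?_
  · have := phase_append_lt hN (κ := κ) (w := w) (w' := w') (by omega) (by omega) (Or.inl hs)
      [stripe N κ w i + 1] []
    rwa [List.append_nil] at this
  · exact ⟨⟨ha, hne, Or.inr (Or.inl ⟨i, by omega, ⟨hs, hmin⟩, rfl, rfl, rfl⟩)⟩,
      phase_mem_program hN hκ w' hi⟩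

/-- The descent: the value enters at the outermost separating level and is handed inwards from one
level to the next, along the phases of `w'`. -/
theorem heldAfter_phase (hN : 1 ≤ N) (hκ : 0 < κ) {w w' : StencilNode (2 ^ N)}
    (ha : StencilArc w w') {i : ℕ} (hi : i ≤ depth N κ) (hs : Separated N κ w w' i) :
    HeldAfter N κ π (phase N κ w' i) (seat N κ w' i) w := by
  induction i with
  | zero => exact heldAfter_entry hN hκ ha hi hs (by simp)
  | succ i ih =>
    by_cases hs' : Separated N κ w w' i
    · refine (ih (by omega) hs').hop (w' := w') (phase_lt_phase_succ N κ w' i)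
        (seat_lt _ _ _ _) fun hne => ?_
      exact ⟨⟨ha, hne, Or.inr (Or.inr ⟨i, by omega, hs', rfl, rfl, rfl⟩)⟩,
        phase_mem_program hN hκ w' hi⟩
    · exact heldAfter_entry hN hκ ha hi hs fun j hj hsj =>
        hs' (separated_succ (by omega) hsj)

/-- Before the one-node diamond of `w'` is evaluated, its processor has received the operand `w`. -/
theorem heldAfter_operand (hN : 1 ≤ N) (hκ : 0 < κ) {w w' : StencilNode (2 ^ N)}
    (ha : StencilArc w w') :
    HeldAfter N κ π (phase N κ w' (depth N κ)) (home N w') w := by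
  by_cases hs : Separated N κ w w' (depth N κ)
  · rw [← seat_depth hκ]
    exact heldAfter_phase hN hκ ha le_rfl hs
  · have hc := coords_of_arc ha
    -- Segments of extent `1` agree, so the arc keeps `u`, and with it the processor; no message is
    -- needed, and `v` grows by `2`.
    have hu : uCoord N w = uCoord N w' := by
      simpa [Separated, ext_depth hκ] using hs
    have hh : home N w' = home N w := by rw [home, home, hu]
    rw [hh]
    intro s h r hr
    refine heldAfter_home hN hκ w s (lt_trans ?_ h) r hr
    have := phase_append_lt hN (κ := κ) (w := w) (w' := w') (i := depth N κ) (by omega) (by omega)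
      (Or.inr (by rw [ext_depth hκ, Nat.div_one, Nat.div_one]; omega)) [] []
    rwa [List.append_nil, List.append_nil] at this

theorem div_two_pow_sub_stepLabel {s : List ℕ} {i : ℕ} (hi : s.length = i + 2) :
    2 ^ (N - stepLabel κ s) = ext N κ i := by
  rw [stepLabel, hi, Nat.add_sub_cancel, ext]

/-- A list of length `i + 2` has clusters of size `ext N κ i`. Climbing and descending stay in the
segment of one level-`i` diamond; crossing at level `i + 1` does so because level `i` does not yet
separate the ends. -/
theorem hop_cluster {w w' : StencilNode (2 ^ N)} {a : List ℕ} {y y' : ℕ}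
    (h : Hop N κ w w' a y y') :
    y / 2 ^ (N - stepLabel κ a) = y' / 2 ^ (N - stepLabel κ a) := by
  obtain ⟨-, ⟨i, hi, hs, rfl, rfl, rfl⟩ | ⟨i, hi, ⟨hs, hmin⟩, rfl, rfl, rfl⟩ |
    ⟨i, hi, hs, rfl, rfl, rfl⟩⟩ := h
  · rw [div_two_pow_sub_stepLabel (by rw [List.length_append, length_phase]; rfl),
      seat_succ_div_ext, seat_div_ext]
  · cases i with
    | zero =>
      have : stepLabel κ (phase N κ w' 0) = 0 := by simp [stepLabel, length_phase]
      rw [this, Nat.sub_zero, Nat.div_eq_of_lt (seat_lt _ _ _ _),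
        Nat.div_eq_of_lt (seat_lt _ _ _ _)]
    | succ i =>
      rw [div_two_pow_sub_stepLabel (length_phase _ _ _ _), seat_succ_div_ext, seat_succ_div_ext]
      exact mod_two_pow_div_ext (not_not.1 (hmin i (Nat.lt_succ_self i)))
  · rw [div_two_pow_sub_stepLabel (length_phase _ _ _ _), seat_succ_div_ext, seat_div_ext]

theorem xor_two_pow_div {l y : ℕ} (hl : l < N) :
    (y ^^^ 2 ^ (N - 1 - l)) / 2 ^ (N - l) = y / 2 ^ (N - l) := by
  rw [← Nat.shiftRight_eq_div_pow, ← Nat.shiftRight_eq_div_pow, Nat.shiftRight_xor_distrib,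
    Nat.shiftRight_eq_div_pow (2 ^ _),
    Nat.div_eq_of_lt (Nat.pow_lt_pow_right (by norm_num) (by omega)), Nat.xor_zero]

theorem alg_evaluates (hN : 1 ≤ N) (hκ : 0 < κ) (π : Equiv.Perm (Fin (2 ^ N))) :
    (alg N κ π).Evaluates StencilArc where
  complete w := by
    by_cases hw : w.2.val = 0
    · exact ⟨⟨0, length_program_pos N κ⟩, π w.1, (mem_eval_input hw).2 ⟨rfl, rfl⟩⟩
    · obtain ⟨s₀, hs₀, h₀⟩ := exists_eval_step hN hκ w
      exact ⟨⟨s₀ + 1, hs₀⟩, ⟨home N w, Nat.mod_lt _ (by positivity)⟩,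
        (mem_eval_inner hw).2 ⟨by simp, by simpa using h₀, rfl⟩⟩
  operands s r w' hw' w ha := by
    have h0 : w'.2.val ≠ 0 := by have := ha.1; omega
    obtain ⟨hs, hp, hh⟩ := (mem_eval_inner h0).1 hw'
    refine heldAfter_operand hN hκ ha s ?_ r hh.symm
    rw [← hp]
    exact path_lt_path (by omega) s.isLt
  messages s r r' w h := by
    rcases some_mem_values.1 (some_mem_sent.1 h) with ⟨w', ha, -, h | h | h⟩ | h
    · obtain ⟨i, hi, hs, hp, hr, -⟩ := h
      refine heldAfter_exit hN hκ ha hi (separated_succ (Nat.le_succ i) hs) s ?_ r hr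
      rw [hp, phase_succ, List.append_assoc]
      exact List.append_left_lt (List.cons_lt_cons_iff.2 (Or.inl (Nat.lt_succ_self _)))
    · obtain ⟨i, hi, ⟨hs, -⟩, hp, hr, -⟩ := h
      have hc := coords_of_arc ha
      refine heldAfter_exit hN hκ ha (by omega) hs s ?_ r hr
      rw [hp]
      have := phase_append_lt hN (κ := κ) (w := w) (w' := w') (by omega) (by omega) (Or.inl hs)
        [stripe N κ w i + 1] []
      rwa [List.append_nil] at this
    · obtain ⟨i, hi, hs, hp, hr, -⟩ := h
      refine heldAfter_phase hN hκ ha hi.le hs s ?_ r hr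
      rw [hp]
      exact phase_lt_phase_succ N κ w' i
    · obtain ⟨hs, hw, hr, -, -⟩ := h
      exact Or.inl ((mem_eval_input hw).2 ⟨hs, hr⟩)
  clusters s r r' h := by
    obtain ⟨m, hm⟩ := Multiset.exists_mem_of_ne_zero h
    change r.val / 2 ^ (N - stepLabel κ (path N κ s)) = r'.val / 2 ^ (N - stepLabel κ (path N κ s))
    change m ∈ values N κ π s r r' + dummies N κ π s r r' at hm
    rcases Multiset.mem_add.1 hm with hm | hm
    · have hv : ∃ w, m = some w := by
        rcases Multiset.mem_add.1 hm with hm | hm <;>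
          obtain ⟨e, -, rfl⟩ := Multiset.mem_map.1 hm <;> exact ⟨_, rfl⟩
      obtain ⟨w, rfl⟩ := hv
      rcases some_mem_values.1 hm with ⟨w', -, h⟩ | h
      · exact hop_cluster h
      · rw [h.1, path_zero]
        simp only [stepLabel, List.length_singleton, Nat.sub_eq_zero_of_le, Nat.one_le_ofNat,
          zero_mul, Nat.sub_zero]
        rw [Nat.div_eq_of_lt r.isLt, Nat.div_eq_of_lt r'.isLt]
    · unfold dummies at hm
      split_ifs at hm with hx
      · rw [hx, xor_two_pow_div (stepLabel_lt hN hκ (path_mem s.isLt))]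
      · exact absurd hm (Multiset.notMem_zero _)

theorem alg_evaluatesOnce (hN : 1 ≤ N) (hκ : 0 < κ) (π : Equiv.Perm (Fin (2 ^ N))) :
    (alg N κ π).EvaluatesOnce := by
  intro w
  obtain ⟨s, r, h⟩ := (alg_evaluates hN hκ π).complete w
  refine ⟨(s, r), h, ?_⟩
  rintro ⟨s', r'⟩ h'
  by_cases hw : w.2.val = 0
  · rw [mem_eval_input hw] at h h'
    exact Prod.ext (Fin.ext (h'.1.trans h.1.symm)) (h'.2.symm.trans h.2)
  · rw [mem_eval_inner hw] at h h'
    obtain ⟨h1, h2, h3⟩ := h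
    obtain ⟨h1', h2', h3'⟩ := h'
    have := path_injective (by have := s'.isLt; exact lt_of_le_of_lt (Nat.sub_le _ _) this)
      (by have := s.isLt; exact lt_of_le_of_lt (Nat.sub_le _ _) this) (h2'.trans h2.symm)
    exact Prod.ext (Fin.ext (by simp only at *; omega)) (Fin.ext (h3'.symm.trans h3))

theorem eq_of_add_mod_eq {n x x' c : ℕ} (hx : x < n) (hx' : x' < n)
    (h : (x + c) % n = (x' + c) % n) : x = x' := by
  have : x ≡ x' [MOD n] := Nat.ModEq.add_right_cancel' c h
  rwa [Nat.ModEq, Nat.mod_eq_of_lt hx, Nat.mod_eq_of_lt hx'] at this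

/-- On a row `home` is a cyclic shift. Hence each virtual processor evaluates at most one node per
row, which gives the work bound `n`. -/
theorem eq_of_home_eq {w w' : StencilNode (2 ^ N)} (ht : w.2 = w'.2)
    (h : home N w = home N w') : w = w' := by
  unfold home uCoord at h
  rw [ht, add_assoc, add_assoc] at h
  exact Prod.ext (Fin.ext (eq_of_add_mod_eq w.1.isLt w'.1.isLt h)) ht

theorem alg_work_le (hN : 1 ≤ N) (hκ : 0 < κ) (π : Equiv.Perm (Fin (2 ^ N))) (r : Fin (2 ^ N)) :
    (alg N κ π).work r ≤ 2 ^ N := by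
  have hO := alg_evaluatesOnce hN hκ π
  unfold work
  rw [← Finset.card_biUnion]
  · calc _ ≤ (Finset.univ : Finset (Fin (2 ^ N))).card :=
          Finset.card_le_card_of_injOn (fun w => w.2) (fun _ _ => Finset.mem_coe.2 (Finset.mem_univ _)) ?_
      _ = 2 ^ N := by rw [Finset.card_univ, Fintype.card_fin]
    intro w hw w' hw' ht
    simp only [Finset.coe_biUnion, Set.mem_iUnion, Finset.mem_coe] at hw hw'
    obtain ⟨s, -, h⟩ := hw
    obtain ⟨s', -, h'⟩ := hw'
    simp only at ht
    by_cases h0 : w.2.val = 0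
    · rw [mem_eval_input h0] at h
      rw [mem_eval_input (ht ▸ h0)] at h'
      exact Prod.ext (π.injective (h.2.trans h'.2.symm)) ht
    · rw [mem_eval_inner h0] at h
      rw [mem_eval_inner (ht ▸ h0)] at h'
      exact eq_of_home_eq ht (h.2.2.trans h'.2.2.symm)
  · intro s _ s' _ hne
    refine Finset.disjoint_left.2 fun w h h' => hne ?_
    exact (hO.mem_eval_iff.1 h).1.trans (hO.mem_eval_iff.1 h').1.symm

theorem alg_isSpecification (hN : 1 ≤ N) (hκ : 0 < κ) (π : Equiv.Perm (Fin (2 ^ N))) :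
    (alg N κ π).IsSpecification :=
  ⟨length_program_pos N κ, fun s => stepLabel_lt hN hκ (path_mem s.isLt)⟩

end Correctness

end DiamondStencil

/-! ### Membership in the class -/

/-- Folding an evenly balanced algorithm keeps the work balanced. -/
theorem StencilAdmissible.of_work_le {N Q : ℕ} {ε : ℝ} (hε : 1 / 2 ≤ ε) (hQ : 1 ≤ Q) (hQN : Q ≤ N)
    {A : StaticAlg (StencilNode (2 ^ N)) Q} (hE : A.Evaluates StencilArc) (hO : A.EvaluatesOnce)
    (hW : ∀ r, A.work r ≤ 2 ^ (N - Q) * 2 ^ N) : StencilAdmissible ε A where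
  evaluates := hE
  once := hO
  balanced r := by
    have h1 : (2 * A.work r : ℕ) ≤ (2 ^ N) ^ 2 := by
      have h2 : 2 * 2 ^ (N - Q) ≤ 2 ^ N := by
        rw [← pow_succ']
        exact Nat.pow_le_pow_right (by norm_num) (by omega)
      calc 2 * A.work r ≤ 2 * (2 ^ (N - Q) * 2 ^ N) := Nat.mul_le_mul_left _ (hW r)
        _ = (2 * 2 ^ (N - Q)) * 2 ^ N := by ring
        _ ≤ 2 ^ N * 2 ^ N := Nat.mul_le_mul_right _ h2
        _ = (2 ^ N) ^ 2 := (sq _).symm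
    have h3 : (2 * A.work r : ℝ) ≤ (2 ^ N) ^ 2 := by exact_mod_cast h1
    push_cast
    have h4 : (0 : ℝ) ≤ (2 ^ N) ^ 2 := by positivity
    nlinarith

theorem ClassC1.of_work_le {N Q : ℕ} {ε : ℝ} (hε : 1 / 2 ≤ ε) (hQ : 1 ≤ Q) (hQN : Q ≤ N)
    {A : StaticAlg (StencilNode (2 ^ N)) Q} (hE : A.Evaluates StencilArc) (hO : A.EvaluatesOnce)
    (hW : ∀ r, A.work r ≤ 2 ^ (N - Q) * 2 ^ N) : ClassC1 ε A := by
  refine ⟨.of_work_le hε hQ hQN hE hO hW, fun j hj hjQ =>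
    .of_work_le hε hj (by omega) (hE.fold hjQ.le) (hO.fold hjQ.le) fun r => ?_⟩
  refine (A.work_fold_le hjQ.le hW r).trans_eq ?_
  rw [← mul_assoc, ← pow_add]
  congr 2
  omega

theorem DiamondStencil.alg_classC1 {N κ : ℕ} (hN : 1 ≤ N) (hκ : 0 < κ)
    (π : Equiv.Perm (Fin (2 ^ N))) : ClassC1 (1 / 2) (alg N κ π) :=
  .of_work_le le_rfl hN le_rfl (alg_evaluates hN hκ π) (alg_evaluatesOnce hN hκ π)
    fun r => by simpa using alg_work_le hN hκ π r

theorem DiamondStencil.alg_fold_classC1 {N κ j : ℕ} {ε : ℝ} (hε : 1 / 2 ≤ ε) (hκ : 0 < κ)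
    (hj : 1 ≤ j) (hjN : j ≤ N) (π : Equiv.Perm (Fin (2 ^ N))) :
    ClassC1 ε ((alg N κ π).fold j) :=
  .of_work_le hε hj hjN ((alg_evaluates (hj.trans hjN) hκ π).fold hjN)
    ((alg_evaluatesOnce (hj.trans hjN) hκ π).fold hjN)
    (StaticAlg.work_fold_le _ hjN (alg_work_le (hj.trans hjN) hκ π))

namespace DiamondStencil

open StaticAlg

/-! ## The degrees of the supersteps -/

section Degree

variable {N κ : ℕ}

theorem eq_of_div_eq_of_mod_eq {a b E : ℕ} (h : a / E = b / E) (h' : a % E = b % E) : a = b := by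
  rw [← Nat.div_add_mod a E, ← Nat.div_add_mod b E, h, h']

/-- On each level the stripe number `a + b` and the index `a`, read off `u`, determine `b`. -/
theorem vCoord_div_ext_congr (hN : 1 ≤ N) {w w' : StencilNode (2 ^ N)} {i : ℕ}
    (hp : phase N κ w i = phase N κ w' i)
    (hu : uCoord N w / ext N κ i = uCoord N w' / ext N κ i) :
    vCoord N w / ext N κ i = vCoord N w' / ext N κ i := by
  induction i with
  | zero =>
    rw [phase_zero, phase_zero, List.cons.injEq] at hp
    rw [ext_zero]
    exact (stage_injective hN hp.1).2
  | succ i ih =>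
    rw [phase_succ, phase_succ] at hp
    obtain ⟨h1, h2⟩ := List.append_inj' hp rfl
    rw [List.cons.injEq] at h2
    have h3 := ih h1 (div_ext_congr (Nat.le_succ i) hu)
    have h4 := h2.1
    unfold stripe at h4
    rw [mod_ext_div_ext_succ N κ (uCoord N w), mod_ext_div_ext_succ N κ (uCoord N w'), hu] at h4
    rw [div_ext_succ N κ (vCoord N w), div_ext_succ N κ (vCoord N w'), h3]
    omega

theorem head_phase (w : StencilNode (2 ^ N)) (i : ℕ) :
    (phase N κ w i).head? = some (stage N w) := rfl

/-- The phase of a diamond and its segment of virtual processors determine it. -/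
theorem div_ext_congr_of_phase (hN : 1 ≤ N) {w w' : StencilNode (2 ^ N)} {i : ℕ}
    (hp : phase N κ w i = phase N κ w' i)
    (hu : uCoord N w % 2 ^ N / ext N κ i = uCoord N w' % 2 ^ N / ext N κ i) :
    uCoord N w / ext N κ i = uCoord N w' / ext N κ i ∧
      vCoord N w / ext N κ i = vCoord N w' / ext N κ i := by
  have hs : stage N w = stage N w' := by
    have := congrArg List.head? hp
    rwa [head_phase, head_phase, Option.some.injEq] at this
  have h0 := (stage_injective hN hs).1
  have key : uCoord N w / ext N κ i = uCoord N w' / ext N κ i := by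
    obtain ⟨c, hc⟩ := ext_dvd N κ i
    rw [hc, Nat.mod_mul_right_div_self, Nat.mod_mul_right_div_self] at hu
    rw [hc, ← Nat.div_div_eq_div_mul, ← Nat.div_div_eq_div_mul] at h0
    exact eq_of_div_eq_of_mod_eq h0 hu
  exact ⟨key, vCoord_div_ext_congr hN hp key⟩

/-- Two consecutive residues differ in parity, and reduction modulo an even `E` preserves parity.
For `E = 1` there is only one residue. -/
theorem mod_eq_of_parity {E m u u' : ℕ} (hE : E = 2 ^ m) (hp : u % 2 = u' % 2)
    (h : (E ≤ u % E + 2 ∧ E ≤ u' % E + 2) ∨ (u % E < 2 ∧ u' % E < 2)) : u % E = u' % E := by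
  have hpos : 0 < E := hE ▸ Nat.two_pow_pos m
  have h1 := Nat.mod_lt u hpos
  have h2 := Nat.mod_lt u' hpos
  rcases Nat.eq_zero_or_pos m with rfl | hm
  · rw [pow_zero] at hE
    omega
  · have h2E : 2 ∣ E := hE ▸ dvd_pow_self 2 (by omega)
    rw [← Nat.mod_mod_of_dvd u h2E, ← Nat.mod_mod_of_dvd u' h2E] at hp
    omega

/-- An arc raises `u` by at most `2`, so it leaves a segment from its last two positions and lands
in the first two of the next. -/
theorem mod_of_separated {w w' : StencilNode (2 ^ N)} (ha : StencilArc w w') {i : ℕ}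
    (hs : Separated N κ w w' i) :
    ext N κ i ≤ uCoord N w % ext N κ i + 2 ∧ uCoord N w' % ext N κ i < 2 := by
  obtain ⟨hd, hu, -⟩ := coords_of_arc ha
  unfold Separated at hs
  generalize w'.1.val + 1 - w.1.val = d at hd hu
  have hE := ext_pos N κ i
  generalize ext N κ i = E at *
  generalize uCoord N w = u at *
  generalize uCoord N w' = u' at *
  have h1 := Nat.div_add_mod u E
  have h2 := Nat.div_add_mod u' E
  have h3 := Nat.mod_lt u hE
  have h4 := Nat.mod_lt u' hE
  constructor
  · by_contra hc
    refine hs (Nat.div_eq_of_lt_le ?_ ?_).symm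
    · rw [mul_comm]; omega
    · rw [add_mul, one_mul, mul_comm]; omega
  · by_contra hc
    refine hs (Nat.div_eq_of_lt_le ?_ ?_)
    · rw [mul_comm]; omega
    · rw [add_mul, one_mul, mul_comm]; omega

theorem seat_congr {w w' : StencilNode (2 ^ N)} {i : ℕ} (h : seat N κ w i = seat N κ w' i) :
    uCoord N w % 2 ^ N / ext N κ i = uCoord N w' % 2 ^ N / ext N κ i ∧
      vCoord N w % ext N κ i = vCoord N w' % ext N κ i := by
  rw [← seat_div_ext, ← seat_div_ext, ← seat_mod_ext, ← seat_mod_ext, h]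
  exact ⟨rfl, rfl⟩

/-- What distinguishes the arcs whose values pass a given processor in a given superstep: the
direction of the arc and the parity of the coordinate `u` of its tail. -/
def arcCode (N : ℕ) (e : StencilNode (2 ^ N) × StencilNode (2 ^ N)) : ℕ × ℕ :=
  (e.2.1.val + 1 - e.1.1.val, uCoord N e.1 % 2)

theorem arcCode_mem {e : StencilNode (2 ^ N) × StencilNode (2 ^ N)} (he : StencilArc e.1 e.2) :
    arcCode N e ∈ Finset.range 3 ×ˢ Finset.range 2 := by
  refine Finset.mem_product.2 ⟨Finset.mem_range.2 ?_, Finset.mem_range.2 (Nat.mod_lt _ two_pos)⟩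
  have := he.2
  simp only [arcCode]
  omega

/-- Two arcs with the same code. -/
structure SameCode (N : ℕ) (e e' : StencilNode (2 ^ N) × StencilNode (2 ^ N)) : Prop where
  arc : StencilArc e.1 e.2
  arc' : StencilArc e'.1 e'.2
  code : arcCode N e = arcCode N e'

section

variable {e e' : StencilNode (2 ^ N) × StencilNode (2 ^ N)}

theorem SameCode.tail_parity (h : SameCode N e e') : uCoord N e.1 % 2 = uCoord N e'.1 % 2 :=
  congrArg Prod.snd h.code

theorem SameCode.shift (h : SameCode N e e') : ∃ d ≤ 2,
    (uCoord N e.2 = uCoord N e.1 + d ∧ vCoord N e.2 + d = vCoord N e.1 + 2) ∧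
      (uCoord N e'.2 = uCoord N e'.1 + d ∧ vCoord N e'.2 + d = vCoord N e'.1 + 2) := by
  have h1 := coords_of_arc h.arc
  have h2 := coords_of_arc h.arc'
  have h3 : e.2.1.val + 1 - e.1.1.val = e'.2.1.val + 1 - e'.1.1.val := congrArg Prod.fst h.code
  rw [← h3] at h2
  exact ⟨_, h1.1, h1.2, h2.2⟩

theorem SameCode.head_parity (h : SameCode N e e') : uCoord N e.2 % 2 = uCoord N e'.2 % 2 := by
  obtain ⟨d, -, h1, h2⟩ := h.shift
  have := h.tail_parity
  omega

theorem SameCode.eq_of_tail (hN : 1 ≤ N) (h : SameCode N e e')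
    (hu : uCoord N e.1 = uCoord N e'.1) (hv : vCoord N e.1 = vCoord N e'.1) : e = e' := by
  obtain ⟨d, -, h1, h2⟩ := h.shift
  exact Prod.ext (eq_of_coords hN hu hv) (eq_of_coords hN (by omega) (by omega))

theorem SameCode.eq_of_head (hN : 1 ≤ N) (h : SameCode N e e')
    (hu : uCoord N e.2 = uCoord N e'.2) (hv : vCoord N e.2 = vCoord N e'.2) : e = e' := by
  obtain ⟨d, -, h1, h2⟩ := h.shift
  exact h.eq_of_tail hN (by omega) (by omega)

variable {i : ℕ}

theorem SameCode.tail_mod (h : SameCode N e e') (hs : Separated N κ e.1 e.2 i)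
    (hs' : Separated N κ e'.1 e'.2 i) : uCoord N e.1 % ext N κ i = uCoord N e'.1 % ext N κ i :=
  mod_eq_of_parity rfl h.tail_parity
    (Or.inl ⟨(mod_of_separated h.arc hs).1, (mod_of_separated h.arc' hs').1⟩)

theorem SameCode.head_mod (h : SameCode N e e') (hs : Separated N κ e.1 e.2 i)
    (hs' : Separated N κ e'.1 e'.2 i) : uCoord N e.2 % ext N κ i = uCoord N e'.2 % ext N κ i :=
  mod_eq_of_parity rfl h.head_parity
    (Or.inr ⟨(mod_of_separated h.arc hs).2, (mod_of_separated h.arc' hs').2⟩)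

/-- The seat gives the segment and the offset of `v`; with the phase, the segment determines the
diamond; the code gives the offset of `u`. Either seat, of sender or receiver, suffices. -/
theorem SameCode.eq_of_leave (hN : 1 ≤ N) (h : SameCode N e e') (hs : Separated N κ e.1 e.2 i)
    (hs' : Separated N κ e'.1 e'.2 i)
    (hp : phase N κ e.1 i ++ [stripe N κ e.1 i + 1] = phase N κ e'.1 i ++ [stripe N κ e'.1 i + 1])
    (hseat : seat N κ e.1 (i + 1) = seat N κ e'.1 (i + 1) ∨ seat N κ e.1 i = seat N κ e'.1 i) :
    e = e' := by
  obtain ⟨h1, h2⟩ := List.append_inj' hp rfl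
  rw [List.cons.injEq, Nat.add_right_cancel_iff] at h2
  have hmod := h.tail_mod hs hs'
  rcases hseat with h3 | h3
  · obtain ⟨h4, h5⟩ := seat_congr h3
    obtain ⟨h6, h7⟩ := div_ext_congr_of_phase hN (by rw [phase_succ, phase_succ, h1, h2.1]) h4
    exact h.eq_of_tail hN (eq_of_div_eq_of_mod_eq (div_ext_congr (Nat.le_succ i) h6) hmod)
      (eq_of_div_eq_of_mod_eq h7 h5)
  · obtain ⟨h4, h5⟩ := seat_congr h3
    obtain ⟨h6, h7⟩ := div_ext_congr_of_phase hN h1 h4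
    exact h.eq_of_tail hN (eq_of_div_eq_of_mod_eq h6 hmod) (eq_of_div_eq_of_mod_eq h7 h5)

theorem SameCode.eq_of_cross (hN : 1 ≤ N) (h : SameCode N e e') (hs : Separated N κ e.1 e.2 i)
    (hs' : Separated N κ e'.1 e'.2 i) (hp : phase N κ e.2 i = phase N κ e'.2 i)
    (hseat : seat N κ e.1 i = seat N κ e'.1 i ∨ seat N κ e.2 i = seat N κ e'.2 i) :
    e = e' := by
  obtain ⟨d, -, ⟨hu, hv⟩, hu', hv'⟩ := h.shift
  rcases hseat with h3 | h3
  · obtain ⟨h4, h5⟩ := seat_congr h3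
    have h6 : uCoord N e.1 % 2 ^ N = uCoord N e'.1 % 2 ^ N := by
      refine eq_of_div_eq_of_mod_eq h4 ?_
      rw [mod_two_pow_mod_ext, mod_two_pow_mod_ext]
      exact h.tail_mod hs hs'
    -- The superstep names the phase of the head while the seat belongs to the tail, so the position
    -- is first shifted along the common direction of the arcs.
    have h7 : uCoord N e.2 % 2 ^ N = uCoord N e'.2 % 2 ^ N := by
      rw [hu, hu']
      exact Nat.ModEq.add_right d h6
    obtain ⟨h8, h9⟩ := div_ext_congr_of_phase hN hp (by rw [h7])
    have h10 := div_ext_congr (Nat.zero_le i) h8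
    rw [ext_zero] at h10
    have h11 : vCoord N e.2 % ext N κ i = vCoord N e'.2 % ext N κ i := by
      refine Nat.ModEq.add_right_cancel' d (n := ext N κ i) ?_
      rw [hv, hv']
      exact Nat.ModEq.add_right 2 h5
    exact h.eq_of_head hN (eq_of_div_eq_of_mod_eq h10 h7) (eq_of_div_eq_of_mod_eq h9 h11)
  · obtain ⟨h4, h5⟩ := seat_congr h3
    obtain ⟨h6, h7⟩ := div_ext_congr_of_phase hN hp h4
    exact h.eq_of_head hN (eq_of_div_eq_of_mod_eq h6 (h.head_mod hs hs'))
      (eq_of_div_eq_of_mod_eq h7 h5)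

theorem SameCode.eq_of_enter (hN : 1 ≤ N) (h : SameCode N e e') (hs : Separated N κ e.1 e.2 i)
    (hs' : Separated N κ e'.1 e'.2 i) (hp : phase N κ e.2 (i + 1) = phase N κ e'.2 (i + 1))
    (hseat : seat N κ e.2 i = seat N κ e'.2 i ∨ seat N κ e.2 (i + 1) = seat N κ e'.2 (i + 1)) :
    e = e' := by
  have hmod := h.head_mod hs hs'
  rcases hseat with h3 | h3
  · obtain ⟨h4, h5⟩ := seat_congr h3
    have h6 : uCoord N e.2 % 2 ^ N = uCoord N e'.2 % 2 ^ N := by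
      refine eq_of_div_eq_of_mod_eq h4 ?_
      rw [mod_two_pow_mod_ext, mod_two_pow_mod_ext]
      exact hmod
    obtain ⟨h8, h9⟩ := div_ext_congr_of_phase hN hp (by rw [h6])
    have h10 := div_ext_congr (Nat.zero_le _) h8
    rw [ext_zero] at h10
    have h11 : vCoord N e.2 % ext N κ (i + 1) = vCoord N e'.2 % ext N κ (i + 1) := by
      rw [← Nat.mod_mod_of_dvd (vCoord N e.2) (ext_dvd_ext N κ (Nat.le_succ i)), h5,
        Nat.mod_mod_of_dvd _ (ext_dvd_ext N κ (Nat.le_succ i))]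
    exact h.eq_of_head hN (eq_of_div_eq_of_mod_eq h10 h6) (eq_of_div_eq_of_mod_eq h9 h11)
  · obtain ⟨h4, h5⟩ := seat_congr h3
    obtain ⟨h6, h7⟩ := div_ext_congr_of_phase hN hp h4
    exact h.eq_of_head hN (eq_of_div_eq_of_mod_eq (div_ext_congr (Nat.le_succ i) h6) hmod)
      (eq_of_div_eq_of_mod_eq h7 h5)

end

/-- The value of `w` leaves the level-`(i + 1)` diamond of `w` and is kept as an output of its
level-`i` diamond. -/
def Leave (N κ : ℕ) (w w' : StencilNode (2 ^ N)) (a : List ℕ) (y y' : ℕ) : Prop :=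
  ∃ i < depth N κ, Separated N κ w w' i ∧ a = phase N κ w i ++ [stripe N κ w i + 1] ∧
    y = seat N κ w (i + 1) ∧ y' = seat N κ w i

/-- The value of `w` becomes an input of the level-`i` diamond of `w'`. -/
def Cross (N κ : ℕ) (w w' : StencilNode (2 ^ N)) (a : List ℕ) (y y' : ℕ) : Prop :=
  ∃ i < depth N κ + 1, (Separated N κ w w' i ∧ ∀ j < i, ¬ Separated N κ w w' j) ∧
    a = phase N κ w' i ∧ y = seat N κ w i ∧ y' = seat N κ w' i

/-- The value of `w` is passed on from the level-`i` to the level-`(i + 1)` diamond of `w'`. -/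
def Enter (N κ : ℕ) (w w' : StencilNode (2 ^ N)) (a : List ℕ) (y y' : ℕ) : Prop :=
  ∃ i < depth N κ, Separated N κ w w' i ∧ a = phase N κ w' (i + 1) ∧
    y = seat N κ w' i ∧ y' = seat N κ w' (i + 1)

variable {e e' : StencilNode (2 ^ N) × StencilNode (2 ^ N)} {a : List ℕ} {y y' z z' : ℕ}

theorem Leave.unique (hN : 1 ≤ N) (h : SameCode N e e') (h1 : Leave N κ e.1 e.2 a y y')
    (h2 : Leave N κ e'.1 e'.2 a z z') (hyz : y = z ∨ y' = z') : e = e' ∧ y = z ∧ y' = z' := by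
  obtain ⟨i, hi, hs, rfl, rfl, rfl⟩ := h1
  obtain ⟨i', hi', hs', hp, rfl, rfl⟩ := h2
  have hii : i = i' := by simpa [length_phase] using congrArg List.length hp
  subst hii
  have := h.eq_of_leave hN hs hs' hp hyz
  subst this
  exact ⟨rfl, rfl, rfl⟩

theorem Cross.unique (hN : 1 ≤ N) (h : SameCode N e e') (h1 : Cross N κ e.1 e.2 a y y')
    (h2 : Cross N κ e'.1 e'.2 a z z') (hyz : y = z ∨ y' = z') : e = e' ∧ y = z ∧ y' = z' := by
  obtain ⟨i, hi, ⟨hs, -⟩, rfl, rfl, rfl⟩ := h1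
  obtain ⟨i', hi', ⟨hs', -⟩, hp, rfl, rfl⟩ := h2
  have hii : i = i' := by simpa [length_phase] using congrArg List.length hp
  subst hii
  have := h.eq_of_cross hN hs hs' hp hyz
  subst this
  exact ⟨rfl, rfl, rfl⟩

theorem Enter.unique (hN : 1 ≤ N) (h : SameCode N e e') (h1 : Enter N κ e.1 e.2 a y y')
    (h2 : Enter N κ e'.1 e'.2 a z z') (hyz : y = z ∨ y' = z') : e = e' ∧ y = z ∧ y' = z' := by
  obtain ⟨i, hi, hs, rfl, rfl, rfl⟩ := h1
  obtain ⟨i', hi', hs', hp, rfl, rfl⟩ := h2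
  have hii : i = i' := by simpa [length_phase] using congrArg List.length hp
  subst hii
  have := h.eq_of_enter hN hs hs' hp hyz
  subst this
  exact ⟨rfl, rfl, rfl⟩

/-- Pigeonhole over pairs of a message and the processor at its other end: the code is injective on
them. -/
theorem sum_card_filter_le {α β ι : Type} [Fintype α] [Fintype ι] [DecidableEq ι]
    (R : α → ι → Prop) [∀ z, DecidablePred fun e => R e z] (f : α → β) (C : Finset β)
    (hf : ∀ e z, R e z → f e ∈ C)
    (hR : ∀ e z e' z', R e z → R e' z' → f e = f e' → e = e' ∧ z = z') :
    ∑ z, (Finset.univ.filter fun e => R e z).card ≤ C.card := by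
  rw [← Finset.card_sigma]
  refine Finset.card_le_card_of_injOn (fun p => f p.2) (fun p hp => ?_) fun p hp p' hp' h => ?_
  · rw [Finset.mem_coe, Finset.mem_sigma, Finset.mem_filter] at hp
    exact hf _ _ hp.2.2
  · rw [Finset.mem_coe, Finset.mem_sigma, Finset.mem_filter] at hp hp'
    obtain ⟨z, e⟩ := p
    obtain ⟨z', e'⟩ := p'
    obtain ⟨rfl, rfl⟩ := hR _ _ _ _ hp.2.2 hp'.2.2 h
    rfl

open Classical in
theorem sum_card_arcs_le (R : StencilNode (2 ^ N) → StencilNode (2 ^ N) → Fin (2 ^ N) → Prop)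
    (hR : ∀ e e' z z', SameCode N e e' → R e.1 e.2 z → R e'.1 e'.2 z' → e = e' ∧ z = z') :
    ∑ z, (Finset.univ.filter fun e : StencilNode (2 ^ N) × StencilNode (2 ^ N) =>
      StencilArc e.1 e.2 ∧ R e.1 e.2 z).card ≤ 6 :=
  sum_card_filter_le _ (arcCode N) (Finset.range 3 ×ˢ Finset.range 2)
    (fun _ _ h => arcCode_mem h.1) fun _ _ _ _ h h' hc => hR _ _ _ _ ⟨h.1, h'.1, hc⟩ h.2 h'.2

open Classical in
theorem card_values_le (π : Equiv.Perm (Fin (2 ^ N))) (s : ℕ) (y y' : Fin (2 ^ N)) :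
    (values N κ π s y y').card ≤
      (Finset.univ.filter fun e : StencilNode (2 ^ N) × StencilNode (2 ^ N) =>
        StencilArc e.1 e.2 ∧ Leave N κ e.1 e.2 (path N κ s) y y').card +
      (Finset.univ.filter fun e : StencilNode (2 ^ N) × StencilNode (2 ^ N) =>
        StencilArc e.1 e.2 ∧ Cross N κ e.1 e.2 (path N κ s) y y').card +
      (Finset.univ.filter fun e : StencilNode (2 ^ N) × StencilNode (2 ^ N) =>
        StencilArc e.1 e.2 ∧ Enter N κ e.1 e.2 (path N κ s) y y').card +
      (Finset.univ.filter fun w : StencilNode (2 ^ N) =>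
        w.2.val = 0 ∧ π w.1 = y ∧ home N w = y').card := by
  rw [values, Multiset.card_add, Multiset.card_map, Multiset.card_map, Finset.card_val,
    Finset.card_val]
  refine Nat.add_le_add ?_ (Finset.card_le_card fun w hw => ?_)
  · refine le_trans (Finset.card_le_card fun e he => ?_)
      ((Finset.card_union_le _ _).trans (Nat.add_le_add_right (Finset.card_union_le _ _) _))
    simp only [Finset.mem_union, Finset.mem_filter, Finset.mem_univ, true_and] at he ⊢
    obtain ⟨ha, -, h | h | h⟩ := he
    · exact Or.inl (Or.inl ⟨ha, h⟩)
    · exact Or.inl (Or.inr ⟨ha, h⟩)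
    · exact Or.inr ⟨ha, h⟩
  · simp only [Finset.mem_filter, Finset.mem_univ, true_and] at hw ⊢
    exact ⟨hw.2.1, hw.2.2.1, hw.2.2.2.1⟩

theorem input_unique {π : Equiv.Perm (Fin (2 ^ N))} {w w' : StencilNode (2 ^ N)}
    {y y' z z' : Fin (2 ^ N)} (h : w.2.val = 0 ∧ π w.1 = y ∧ home N w = y')
    (h' : w'.2.val = 0 ∧ π w'.1 = z ∧ home N w' = z') (hyz : y = z ∨ y' = z') :
    w = w' ∧ y = z ∧ y' = z' := by
  obtain ⟨h1, rfl, h3⟩ := h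
  obtain ⟨h1', rfl, h3'⟩ := h'
  have ht : w.2 = w'.2 := Fin.ext (h1.trans h1'.symm)
  have : w = w' := by
    rcases hyz with h | h
    · exact Prod.ext (π.injective h) ht
    · exact eq_of_home_eq ht (h3.trans ((congrArg Fin.val h).trans h3'.symm))
  subst this
  exact ⟨rfl, rfl, Fin.ext (h3.symm.trans h3')⟩

/-- In a superstep, a virtual processor sends and receives a bounded number of node values. -/
theorem relationDegree_values_le (hN : 1 ≤ N) (π : Equiv.Perm (Fin (2 ^ N))) (s : ℕ) :
    relationDegree (values N κ π s) ≤ 19 := by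
  classical
  -- Three kinds of moves with six codes each, and one input: `3 · 6 + 1 = 19`.
  refine relationDegree_le (fun y => ?_) fun y' => ?_
  · refine (Finset.sum_le_sum_of_subset (Finset.subset_univ _)).trans
      ((Finset.sum_le_sum fun y' _ => card_values_le π s y y').trans ?_)
    rw [Finset.sum_add_distrib, Finset.sum_add_distrib, Finset.sum_add_distrib]
    have h1 := sum_card_arcs_le
      (fun w w' (z : Fin (2 ^ N)) => Leave N κ w w' (path N κ s) y z) fun e e' z z' hc h h' => by
        obtain ⟨h1, -, h2⟩ := h.unique hN hc h' (Or.inl rfl)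
        exact ⟨h1, Fin.ext h2⟩
    have h2 := sum_card_arcs_le
      (fun w w' (z : Fin (2 ^ N)) => Cross N κ w w' (path N κ s) y z) fun e e' z z' hc h h' => by
        obtain ⟨h1, -, h2⟩ := h.unique hN hc h' (Or.inl rfl)
        exact ⟨h1, Fin.ext h2⟩
    have h3 := sum_card_arcs_le
      (fun w w' (z : Fin (2 ^ N)) => Enter N κ w w' (path N κ s) y z) fun e e' z z' hc h h' => by
        obtain ⟨h1, -, h2⟩ := h.unique hN hc h' (Or.inl rfl)
        exact ⟨h1, Fin.ext h2⟩
    have h4 := sum_card_filter_le (fun (w : StencilNode (2 ^ N)) (z : Fin (2 ^ N)) =>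
        w.2.val = 0 ∧ π w.1 = y ∧ home N w = z) (fun _ => ()) {()}
      (fun _ _ _ => Finset.mem_singleton_self _) fun w z w' z' h h' _ => by
        obtain ⟨h1, -, h2⟩ := input_unique h h' (Or.inl rfl)
        exact ⟨h1, h2⟩
    rw [Finset.card_singleton] at h4
    exact Nat.add_le_add (Nat.add_le_add (Nat.add_le_add h1 h2) h3) h4
  · refine (Finset.sum_le_sum_of_subset (Finset.subset_univ _)).trans
      ((Finset.sum_le_sum fun y _ => card_values_le π s y y').trans ?_)
    rw [Finset.sum_add_distrib, Finset.sum_add_distrib, Finset.sum_add_distrib]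
    have h1 := sum_card_arcs_le
      (fun w w' (z : Fin (2 ^ N)) => Leave N κ w w' (path N κ s) z y') fun e e' z z' hc h h' => by
        obtain ⟨h1, h2, -⟩ := h.unique hN hc h' (Or.inr rfl)
        exact ⟨h1, Fin.ext h2⟩
    have h2 := sum_card_arcs_le
      (fun w w' (z : Fin (2 ^ N)) => Cross N κ w w' (path N κ s) z y') fun e e' z z' hc h h' => by
        obtain ⟨h1, h2, -⟩ := h.unique hN hc h' (Or.inr rfl)
        exact ⟨h1, Fin.ext h2⟩
    have h3 := sum_card_arcs_le
      (fun w w' (z : Fin (2 ^ N)) => Enter N κ w w' (path N κ s) z y') fun e e' z z' hc h h' => by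
        obtain ⟨h1, h2, -⟩ := h.unique hN hc h' (Or.inr rfl)
        exact ⟨h1, Fin.ext h2⟩
    have h4 := sum_card_filter_le (fun (w : StencilNode (2 ^ N)) (z : Fin (2 ^ N)) =>
        w.2.val = 0 ∧ π w.1 = z ∧ home N w = y') (fun _ => ()) {()}
      (fun _ _ _ => Finset.mem_singleton_self _) fun w z w' z' h h' _ => by
        obtain ⟨h1, h2, -⟩ := input_unique h h' (Or.inr rfl)
        exact ⟨h1, h2⟩
    rw [Finset.card_singleton] at h4
    exact Nat.add_le_add (Nat.add_le_add (Nat.add_le_add h1 h2) h3) h4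

end Degree

end DiamondStencil

namespace DiamondStencil

open StaticAlg

/-! ## Dummy messages and wiseness -/

section Dummies

variable {N κ : ℕ}

/-- The virtual processor whose index differs in bit `i`, counted from the most significant one. -/
def partner (hN : 1 ≤ N) (i : ℕ) (y : Fin (2 ^ N)) : Fin (2 ^ N) :=
  ⟨y.val ^^^ 2 ^ (N - 1 - i),
    Nat.xor_lt_two_pow y.isLt (Nat.pow_lt_pow_right (by norm_num) (by omega))⟩

theorem partner_partner (hN : 1 ≤ N) (i : ℕ) (y : Fin (2 ^ N)) :
    partner hN i (partner hN i y) = y :=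
  Fin.ext (Nat.xor_xor_cancel_right _ _)

theorem dummies_eq (hN : 1 ≤ N) (π : Equiv.Perm (Fin (2 ^ N))) (s : ℕ) (y y' : Fin (2 ^ N)) :
    dummies N κ π s y y' = if y' = partner hN (stepLabel κ (path N κ s)) y then
      Multiset.replicate (2 * relationDegree (values N κ π s) - outDegree (values N κ π s) y) none
    else 0 := by
  simp only [dummies, partner, Fin.ext_iff, path]

theorem card_dummies_le (hN : 1 ≤ N) (π : Equiv.Perm (Fin (2 ^ N))) (s : ℕ)
    (y y' : Fin (2 ^ N)) : (dummies N κ π s y y').card ≤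
      if y' = partner hN (stepLabel κ (path N κ s)) y then 2 * relationDegree (values N κ π s)
      else 0 := by
  rw [dummies_eq hN]
  split_ifs
  · rw [Multiset.card_replicate]; exact Nat.sub_le _ _
  · simp

/-- `partner` is an involution, so a virtual processor receives dummies from one other only; these
at most double-count the degree `d` of the values to `d + 2 d`. -/
theorem relationDegree_sent_le (hN : 1 ≤ N) (π : Equiv.Perm (Fin (2 ^ N)))
    (s : Fin (alg N κ π).len) :
    relationDegree ((alg N κ π).sent s) ≤ 3 * relationDegree (values N κ π s) := by
  refine relationDegree_le (fun y => ?_) fun y' => ?_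
  · have h1 := outDegree_le_relationDegree (values N κ π s) y
    have h2 : ∑ y' ∈ Finset.univ.erase y, (dummies N κ π s y y').card ≤
        2 * relationDegree (values N κ π s) := by
      refine (Finset.sum_le_sum_of_subset (Finset.subset_univ _)).trans
        ((Finset.sum_le_sum fun y' _ => card_dummies_le hN π s y y').trans ?_)
      simp
    have h3 : outDegree ((alg N κ π).sent s) y =
        outDegree (values N κ π s) y + ∑ y' ∈ Finset.univ.erase y, (dummies N κ π s y y').card := by
      unfold outDegree
      rw [← Finset.sum_add_distrib]
      exact Finset.sum_congr rfl fun y' _ => Multiset.card_add _ _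
    omega
  · have h1 := inDegree_le_relationDegree (values N κ π s) y'
    have h2 : ∑ y ∈ Finset.univ.erase y', (dummies N κ π s y y').card ≤
        2 * relationDegree (values N κ π s) := by
      refine (Finset.sum_le_sum_of_subset (Finset.subset_univ _)).trans
        ((Finset.sum_le_sum fun y _ => card_dummies_le hN π s y y').trans ?_)
      have : ∀ y, y' = partner hN (stepLabel κ (path N κ s)) y ↔
          y = partner hN (stepLabel κ (path N κ s)) y' := by
        intro y
        constructor <;> rintro rfl <;> rw [partner_partner]
      simp only [this, Finset.sum_ite_eq', Finset.mem_univ, if_true, le_refl]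
    have h3 : inDegree ((alg N κ π).sent s) y' =
        inDegree (values N κ π s) y' + ∑ y ∈ Finset.univ.erase y', (dummies N κ π s y y').card := by
      unfold inDegree
      rw [← Finset.sum_add_distrib]
      exact Finset.sum_congr rfl fun y _ => Multiset.card_add _ _
    omega

theorem blockOf_partner_ne (hN : 1 ≤ N) {i j : ℕ} (hij : i < j) (hjN : j ≤ N) (y : Fin (2 ^ N)) :
    blockOf hjN (partner hN i y) ≠ blockOf hjN y := by
  intro h
  have h1 : (y.val ^^^ 2 ^ (N - 1 - i)) / 2 ^ (N - j) = y.val / 2 ^ (N - j) := congrArg Fin.val h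
  rw [← Nat.shiftRight_eq_div_pow, ← Nat.shiftRight_eq_div_pow, Nat.shiftRight_xor_distrib] at h1
  have h2 : 2 ^ (N - 1 - i) >>> (N - j) = 0 := by
    have := congrArg (fun z => y.val >>> (N - j) ^^^ z) h1
    simpa using this
  rw [Nat.shiftRight_eq_div_pow, Nat.pow_div (by omega) (by norm_num)] at h2
  exact absurd h2 (by positivity)

/-- The dummy messages of a superstep with label `i < j` leave the blocks of the folding on `2 ^ j`
processors. -/
theorem le_relationDegree_fold (hN : 1 ≤ N) (π : Equiv.Perm (Fin (2 ^ N)))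
    (s : Fin (alg N κ π).len) {j : ℕ} (hj : (alg N κ π).label s < j) (hjN : j ≤ N) :
    2 ^ (N - j) * relationDegree (values N κ π s) ≤
      relationDegree (((alg N κ π).fold j).sent s) := by
  let R : Fin (2 ^ j) := ⟨0, by positivity⟩
  refine le_trans ?_ (outDegree_le_relationDegree _ R)
  refine le_trans ?_ (outDegree_fold ((alg N κ π).sent s) j R).ge
  rw [← card_block hjN R, ← smul_eq_mul]
  refine Finset.card_nsmul_le_sum _ _ _ fun y hy => ?_
  set i := stepLabel κ (path N κ s) with hi
  have hmem : partner hN i y ∈ (Finset.univ.erase R).biUnion (block N j) := by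
    refine Finset.mem_biUnion.2 ⟨_, ?_, mem_block_blockOf hjN _⟩
    rw [Finset.mem_erase]
    refine ⟨?_, Finset.mem_univ _⟩
    rw [← (mem_block_iff_blockOf hjN).1 hy]
    exact blockOf_partner_ne hN hj hjN y
  refine le_trans ?_ (Finset.single_le_sum
    (f := fun y' => ((alg N κ π).sent s y y').card) (fun _ _ => Nat.zero_le _) hmem)
  -- At most `d` of the `2 d` messages of `y` carry values, so at least `d` dummies go to the
  -- partner, outside the block.
  have h1 := outDegree_le_relationDegree (values N κ π s) y
  have h2 : (dummies N κ π s y (partner hN i y)).card =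
      2 * relationDegree (values N κ π s) - outDegree (values N κ π s) y := by
    rw [dummies_eq hN, if_pos rfl, Multiset.card_replicate]
  change _ ≤ (values N κ π s y (partner hN i y) + dummies N κ π s y (partner hN i y)).card
  rw [Multiset.card_add, h2]
  omega

/-- Superstep by superstep: with `d` the degree of the values, the unfolded degree is at most `3 d`
and the folded one at least `2 ^ (N - j) * d`. -/
theorem alg_wise (hN : 1 ≤ N) (π : Equiv.Perm (Fin (2 ^ N))) : (alg N κ π).Wise (1 / 3) N := by
  intro j hj hjN
  have h : 2 ^ (N - j) * ∑ i ∈ Finset.range j, ((alg N κ π).fold N).F i ≤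
      3 * ∑ i ∈ Finset.range j, ((alg N κ π).fold j).F i := by
    rw [sum_range_F, sum_range_F, Finset.mul_sum, Finset.mul_sum]
    refine Finset.sum_le_sum fun s hs => ?_
    have hl : (alg N κ π).label s < j := (Finset.mem_filter.1 hs).2
    have h1 := relationDegree_fold_le (alg N κ π) le_rfl s
    rw [Nat.sub_self, pow_zero, one_mul] at h1
    calc _ ≤ 2 ^ (N - j) * (3 * relationDegree (values N κ π s)) :=
          Nat.mul_le_mul_left _ (h1.trans (relationDegree_sent_le hN π s))
      _ = 3 * (2 ^ (N - j) * relationDegree (values N κ π s)) := by ring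
      _ ≤ _ := Nat.mul_le_mul_left _ (le_relationDegree_fold hN π s hl hjN)
  have h' : (2 : ℝ) ^ (N - j) * ∑ i ∈ Finset.range j, (((alg N κ π).fold N).F i : ℝ) ≤
      3 * ∑ i ∈ Finset.range j, (((alg N κ π).fold j).F i : ℝ) := by exact_mod_cast h
  rw [pow_sub₀ _ two_ne_zero hjN, ← div_eq_mul_inv] at h'
  linarith

/-! ## Upper bounds -/

theorem F_fold_le (hN : 1 ≤ N) (π : Equiv.Perm (Fin (2 ^ N))) {j : ℕ} (hjN : j ≤ N) (i : ℕ) :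
    ((alg N κ π).fold j).F i ≤ 57 * 2 ^ (N - j) * (alg N κ π).S i := by
  rw [mul_comm, S, F, ← smul_eq_mul]
  refine Finset.sum_le_card_nsmul _ _ _ fun s _ => ?_
  have h1 := relationDegree_sent_le hN π s
  have h2 := relationDegree_values_le (κ := κ) hN π s
  calc _ ≤ _ := relationDegree_fold_le (alg N κ π) hjN s
    _ ≤ 2 ^ (N - j) * 57 := Nat.mul_le_mul_left _ (by omega)
    _ = _ := mul_comm _ _

/-- A label below `j` means at most `(j - 1) / κ + 1` stripe numbers. Each contributes a factor `2 ^
(κ + 1)`: the rounding of `j` to multiples of `κ` costs `2 ^ κ`, the doubled number of stripes `2 ^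
((j - 1) / κ)`. -/
theorem sum_S_le (hκ : 0 < κ) (π : Equiv.Perm (Fin (2 ^ N))) {j : ℕ} (hj : 1 ≤ j) :
    ∑ i ∈ Finset.range j, (alg N κ π).S i ≤ 6 * 2 ^ (j + κ + (j - 1) / κ) := by
  rw [sum_range_S]
  have h := countP_program_le N κ ((j - 1) / κ + 1)
  rw [← card_filter_path] at h
  refine (Finset.card_le_card fun s hs => ?_).trans (h.trans (Nat.mul_le_mul_left _
    (Nat.pow_le_pow_right (by norm_num) ?_)))
  · replace hs : ((path N κ s).length - 2) * κ < j := (Finset.mem_filter.1 hs).2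
    refine Finset.mem_filter.2 ⟨Finset.mem_univ _, decide_eq_true ?_⟩
    have := (Nat.le_div_iff_mul_le hκ).2 (show ((path N κ s).length - 2) * κ ≤ j - 1 by omega)
    omega
  · have := Nat.mul_div_le (j - 1) κ
    calc (κ + 1) * ((j - 1) / κ + 1) = κ * ((j - 1) / κ) + κ + (j - 1) / κ + 1 := by ring
      _ ≤ j + κ + (j - 1) / κ := by omega

end Dummies

end DiamondStencil

/-! ## The recursion degree -/

theorem lg_two_pow {N : ℕ} (hN : 1 ≤ N) : lg (2 ^ N) = N := by
  rw [lg, Real.logb_pow, Real.logb_self_eq_one (by norm_num), mul_one]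
  exact max_eq_right (by exact_mod_cast hN)

theorem ceil_sqrt_lg_pos (x : ℝ) : 0 < ⌈√(lg x)⌉₊ :=
  Nat.ceil_pos.2 (Real.sqrt_pos.2 (lt_of_lt_of_le one_pos (le_max_left _ _)))

theorem one_le_four_rpow_sqrt (x : ℝ) : 1 ≤ (4 : ℝ) ^ √x :=
  Real.one_le_rpow (by norm_num) (Real.sqrt_nonneg _)

/-- The choice of `κ` near `√N` balances the two losses `κ` and `N / κ`; each is about `√N`, and the
ceiling costs the factor `2`. -/
theorem two_pow_ceil_add_div_le {N m : ℕ} (hN : 1 ≤ N) (hm : m ≤ N) :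
    (2 : ℝ) ^ (⌈√(lg (2 ^ N))⌉₊ + m / ⌈√(lg (2 ^ N))⌉₊) ≤ 2 * (4 : ℝ) ^ √(lg (2 ^ N)) := by
  have hκ := ceil_sqrt_lg_pos (2 ^ N)
  have hceil : (⌈√(lg (2 ^ N))⌉₊ : ℝ) < √(lg (2 ^ N)) + 1 := Nat.ceil_lt_add_one (Real.sqrt_nonneg _)
  have hle : √(lg (2 ^ N)) ≤ ⌈√(lg (2 ^ N))⌉₊ := Nat.le_ceil _
  have hdiv : ((m / ⌈√(lg (2 ^ N))⌉₊ : ℕ) : ℝ) ≤ √(lg (2 ^ N)) := by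
    generalize ⌈√(lg (2 ^ N))⌉₊ = κ at *
    refine Nat.cast_div_le.trans ((div_le_iff₀ (by exact_mod_cast hκ)).2 ?_)
    have h1 : √(lg (2 ^ N)) * √(lg (2 ^ N)) = N := by
      rw [Real.mul_self_sqrt (by rw [lg_two_pow hN]; positivity), lg_two_pow hN]
    calc (m : ℝ) ≤ N := by exact_mod_cast hm
      _ = √(lg (2 ^ N)) * √(lg (2 ^ N)) := h1.symm
      _ ≤ √(lg (2 ^ N)) * κ := mul_le_mul_of_nonneg_left hle (Real.sqrt_nonneg _)
  rw [← Real.rpow_natCast, show (4 : ℝ) = 2 ^ (2 : ℝ) by norm_num, ← Real.rpow_mul (by norm_num)]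
  calc (2 : ℝ) ^ ((⌈√(lg (2 ^ N))⌉₊ + m / ⌈√(lg (2 ^ N))⌉₊ : ℕ) : ℝ)
      ≤ 2 ^ (1 + 2 * √(lg (2 ^ N))) := by
        refine Real.rpow_le_rpow_of_exponent_le (by norm_num) ?_
        rw [Nat.cast_add]
        linarith
    _ = _ := by rw [Real.rpow_add (by norm_num), Real.rpow_one]

theorem sum_S_stencilAlg_le {N j : ℕ} (hj : 1 ≤ j) (hjN : j ≤ N) (π : Equiv.Perm (Fin (2 ^ N))) :
    ∑ i ∈ Finset.range j, ((stencilAlg N π).S i : ℝ) ≤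
      12 * 2 ^ j * (4 : ℝ) ^ √(lg (2 ^ N)) := by
  have h : ∑ i ∈ Finset.range j, (stencilAlg N π).S i ≤
      6 * 2 ^ (j + ⌈√(lg (2 ^ N))⌉₊ + (j - 1) / ⌈√(lg (2 ^ N))⌉₊) :=
    DiamondStencil.sum_S_le (ceil_sqrt_lg_pos (2 ^ N)) π hj
  have h' : ∑ i ∈ Finset.range j, ((stencilAlg N π).S i : ℝ) ≤
      6 * 2 ^ (j + ⌈√(lg (2 ^ N))⌉₊ + (j - 1) / ⌈√(lg (2 ^ N))⌉₊) := by exact_mod_cast h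
  refine h'.trans ?_
  rw [add_assoc, pow_add]
  have h2 := two_pow_ceil_add_div_le (m := j - 1) (hj.trans hjN) (by omega)
  calc _ = 6 * 2 ^ j * (2 : ℝ) ^ (⌈√(lg (2 ^ N))⌉₊ + (j - 1) / ⌈√(lg (2 ^ N))⌉₊) := by ring
    _ ≤ 6 * 2 ^ j * (2 * (4 : ℝ) ^ √(lg (2 ^ N))) := by gcongr
    _ = _ := by ring

theorem StaticAlg.H_eq_D {V : Type} {Q : ℕ} (A : StaticAlg V Q) (σ : ℝ) :
    A.H σ = A.D (fun _ => 1) (fun _ => σ) := by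
  simp [H, D]

theorem D_stencilAlg_le {N j : ℕ} (hj : 1 ≤ j) (hjN : j ≤ N) (π : Equiv.Perm (Fin (2 ^ N)))
    {c : ℝ} {g ℓ : ℕ → ℝ} (hg : ∀ i < j, 0 < g i)
    (hℓ : ∀ i < j, ℓ i ≤ c * ((2 : ℝ) ^ N / 2 ^ j) * g i) :
    ((stencilAlg N π).fold j).D g ℓ ≤ ∑ i ∈ Finset.range j,
      (57 + c) * ((2 : ℝ) ^ N / 2 ^ j) * (stencilAlg N π).S i * g i := by
  refine Finset.sum_le_sum fun i hi => ?_
  rw [Finset.mem_range] at hi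
  have h1 : (((stencilAlg N π).fold j).F i : ℝ) ≤
      57 * ((2 : ℝ) ^ N / 2 ^ j) * (stencilAlg N π).S i := by
    have : ((stencilAlg N π).fold j).F i ≤ 57 * 2 ^ (N - j) * (stencilAlg N π).S i :=
      DiamondStencil.F_fold_le (hj.trans hjN) π hjN i
    have h2 : (((stencilAlg N π).fold j).F i : ℝ) ≤
      57 * (2 : ℝ) ^ (N - j) * (stencilAlg N π).S i := by exact_mod_cast this
    rwa [pow_sub₀ _ two_ne_zero hjN, ← div_eq_mul_inv] at h2
  have hS : (((stencilAlg N π).fold j).S i : ℝ) = (stencilAlg N π).S i := rfl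
  rw [hS]
  have h3 := mul_le_mul_of_nonneg_right h1 (hg i hi).le
  have h4 := mul_le_mul_of_nonneg_left (hℓ i hi) (Nat.cast_nonneg (α := ℝ) ((stencilAlg N π).S i))
  calc _ ≤ _ := add_le_add h3 h4
    _ = _ := by ring

/-! ## Optimality -/

/-- Summation by parts: domination of the partial sums is preserved by non-increasing weights. -/
theorem sum_mul_le_sum_mul_of_partial_sums_le {a b g : ℕ → ℝ} {j : ℕ} (hg : ∀ i < j, 0 < g i)
    (hmono : ∀ i, i + 1 < j → g (i + 1) ≤ g i)
    (h : ∀ m, 1 ≤ m → m ≤ j → ∑ i ∈ Finset.range m, a i ≤ ∑ i ∈ Finset.range m, b i) :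
    ∑ i ∈ Finset.range j, a i * g i ≤ ∑ i ∈ Finset.range j, b i * g i := by
  -- Since the partial sums of `b - a` are nonnegative, replacing the weight `g m` of the
  -- accumulated sum by the smaller `g (m + 1)` only decreases it.
  have key : ∀ m, m < j → g m * ∑ i ∈ Finset.range (m + 1), (b i - a i) ≤
      ∑ i ∈ Finset.range (m + 1), (b i - a i) * g i := by
    intro m
    induction m with
    | zero => intro _; simp [mul_comm]
    | succ m ih =>
      intro hm
      rw [Finset.sum_range_succ, Finset.sum_range_succ _ (m + 1), mul_add]
      have h1 : 0 ≤ ∑ i ∈ Finset.range (m + 1), (b i - a i) := by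
        rw [Finset.sum_sub_distrib, sub_nonneg]
        exact h _ (by omega) (by omega)
      have h2 := mul_le_mul_of_nonneg_right (hmono m hm) h1
      have h3 := ih (by omega)
      linarith
  rcases Nat.eq_zero_or_pos j with rfl | hj
  · simp
  · obtain ⟨m, rfl⟩ := Nat.exists_eq_add_of_le' hj
    have h1 : 0 ≤ ∑ i ∈ Finset.range (m + 1), (b i - a i) := by
      rw [Finset.sum_sub_distrib, sub_nonneg]
      exact h _ (by omega) le_rfl
    have h2 := key m (by omega)
    have h3 := mul_nonneg (hg m (by omega)).le h1
    have h4 : ∑ i ∈ Finset.range (m + 1), (b i - a i) * g i =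
        ∑ i ∈ Finset.range (m + 1), b i * g i - ∑ i ∈ Finset.range (m + 1), a i * g i := by
      rw [← Finset.sum_sub_distrib]
      exact Finset.sum_congr rfl fun i _ => sub_mul _ _ _
    linarith

/-- The lower bound holds on every machine on which the algorithm can be folded. -/
theorem ClassC1.le_sum_F {ε : ℝ} (hε : ε < 1) {N j m : ℕ} (hN : 1 ≤ N) (hm : 1 ≤ m) (hmj : m ≤ j)
    {B : StaticAlg (StencilNode (2 ^ N)) j} (hB : ClassC1 ε B) :
    min (1 / 1024) ((1 - ε) / 2) * (2 : ℝ) ^ N * (2 ^ m / 2 ^ j) ≤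
      ∑ i ∈ Finset.range m, (B.F i : ℝ) := by
  rcases Nat.eq_or_lt_of_le hmj with rfl | hlt
  · rw [div_self (by positivity), mul_one]
    exact hB.1.le_sum_F hε hN
  · have h1 := (hB.2 m hm hlt).le_sum_F hε hN
    have h2 : ∑ i ∈ Finset.range m, ((B.fold m).F i : ℝ) ≤
        2 ^ (j - m) * ∑ i ∈ Finset.range m, (B.F i : ℝ) := by
      exact_mod_cast B.sum_range_F_fold_le hmj m
    rw [pow_sub₀ _ two_ne_zero hmj, ← div_eq_mul_inv] at h2
    have h3 : (2 : ℝ) ^ j / 2 ^ m * (2 ^ m / 2 ^ j) = 1 := by field_simp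
    calc _ ≤ (2 ^ j / 2 ^ m * ∑ i ∈ Finset.range m, (B.F i : ℝ)) * (2 ^ m / 2 ^ j) :=
          mul_le_mul_of_nonneg_right (h1.trans h2) (by positivity)
      _ = (2 : ℝ) ^ j / 2 ^ m * (2 ^ m / 2 ^ j) * ∑ i ∈ Finset.range m, (B.F i : ℝ) := by ring
      _ = _ := by rw [h3, one_mul]

theorem stencilAlg_optimalOnDBSP {ε c : ℝ} (hε : 1 / 2 ≤ ε) (hε1 : ε < 1) (hc : 0 ≤ c) :
    ∃ b : ℝ, 0 < b ∧ ∀ N j : ℕ, 1 ≤ j → j ≤ N → ∀ π : Equiv.Perm (Fin (2 ^ N)),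
      ∀ g ℓ : ℕ → ℝ, (∀ i < j, 0 < g i ∧ 0 ≤ ℓ i) →
        (∀ i, i + 1 < j → g (i + 1) ≤ g i ∧ ℓ (i + 1) / g (i + 1) ≤ ℓ i / g i) →
        ℓ 0 / g 0 ≤ c * ((2 : ℝ) ^ N / 2 ^ j) →
        StaticAlg.OptimalOnDBSP (ClassC1 ε) (b / (4 : ℝ) ^ √(lg (2 ^ N))) g ℓ
          ((stencilAlg N π).fold j) := by
  set c' : ℝ := min (1 / 1024) ((1 - ε) / 2)
  have hc' : 0 < c' := lt_min (by norm_num) (by linarith)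
  have hden : 0 < 12 * (57 + c) := by positivity
  -- `12` comes from the number of supersteps, `57 + c` from degree and latency of each, `c'` from
  -- the lower bound; the cap `1` keeps the optimality factor at most `1`.
  refine ⟨min 1 (c' / (12 * (57 + c))), lt_min one_pos (by positivity), ?_⟩
  intro N j hj hjN π g ℓ hpos hmono h0
  set b := min 1 (c' / (12 * (57 + c)))
  have hb : 0 < b := lt_min one_pos (by positivity)
  have hbc : b * (12 * (57 + c)) ≤ c' := (le_div_iff₀ hden).1 (min_le_right _ _)
  set X := (4 : ℝ) ^ √(lg (2 ^ N)) with hX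
  have hX1 : 1 ≤ X := one_le_four_rpow_sqrt _
  have hX0 : 0 < X := one_pos.trans_le hX1
  refine ⟨by positivity, (div_le_one hX0).2 ((min_le_left _ _).trans hX1),
    DiamondStencil.alg_fold_classC1 hε (ceil_sqrt_lg_pos _) hj hjN π, fun B hB => ?_⟩
  have hratio : ∀ i < j, ℓ i / g i ≤ c * ((2 : ℝ) ^ N / 2 ^ j) := by
    intro i
    induction i with
    | zero => intro _; exact h0
    | succ i ih => intro hi; exact (hmono i hi).2.trans (ih (by omega))
  have hD := D_stencilAlg_le hj hjN π (c := c) (g := g) (ℓ := ℓ) (fun i hi => (hpos i hi).1)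
    (fun i hi => (div_le_iff₀ (hpos i hi).1).1 (hratio i hi))
  -- Single labels cannot be compared, only initial segments of labels: a competitor is free to
  -- choose at which label it communicates.
  have hsum := sum_mul_le_sum_mul_of_partial_sums_le
    (a := fun i => (57 + c) * ((2 : ℝ) ^ N / 2 ^ j) * (stencilAlg N π).S i)
    (b := fun i => 1 / (b / X) * B.F i) (g := g) (j := j) (fun i hi => (hpos i hi).1)
    (fun i hi => (hmono i hi).1) (fun m hm hmj => by
      rw [← Finset.mul_sum, ← Finset.mul_sum]
      have h1 := sum_S_stencilAlg_le hm (hmj.trans hjN) π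
      have h2 := hB.le_sum_F hε1 (hj.trans hjN) hm hmj
      rw [← hX] at h1
      rw [one_div_div]
      calc (57 + c) * ((2 : ℝ) ^ N / 2 ^ j) * ∑ i ∈ Finset.range m, ((stencilAlg N π).S i : ℝ)
          ≤ (57 + c) * ((2 : ℝ) ^ N / 2 ^ j) * (12 * 2 ^ m * X) :=
            mul_le_mul_of_nonneg_left h1 (by positivity)
        _ = X / b * (b * (12 * (57 + c)) * (2 : ℝ) ^ N * (2 ^ m / 2 ^ j)) := by
          field_simp
        _ ≤ X / b * (c' * (2 : ℝ) ^ N * (2 ^ m / 2 ^ j)) := by gcongr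
        _ ≤ X / b * ∑ i ∈ Finset.range m, (B.F i : ℝ) :=
            mul_le_mul_of_nonneg_left h2 (by positivity))
  refine hD.trans (hsum.trans ?_)
  rw [StaticAlg.D, Finset.mul_sum]
  refine Finset.sum_le_sum fun i hi => ?_
  rw [mul_assoc]
  refine mul_le_mul_of_nonneg_left (le_add_of_nonneg_right ?_) (by positivity)
  exact mul_nonneg (Nat.cast_nonneg _) (hpos i (Finset.mem_range.1 hi)).2

theorem mainTheorem9 :
    -- the algorithm is a static `M(n)`-algorithm in the class, for every even placement of the inputs
    (∀ N : ℕ, 1 ≤ N → ∀ π : Equiv.Perm (Fin (2 ^ N)),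
      (stencilAlg N π).IsSpecification ∧ ClassC1 (1 / 2) (stencilAlg N π)) ∧
    -- communication complexity on `M(p, σ)`, for `n = 2 ^ N` and `p = 2 ^ j`
    (∀ c : ℝ, 0 ≤ c → ∃ K : ℝ, 0 < K ∧
      ∀ N j : ℕ, 1 ≤ j → j ≤ N → ∀ π : Equiv.Perm (Fin (2 ^ N)),
      ∀ σ : ℝ, 0 ≤ σ → σ ≤ c * ((2 : ℝ) ^ N / 2 ^ j) →
        ((stencilAlg N π).fold j).H σ ≤ K * ((2 : ℝ) ^ N * (4 : ℝ) ^ √(lg (2 ^ N)))) ∧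
    -- `(Θ(1), n)`-wiseness
    (∃ α : ℝ, 0 < α ∧ α ≤ 1 ∧
      ∀ N : ℕ, 1 ≤ N → ∀ π : Equiv.Perm (Fin (2 ^ N)), (stencilAlg N π).Wise α N) ∧
    -- `Ω(1 / 4 ^ √(log n))`-optimality on `M(p, σ)`
    (∀ ε : ℝ, 1 / 2 ≤ ε → ε < 1 → ∀ c : ℝ, 0 ≤ c → ∃ b : ℝ, 0 < b ∧
      ∀ N j : ℕ, 1 ≤ j → j ≤ N → ∀ π : Equiv.Perm (Fin (2 ^ N)),
      ∀ σ : ℝ, 0 ≤ σ → σ ≤ c * ((2 : ℝ) ^ N / 2 ^ j) →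
        StaticAlg.OptimalOnM (ClassC1 ε) (b / (4 : ℝ) ^ √(lg (2 ^ N))) σ
          ((stencilAlg N π).fold j)) ∧
    -- `Ω(1 / 4 ^ √(log n))`-optimality on `D-BSP(p, g, ℓ)`
    (∀ ε : ℝ, 1 / 2 ≤ ε → ε < 1 → ∀ c : ℝ, 0 ≤ c → ∃ b : ℝ, 0 < b ∧
      ∀ N j : ℕ, 1 ≤ j → j ≤ N → ∀ π : Equiv.Perm (Fin (2 ^ N)),
      ∀ g ℓ : ℕ → ℝ, (∀ i < j, 0 < g i ∧ 0 ≤ ℓ i) →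
        (∀ i, i + 1 < j → g (i + 1) ≤ g i ∧ ℓ (i + 1) / g (i + 1) ≤ ℓ i / g i) →
        ℓ 0 / g 0 ≤ c * ((2 : ℝ) ^ N / 2 ^ j) →
        StaticAlg.OptimalOnDBSP (ClassC1 ε) (b / (4 : ℝ) ^ √(lg (2 ^ N))) g ℓ
          ((stencilAlg N π).fold j)) := by
  refine ⟨fun N hN π => ⟨DiamondStencil.alg_isSpecification hN (ceil_sqrt_lg_pos _) π,
    DiamondStencil.alg_classC1 hN (ceil_sqrt_lg_pos _) π⟩, fun c hc => ?_,
    ⟨1 / 3, by norm_num, by norm_num, fun N hN π => DiamondStencil.alg_wise hN π⟩,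
    fun ε hε hε1 c hc => ?_, fun ε hε hε1 c hc => stencilAlg_optimalOnDBSP hε hε1 hc⟩
  · refine ⟨12 * (57 + c), by positivity, fun N j hj hjN π σ hσ hσc => ?_⟩
    rw [StaticAlg.H_eq_D]
    refine (D_stencilAlg_le hj hjN π (c := c) (fun _ _ => one_pos)
      (fun _ _ => by rwa [mul_one])).trans ?_
    simp only [mul_one]
    rw [← Finset.mul_sum]
    calc _ ≤ (57 + c) * ((2 : ℝ) ^ N / 2 ^ j) * (12 * 2 ^ j * (4 : ℝ) ^ √(lg (2 ^ N))) :=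
          mul_le_mul_of_nonneg_left (sum_S_stencilAlg_le hj hjN π) (by positivity)
      _ = _ := by field_simp
  · obtain ⟨b, hb, h⟩ := stencilAlg_optimalOnDBSP hε hε1 hc
    refine ⟨b, hb, fun N j hj hjN π σ hσ hσc => ?_⟩
    obtain ⟨h1, h2, h3, h4⟩ := h N j hj hjN π (fun _ => 1) (fun _ => σ)
      (fun _ _ => ⟨one_pos, hσ⟩) (fun _ _ => ⟨le_rfl, le_rfl⟩) (by simpa using hσc)
    refine ⟨h1, h2, h3, fun B hB => ?_⟩
    rw [StaticAlg.H_eq_D, StaticAlg.H_eq_D]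
    exact h4 B hB
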